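/- A literal is a propositional variable or its negation; a clause is a finite collection of literals derived from distinct variables; a formula $F$ is a finite collection of clauses, $\mathrm{Var}(F)$ is the set of variables appearing in it, $n=|\mathrm{Var}(F)|$, and $|F|$ is the length of $F$ (in a standard encoding, with binary names of variables). An x-model of $F$ is an assignment under which every clause has exactly one true literal; XSAT is the problem of deciding whether a formula has an x-model. For a program $S$ deciding XSAT, let $P$ be the following algorithm, which computes the maximum Hamming distance between two x-models of $F$ with $S$ as external solver. Set $ans:=\bot$. For $k=0,\dots,n$ and for every subset $X\subseteq \mathrm{Var}(F)$ of size $k$: let $C$ be the set of clauses of $F$ containing a literal derived from $X$, and let $C'$ be a copy of $C$ in which every literal derived from $X$ is flipped; if every clause of $C$ contains either $0$ or $2$ literals derived from $X$, and $S$ reports that $F\cup C'$ has an x-model, then set $ans:=k$. Finally return $ans$. We say that a program runs in polynomial space and time $O(a^n)$ if there is a polynomial $p$ such that on every formula $F$ it halts within time $p(|F|)\,a^{n}$ and space $p(|F|)$ (as usual for exponential-time algorithms, factors polynomial in the length of the input are suppressed in the time bound). Programs are programs of the WHILE language over binary trees; evaluating an expression costs the total size of the values of its subexpressions, and space is the total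 size of all values stored. **Theorem.** $P$ runs in polynomial space and time $O(2^n)$. Precisely: 1. There is a program $S$ deciding XSAT such that $P$ with the solver $S$ runs in polynomial space and time $O(2^n)$. 2. For every program $S$ that decides XSAT in polynomial space and time $O(1.1749^n)$, $P$ with the solver $S$ runs in polynomial space and time $O(2^n)$. -/

import Mathlib

/-! ## A machine model: WHILE programs over binary trees, with time and space -/

/-- The data values of the model: binary trees. -/
inductive Val : Type
  | nil : Val
  | cons : Val → Val → Val
  deriving DecidableEq

namespace Val

/-- The size of a value: its number of nodes. -/
def size : Val → ℕ
  | nil => 1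
  | cons a b => 1 + a.size + b.size

def head : Val → Val
  | nil => nil
  | cons a _ => a

def tail : Val → Val
  | nil => nil
  | cons _ b => b

/-- Truth values: `nil` is false; everything else counts as true. -/
def ofBool : Bool → Val
  | false => nil
  | true => cons nil nil

/-- A list is stored as a right comb. -/
def ofList : List Val → Val
  | [] => nil
  | a :: l => cons a (ofList l)

/-- A natural number is stored in binary (least significant bit first). -/
def ofNat (n : ℕ) : Val := ofList (n.bits.map ofBool)

end Val

/-- Expressions over `k` registers. -/
inductive Exp (k : ℕ) : Type
  | var : Fin k → Exp k
  | nil : Exp k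
  | cons : Exp k → Exp k → Exp k
  | hd : Exp k → Exp k
  | tl : Exp k → Exp k
  | eq : Exp k → Exp k → Exp k

instance (k : ℕ) : Coe (Fin k) (Exp k) := ⟨Exp.var⟩

/-- A store: the contents of the `k` registers. -/
abbrev Store (k : ℕ) := Fin k → Val

/-- The memory occupied by a store. -/
def Store.size {k : ℕ} (s : Store k) : ℕ := ∑ i, (s i).size

/-- The initial store on input `v`: the input is in register 0, all others are empty. -/
def Store.input (m : ℕ) (v : Val) : Store (m + 1) := Function.update (fun _ => Val.nil) 0 v

namespace Exp

def eval {k : ℕ} (s : Store k) : Exp k → Val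
  | var x => s x
  | nil => Val.nil
  | cons a b => Val.cons (a.eval s) (b.eval s)
  | hd a => (a.eval s).head
  | tl a => (a.eval s).tail
  | eq a b => Val.ofBool (decide (a.eval s = b.eval s))

/-- The cost of evaluating an expression: the total size of the values of all its
subexpressions. It is charged both as time and as temporary memory, so that copying and
comparing large values is not free. -/
def cost {k : ℕ} (s : Store k) : Exp k → ℕ
  | var x => (s x).size
  | nil => 1
  | cons a b => a.cost s + b.cost s + (eval s (cons a b)).size
  | hd a => a.cost s + (eval s (hd a)).size
  | tl a => a.cost s + (eval s (tl a)).size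
  | eq a b => a.cost s + b.cost s + (eval s (eq a b)).size

end Exp

/-- Commands over `k` registers. `call x p e` runs the program `p` in a fresh store of its own
on the value of `e`, and stores the final content of its register 0 in register `x`. -/
inductive Cmd : ℕ → Type
  | skip {k : ℕ} : Cmd k
  | assign {k : ℕ} (x : Fin k) (e : Exp k) : Cmd k
  | seq {k : ℕ} (c d : Cmd k) : Cmd k
  | ite {k : ℕ} (e : Exp k) (c d : Cmd k) : Cmd k
  | while {k : ℕ} (e : Exp k) (c : Cmd k) : Cmd k
  | call {k m : ℕ} (x : Fin k) (p : Cmd (m + 1)) (e : Exp k) : Cmd k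

infix:65 " ::= " => Cmd.assign
infixr:60 " ;; " => Cmd.seq

/-- `Exec c s s' t w`: started in the store `s`, the command `c` halts in the store `s'` after
time `t`, and the memory in use (registers of all active programs, and temporary values) never
exceeds `w`, this peak value being counted by the rules below. -/
inductive Exec : {k : ℕ} → Cmd k → Store k → Store k → ℕ → ℕ → Prop
  | skip {k : ℕ} (s : Store k) : Exec Cmd.skip s s 1 s.size
  | assign {k : ℕ} (x : Fin k) (e : Exp k) (s : Store k) :
      Exec (x ::= e) s (Function.update s x (e.eval s)) (e.cost s) (s.size + e.cost s)
  | seq {k : ℕ} {c d : Cmd k} {s s₁ s₂ : Store k} {t₁ t₂ w₁ w₂ : ℕ} :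
      Exec c s s₁ t₁ w₁ → Exec d s₁ s₂ t₂ w₂ → Exec (c ;; d) s s₂ (t₁ + t₂) (max w₁ w₂)
  | ite_true {k : ℕ} {e : Exp k} {c d : Cmd k} {s s₁ : Store k} {t w : ℕ} :
      e.eval s ≠ Val.nil → Exec c s s₁ t w →
      Exec (Cmd.ite e c d) s s₁ (e.cost s + t) (max (s.size + e.cost s) w)
  | ite_false {k : ℕ} {e : Exp k} {c d : Cmd k} {s s₁ : Store k} {t w : ℕ} :
      e.eval s = Val.nil → Exec d s s₁ t w →
      Exec (Cmd.ite e c d) s s₁ (e.cost s + t) (max (s.size + e.cost s) w)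
  | while_true {k : ℕ} {e : Exp k} {c : Cmd k} {s s₁ s₂ : Store k} {t₁ t₂ w₁ w₂ : ℕ} :
      e.eval s ≠ Val.nil → Exec c s s₁ t₁ w₁ → Exec (Cmd.while e c) s₁ s₂ t₂ w₂ →
      Exec (Cmd.while e c) s s₂ (e.cost s + t₁ + t₂) (max (s.size + e.cost s) (max w₁ w₂))
  | while_false {k : ℕ} {e : Exp k} {c : Cmd k} {s : Store k} :
      e.eval s = Val.nil → Exec (Cmd.while e c) s s (e.cost s) (s.size + e.cost s)
  | call {k m : ℕ} {x : Fin k} {p : Cmd (m + 1)} {e : Exp k} {s : Store k}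
      {s' : Store (m + 1)} {t w : ℕ} :
      Exec p (Store.input m (e.eval s)) s' t w →
      Exec (Cmd.call x p e) s (Function.update s x (s' 0)) (e.cost s + t) (s.size + e.cost s + w)

/-- `foreach x w e c`: run `c` for `x` ranging over the elements of the list `e`; the register
`w` holds the part of the list that is still to be visited. -/
def Cmd.foreach {k : ℕ} (x w : Fin k) (e : Exp k) (c : Cmd k) : Cmd k :=
  w ::= e ;;
  Cmd.while w (
    x ::= Exp.hd w ;;
    w ::= Exp.tl w ;;
    c)

/-! ## Formulas and exact satisfiability -/

/-- The literal `p` (if `pos = true`) or its negation, derived from the variable `p = var`. -/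
structure Literal where
  var : ℕ
  pos : Bool

abbrev Clause := List Literal

abbrev Formula := List Clause

/-- The literal is true under the assignment `v`. -/
def Literal.holds (v : ℕ → Bool) (l : Literal) : Bool := v l.var == l.pos

namespace Formula

/-- In every clause, the literals are derived from distinct variables. -/
def WellFormed (F : Formula) : Prop := ∀ c ∈ F, (c.map Literal.var).Nodup

/-- The set of variables appearing in a clause of `F`. -/
def vars (F : Formula) : Finset ℕ := (F.flatten.map Literal.var).toFinset

/-- `v` is an x-model of `F`: exactly one literal is true in every clause. -/
def IsXModel (F : Formula) (v : ℕ → Bool) : Prop :=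
  ∀ c ∈ F, c.countP (Literal.holds v) = 1

def XSatisfiable (F : Formula) : Prop := ∃ v, F.IsXModel v

/-- A literal is stored as the pair of its sign and the name of its variable; clauses and
formulas are stored as lists. -/
def encode (F : Formula) : Val :=
  Val.ofList (F.map fun c =>
    Val.ofList (c.map fun l => Val.cons (Val.ofBool l.pos) (Val.ofNat l.var)))

/-- The length of (the encoding of) a formula. -/
def length (F : Formula) : ℕ := F.encode.size

end Formula

/-- The program `S` is an XSAT solver. -/
def DecidesXSAT {m : ℕ} (S : Cmd (m + 1)) : Prop :=
  ∀ F : Formula, F.WellFormed → ∃ s t w,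
    Exec S (Store.input m F.encode) s t w ∧ (s 0 ≠ Val.nil ↔ F.XSatisfiable)

/-- On formulas, the program `S` always halts and uses polynomial space and time `O(a ^ n)`, up to
a polynomial factor in the length of the formula, where `n` is the number of variables. -/
def RunsInPolySpaceAndTime (a : ℝ) {m : ℕ} (S : Cmd (m + 1)) : Prop :=
  ∃ p : Polynomial ℕ, ∀ F : Formula, F.WellFormed → ∃ s t w,
    Exec S (Store.input m F.encode) s t w ∧
    (t : ℝ) ≤ (p.eval F.length : ℕ) * a ^ F.vars.card ∧
    w ≤ p.eval F.length

/-! ## The algorithm `P` -/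

/-- Input: a pair of a value and a list. Output: is the value an element of the list? -/
def memberProg : Cmd 5 :=
  let io : Fin 5 := 0
  let v : Fin 5 := 1
  let y : Fin 5 := 2
  let w : Fin 5 := 3
  let ans : Fin 5 := 4
  v ::= Exp.hd io ;;
  ans ::= Exp.nil ;;
  Cmd.foreach y w (Exp.tl io) (
    Cmd.ite (Exp.eq y v) (ans ::= Exp.cons Exp.nil Exp.nil) Cmd.skip) ;;
  io ::= ans

/-- Input: a formula. Output: the list of its variables, without repetition. -/
def varsProg : Cmd 7 :=
  let io : Fin 7 := 0
  let V : Fin 7 := 1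
  let c : Fin 7 := 2
  let w₁ : Fin 7 := 3
  let l : Fin 7 := 4
  let w₂ : Fin 7 := 5
  let b : Fin 7 := 6
  V ::= Exp.nil ;;
  Cmd.foreach c w₁ io (
    Cmd.foreach l w₂ c (
      Cmd.call b memberProg (Exp.cons (Exp.tl l) V) ;;
      Cmd.ite b Cmd.skip (V ::= Exp.cons (Exp.tl l) V))) ;;
  io ::= V

/-- Input: a pair of a list of bits and a list `V`. Output: the list of the elements of `V` whose
bit is set. -/
def selectProg : Cmd 4 :=
  let io : Fin 4 := 0
  let B : Fin 4 := 1
  let V : Fin 4 := 2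
  let X : Fin 4 := 3
  B ::= Exp.hd io ;;
  V ::= Exp.tl io ;;
  X ::= Exp.nil ;;
  Cmd.while V (
    Cmd.ite (Exp.hd B) (X ::= Exp.cons (Exp.hd V) X) Cmd.skip ;;
    B ::= Exp.tl B ;;
    V ::= Exp.tl V) ;;
  io ::= X

/-- Input: a pair of a clause and a set `X` of variables. Output: the pair of the number (in
unary) of literals of the clause derived from `X`, and the clause with these literals flipped. -/
def flipProg : Cmd 7 :=
  let io : Fin 7 := 0
  let X : Fin 7 := 1
  let N : Fin 7 := 2
  let d : Fin 7 := 3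
  let l : Fin 7 := 4
  let w : Fin 7 := 5
  let b : Fin 7 := 6
  X ::= Exp.tl io ;;
  N ::= Exp.nil ;;
  d ::= Exp.nil ;;
  Cmd.foreach l w (Exp.hd io) (
    Cmd.call b memberProg (Exp.cons (Exp.tl l) X) ;;
    Cmd.ite b (
      N ::= Exp.cons Exp.nil N ;;
      d ::= Exp.cons (Exp.cons (Exp.eq (Exp.hd l) Exp.nil) (Exp.tl l)) d)
    (d ::= Exp.cons l d)) ;;
  io ::= Exp.cons N d

/-- The algorithm `P`, with the external XSAT solver `S`. The number `k` is kept in unary in the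
register `K`. Subsets `X` of the list `V` of variables are enumerated as strings `B` of `n` bits,
by counting in binary. The register `G` collects the formula `F ∪ C'`, and `ok` records whether
all clauses contain 0 or 2 literals derived from `X`. The output is `nil` for `⊥`, and a pair with
second component `k` for the number `k`. -/
def algorithmP {m : ℕ} (S : Cmd (m + 1)) : Cmd 18 :=
  let F : Fin 18 := 0
  let V : Fin 18 := 1
  let ans : Fin 18 := 2
  let K : Fin 18 := 3
  let R : Fin 18 := 4
  let B : Fin 18 := 5
  let v : Fin 18 := 6
  let w : Fin 18 := 7
  let more : Fin 18 := 8
  let X : Fin 18 := 9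
  let N : Fin 18 := 10
  let G : Fin 18 := 11
  let ok : Fin 18 := 12
  let c : Fin 18 := 13
  let w' : Fin 18 := 14
  let r : Fin 18 := 15
  let b : Fin 18 := 16
  let Z : Fin 18 := 17
  let tt : Exp 18 := Exp.cons Exp.nil Exp.nil
  let two : Exp 18 := Exp.cons Exp.nil (Exp.cons Exp.nil Exp.nil)
  Cmd.call V varsProg F ;;
  ans ::= Exp.nil ;;
  K ::= Exp.nil ;;
  R ::= Exp.cons Exp.nil V ;;
  -- for `k` from 0 to `n`
  Cmd.while R (
    B ::= Exp.nil ;;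
    Cmd.foreach v w V (B ::= Exp.cons Exp.nil B) ;;
    more ::= tt ;;
    -- for every subset `X`
    Cmd.while more (
      Cmd.call X selectProg (Exp.cons B V) ;;
      N ::= Exp.nil ;;
      Cmd.foreach v w X (N ::= Exp.cons Exp.nil N) ;;
      -- of size `k`
      Cmd.ite (Exp.eq N K) (
        G ::= F ;;
        ok ::= tt ;;
        Cmd.foreach c w' F (
          Cmd.call r flipProg (Exp.cons c X) ;;
          Cmd.ite (Exp.hd r) (
            G ::= Exp.cons (Exp.tl r) G ;;
            Cmd.ite (Exp.eq (Exp.hd r) two) Cmd.skip (ok ::= Exp.nil))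
          Cmd.skip) ;;
        Cmd.ite ok (
          Cmd.call b S G ;;
          Cmd.ite b (ans ::= Exp.cons Exp.nil K) Cmd.skip)
        Cmd.skip)
      Cmd.skip ;;
      -- the next string of bits, if there is one
      Z ::= Exp.nil ;;
      Cmd.while (Exp.hd B) (
        Z ::= Exp.cons Exp.nil Z ;;
        B ::= Exp.tl B) ;;
      Cmd.ite B (
        B ::= Exp.cons tt (Exp.tl B) ;;
        Cmd.while Z (
          B ::= Exp.cons Exp.nil B ;;
          Z ::= Exp.tl Z))
      (more ::= Exp.nil)) ;;
    K ::= Exp.cons Exp.nil K ;;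
    R ::= Exp.tl R) ;;
  F ::= ans

/-! ## Bounds on the size of stores and values -/

/-! Apart from the calls of `S`, treating one subset costs `P` polynomial time, and there are `n +
1` rounds of `2 ^ n` subsets. What has to be bounded is the total time of the calls. The solver is
called only for good sets `X`, those from which every clause contains 0 or 2 literals, and always on
a formula with the same `n` variables and at most four times the length of `F`.

Good sets are counted by revealing `X` clause by clause. If a clause has `r` variables that were not
revealed before and `j` of its variables are already in `X`, the new variables can be treated in `1
+ r.choose 2`, `r`, `1` or `0` ways for `j = 0`, `1`, `2`, `≥ 3`, hence in at most `1 + r.choose 2`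
ways. This is at most `(2 / 1.1749) ^ r`, so there are at most `(2 / 1.1749) ^ n` good sets, and
calls of cost `1.1749 ^ n` add up to `2 ^ n`. This is the second claim.

The first claim needs a solver that is fast on the formulas `F ∪ C'` on average over good `X`, not
on all formulas. Let `x`, `y` be the two literals of a clause `c` derived from `X`, and `c'` the
flipped copy. Then `c` and `c'` both have exactly one true literal if and only if exactly one of
`x`, `y` is true and all other literals of `c` are false: if `x` and `y` were both false, both of
their negations would be true in `c'`. The solver detects such pairs, replaces them by equations
between literals, whose consistency is decided by elimination, and searches depth-first for the true
literal of each remaining clause. A clause untouched by `X` with `r` new variables multiplies the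
search tree by at most `r + 1`, up to additive terms: one branch for each undecided literal and one
for a decided literal that is true. In the count above, the empty intersection now gets the weight
`r + 1` instead of `1`, and `r + 1 + r.choose 2 ≤ 2 ^ r` shows that the search trees of all calls
add up to `2 ^ n` times a polynomial.

Both counts are instances of `Formula.sum_good_weight_le`. The search tree is bounded in
`Formula.work_flips_append_le`, which rests on `work_cons_le` and `work_le_work_cons`; the space of
the search is bounded through `StackBounded`. `runs_algorithmP` turns a bound for the sum of the
solver costs into the bound for the program, by a Hoare logic (`Triple`) that tracks time and space
up to polynomials. -/

lemma Val.one_le_size (v : Val) : 1 ≤ v.size := by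
  cases v <;> simp [Val.size]; omega

lemma Val.size_head_le (v : Val) : v.head.size ≤ v.size := by
  cases v <;> simp [Val.size, Val.head]; omega

lemma Val.size_tail_le (v : Val) : v.tail.size ≤ v.size := by
  cases v <;> simp [Val.size, Val.tail]

lemma Val.size_ofBool_le (b : Bool) : (Val.ofBool b).size ≤ 3 := by
  cases b <;> simp [Val.size, Val.ofBool]

lemma Exp.size_eval_le_cost {k : ℕ} (s : Store k) (e : Exp k) : (e.eval s).size ≤ e.cost s := by
  cases e <;> simp [Exp.eval, Exp.cost, Val.size]

lemma Store.size_le_size {k : ℕ} (s : Store k) (i : Fin k) : (s i).size ≤ s.size :=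
  Finset.single_le_sum (f := fun i => (s i).size) (fun _ _ => Nat.zero_le _) (Finset.mem_univ i)

lemma Store.size_update_le {k : ℕ} (s : Store k) (x : Fin k) (v : Val) :
    Store.size (Function.update s x v) ≤ s.size + v.size := by
  unfold Store.size
  rw [← Finset.add_sum_erase _ _ (Finset.mem_univ x),
    ← Finset.add_sum_erase (Finset.univ) (fun i => (s i).size) (Finset.mem_univ x)]
  have : ∑ i ∈ Finset.univ.erase x, (Function.update s x v i).size
      = ∑ i ∈ Finset.univ.erase x, (s i).size :=
    Finset.sum_congr rfl fun i hi => by rw [Function.update_of_ne (Finset.ne_of_mem_erase hi)]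
  rw [this]
  simp
  omega

lemma Store.size_le_mul {k J : ℕ} (s : Store k) (h : ∀ i, (s i).size ≤ J) : s.size ≤ k * J := by
  simpa [Store.size] using Finset.sum_le_card_nsmul Finset.univ (fun i => (s i).size) J (fun i _ => h i)

lemma Store.size_input_le (m : ℕ) (v : Val) : (Store.input m v).size ≤ m + 1 + v.size := by
  refine (Store.size_update_le _ _ _).trans ?_
  simp [Store.size, Val.size]

/-- The cost of an expression is linear in the size of the store. -/
lemma Exp.exists_cost_le {k : ℕ} (e : Exp k) : ∃ C, ∀ s : Store k, e.cost s ≤ C * (s.size + 1) := by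
  induction e with
  | var x => exact ⟨1, fun s => by have := s.size_le_size x; simp only [Exp.cost]; omega⟩
  | nil => exact ⟨1, fun s => by simp [Exp.cost]⟩
  | cons a b iha ihb =>
    obtain ⟨A, hA⟩ := iha
    obtain ⟨B, hB⟩ := ihb
    refine ⟨2 * A + 2 * B + 1, fun s => ?_⟩
    have h1 := a.size_eval_le_cost s
    have h2 := b.size_eval_le_cost s
    have := hA s
    have := hB s
    simp only [Exp.cost, Exp.eval, Val.size]
    nlinarith
  | hd a iha =>
    obtain ⟨A, hA⟩ := iha
    refine ⟨2 * A, fun s => ?_⟩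
    have h1 := a.size_eval_le_cost s
    have h2 := (a.eval s).size_head_le
    have := hA s
    simp only [Exp.cost, Exp.eval]
    nlinarith
  | tl a iha =>
    obtain ⟨A, hA⟩ := iha
    refine ⟨2 * A, fun s => ?_⟩
    have h1 := a.size_eval_le_cost s
    have h2 := (a.eval s).size_tail_le
    have := hA s
    simp only [Exp.cost, Exp.eval]
    nlinarith
  | eq a b iha ihb =>
    obtain ⟨A, hA⟩ := iha
    obtain ⟨B, hB⟩ := ihb
    refine ⟨A + B + 3, fun s => ?_⟩
    have := Val.size_ofBool_le (decide (a.eval s = b.eval s))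
    have := hA s
    have := hB s
    simp only [Exp.cost, Exp.eval]
    nlinarith

/-- The peak memory bounds the final store, so a space bound for one command provides the size
hypothesis for the next one. -/
lemma Exec.size_le {k : ℕ} {c : Cmd k} {s s' : Store k} {t w : ℕ} (h : Exec c s s' t w) :
    s'.size ≤ w := by
  induction h with
  | skip s => exact le_rfl
  | assign x e s =>
    exact (Store.size_update_le _ _ _).trans (Nat.add_le_add_left (e.size_eval_le_cost s) _)
  | seq _ _ _ ih => exact ih.trans (le_max_right _ _)
  | ite_true _ _ ih => exact ih.trans (le_max_right _ _)
  | ite_false _ _ ih => exact ih.trans (le_max_right _ _)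
  | while_true _ _ _ _ ih => exact ih.trans ((le_max_right _ _).trans (le_max_right _ _))
  | while_false _ => exact Nat.le_add_right _ _
  | @call k m x p e s s' t w _ ih =>
    have h1 := Store.size_update_le s x (s' 0)
    have h2 := s'.size_le_size 0
    omega

lemma Polynomial.eval_mono_nat (p : Polynomial ℕ) : Monotone fun n => p.eval n := by
  intro a b h
  simp only [Polynomial.eval_eq_sum_range]
  exact Finset.sum_le_sum fun i _ => Nat.mul_le_mul_left _ (Nat.pow_le_pow_left h i)

/-! ## Encodings -/

/-- Types whose elements are stored as values. -/
class Enc (β : Type*) where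
  enc : β → Val
  inj : Function.Injective enc

open Enc (enc)

lemma Val.ofList_injective : Function.Injective Val.ofList := by
  intro l
  induction l with
  | nil => intro m h; cases m <;> simp_all [Val.ofList]
  | cons a l ih =>
    intro m h
    cases m with
    | nil => simp [Val.ofList] at h
    | cons b m =>
      simp only [Val.ofList, Val.cons.injEq] at h
      rw [h.1, ih h.2]

lemma Val.ofBool_injective : Function.Injective Val.ofBool := by
  intro a b; cases a <;> cases b <;> simp [Val.ofBool]

instance : Enc Val := ⟨id, Function.injective_id⟩

instance : Enc Bool := ⟨Val.ofBool, Val.ofBool_injective⟩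

instance {β γ : Type*} [Enc β] [Enc γ] : Enc (β × γ) :=
  ⟨fun x => Val.cons (enc x.1) (enc x.2), fun x y h => by
    simp only [Val.cons.injEq] at h
    exact Prod.ext (Enc.inj h.1) (Enc.inj h.2)⟩

instance {β : Type*} [Enc β] : Enc (List β) :=
  ⟨fun l => Val.ofList (l.map enc),
    Val.ofList_injective.comp (List.map_injective_iff.2 Enc.inj)⟩

section

variable {β γ : Type*} [Enc β] [Enc γ]

lemma enc_val (v : Val) : enc v = v := rfl

lemma enc_bool (b : Bool) : enc b = Val.ofBool b := rfl

lemma enc_pair (x : β × γ) : enc x = Val.cons (enc x.1) (enc x.2) := rfl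

lemma enc_nil : enc ([] : List β) = Val.nil := rfl

lemma enc_cons (b : β) (l : List β) : enc (b :: l) = Val.cons (enc b) (enc l) := rfl

lemma enc_list (l : List β) : enc l = Val.ofList (l.map enc) := rfl

lemma enc_list_eq_nil {l : List β} : enc l = Val.nil ↔ l = [] := by
  cases l <;> simp [enc_nil, enc_cons]

lemma ofBool_eq_nil {b : Bool} : Val.ofBool b = Val.nil ↔ b = false := by
  cases b <;> simp [Val.ofBool]

lemma length_lt_size_enc (l : List β) : l.length < (enc l).size := by
  induction l with
  | nil => simp [enc_nil, Val.size]
  | cons b l ih =>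
    have := (enc b).one_le_size
    simp only [enc_cons, Val.size, List.length_cons]
    omega

lemma size_enc_append (l l' : List β) : (enc (l ++ l')).size + 1 = (enc l).size + (enc l').size := by
  induction l with
  | nil => simp [enc_nil, Val.size]; omega
  | cons b l ih => simp only [List.cons_append, enc_cons, Val.size]; omega

lemma size_enc_le (l : List β) (K : ℕ) (h : ∀ b ∈ l, (enc b).size ≤ K) :
    (enc l).size ≤ l.length * (K + 1) + 1 := by
  induction l with
  | nil => simp [enc_nil, Val.size]
  | cons b l ih =>
    have h1 := ih fun c hc => h c (List.mem_cons_of_mem _ hc)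
    have h2 := h b List.mem_cons_self
    simp only [enc_cons, Val.size, List.length_cons]
    linarith [add_mul l.length 1 (K + 1)]

lemma size_enc_mem {l : List β} {b : β} (h : b ∈ l) : (enc b).size < (enc l).size := by
  induction l with
  | nil => simp at h
  | cons c l ih =>
    simp only [enc_cons, Val.size]
    rcases List.mem_cons.1 h with rfl | h
    · omega
    · have := ih h; omega

end

/-! ## Triples with polynomial bounds -/

/-- Started in a store satisfying `P a` whose size is polynomial in `N a`, the command `c` halts in
a store satisfying `Q a`, in time polynomial in `N a` up to the factor `M a + 1`, and in space
polynomial in `N a`; the bounds are uniform in the parameter `a`. -/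
def Triple {α : Type*} {k : ℕ} (N M : α → ℕ) (P : α → Store k → Prop) (c : Cmd k)
    (Q : α → Store k → Prop) : Prop :=
  ∀ q : Polynomial ℕ, ∃ p : Polynomial ℕ, ∀ a s, P a s → s.size ≤ q.eval (N a) →
    ∃ s' t w, Exec c s s' t w ∧ Q a s' ∧ t ≤ p.eval (N a) * (M a + 1) ∧ w ≤ p.eval (N a)

namespace Triple

variable {α : Type*} {k : ℕ} {N M : α → ℕ} {P Q R : α → Store k → Prop} {c d : Cmd k}

lemma conseq {P' Q' : α → Store k → Prop} (h : Triple N M P c Q) (hP : ∀ a s, P' a s → P a s)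
    (hQ : ∀ a s, Q a s → Q' a s) : Triple N M P' c Q' := by
  intro q
  obtain ⟨p, hp⟩ := h q
  refine ⟨p, fun a s hs hq => ?_⟩
  obtain ⟨s', t, w, h1, h2, h3⟩ := hp a s (hP a s hs) hq
  exact ⟨s', t, w, h1, hQ _ _ h2, h3⟩

/-- Change of the time factor, up to a polynomial. -/
lemma weaken {M' : α → ℕ} (h : Triple N M P c Q) (r : Polynomial ℕ)
    (hr : ∀ a s, P a s → M a + 1 ≤ r.eval (N a) * (M' a + 1)) : Triple N M' P c Q := by
  intro q
  obtain ⟨p, hp⟩ := h q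
  refine ⟨p * r + p, fun a s hs hq => ?_⟩
  obtain ⟨s', t, w, h1, h2, h3, h4⟩ := hp a s hs hq
  refine ⟨s', t, w, h1, h2, h3.trans ?_, h4.trans ?_⟩
  · rw [Polynomial.eval_add, Polynomial.eval_mul, add_mul, mul_assoc]
    exact le_add_right (Nat.mul_le_mul_left _ (hr a s hs))
  · simp

/-- Change of the parameter. -/
lemma reindex {β : Type*} {N' M' : β → ℕ} {P' Q' : β → Store k → Prop} (h : Triple N M P c Q)
    (hr : ∀ b s, P' b s → ∃ a, P a s ∧ N a = N' b ∧ M a ≤ M' b ∧ ∀ s', Q a s' → Q' b s') :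
    Triple N' M' P' c Q' := by
  intro q
  obtain ⟨p, hp⟩ := h q
  refine ⟨p, fun b s hs hq => ?_⟩
  obtain ⟨a, ha, hN, hM, hQ⟩ := hr b s hs
  obtain ⟨s', t, w, h1, h2, h3, h4⟩ := hp a s ha (hN ▸ hq)
  rw [hN] at h3 h4
  exact ⟨s', t, w, h1, hQ _ h2, h3.trans (Nat.mul_le_mul_left _ (by omega)), h4⟩

lemma skip (h : ∀ a s, P a s → Q a s) : Triple N M P Cmd.skip Q := by
  intro q
  refine ⟨q + 1, fun a s hs hq => ⟨s, 1, s.size, Exec.skip s, h a s hs, ?_, ?_⟩⟩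
  · simp only [Polynomial.eval_add, Polynomial.eval_one]; nlinarith
  · simp only [Polynomial.eval_add, Polynomial.eval_one]; omega

lemma assign {x : Fin k} {e : Exp k} (h : ∀ a s, P a s → Q a (Function.update s x (e.eval s))) :
    Triple N M P (x ::= e) Q := by
  intro q
  obtain ⟨C, hC⟩ := e.exists_cost_le
  refine ⟨q + Polynomial.C C * (q + 1), fun a s hs hq =>
    ⟨_, _, _, Exec.assign x e s, h a s hs, ?_, ?_⟩⟩
  all_goals
    have h1 := hC s
    have h2 : C * (s.size + 1) ≤ C * (q.eval (N a) + 1) := Nat.mul_le_mul_left _ (by omega)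
    simp only [Polynomial.eval_add, Polynomial.eval_mul, Polynomial.eval_C, Polynomial.eval_one]
  · nlinarith
  · omega

lemma seq (h₁ : Triple N M P c Q) (h₂ : Triple N M Q d R) : Triple N M P (c ;; d) R := by
  intro q
  obtain ⟨p₁, hp₁⟩ := h₁ q
  -- The space bound of the first command is the size bound for the store handed to the second. This
  -- is why the definition of `Triple` quantifies over all polynomials `q`.
  obtain ⟨p₂, hp₂⟩ := h₂ p₁
  refine ⟨p₁ + p₂, fun a s hs hq => ?_⟩
  obtain ⟨s₁, t₁, w₁, e₁, hQ, ht₁, hw₁⟩ := hp₁ a s hs hq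
  obtain ⟨s₂, t₂, w₂, e₂, hR, ht₂, hw₂⟩ := hp₂ a s₁ hQ (e₁.size_le.trans hw₁)
  refine ⟨s₂, _, _, Exec.seq e₁ e₂, hR, ?_, ?_⟩
  · rw [Polynomial.eval_add, add_mul]; omega
  · rw [Polynomial.eval_add]; omega

/-- The intermediate assertion is the strongest postcondition, so none has to be supplied when
assignments are chained. -/
lemma assign_seq {x : Fin k} {e : Exp k}
    (h : Triple N M (fun a s => ∃ s₀, P a s₀ ∧ s = Function.update s₀ x (e.eval s₀)) c Q) :
    Triple N M P (x ::= e ;; c) Q :=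
  seq (assign fun _ s hs => ⟨s, hs, rfl⟩) h

lemma ite {e : Exp k} (h₁ : Triple N M (fun a s => P a s ∧ e.eval s ≠ Val.nil) c Q)
    (h₂ : Triple N M (fun a s => P a s ∧ e.eval s = Val.nil) d Q) :
    Triple N M P (Cmd.ite e c d) Q := by
  intro q
  obtain ⟨p₁, hp₁⟩ := h₁ q
  obtain ⟨p₂, hp₂⟩ := h₂ q
  obtain ⟨C, hC⟩ := e.exists_cost_le
  refine ⟨q + Polynomial.C C * (q + 1) + p₁ + p₂, fun a s hs hq => ?_⟩
  have h1 := hC s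
  have h2 : C * (s.size + 1) ≤ C * (q.eval (N a) + 1) := Nat.mul_le_mul_left _ (by omega)
  by_cases he : e.eval s = Val.nil
  · obtain ⟨s₁, t₁, w₁, e₁, hQ, ht₁, hw₁⟩ := hp₂ a s ⟨hs, he⟩ hq
    refine ⟨_, _, _, Exec.ite_false he e₁, hQ, ?_, ?_⟩ <;>
      simp only [Polynomial.eval_add, Polynomial.eval_mul, Polynomial.eval_C, Polynomial.eval_one]
    · nlinarith
    · omega
  · obtain ⟨s₁, t₁, w₁, e₁, hQ, ht₁, hw₁⟩ := hp₁ a s ⟨hs, he⟩ hq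
    refine ⟨_, _, _, Exec.ite_true he e₁, hQ, ?_, ?_⟩ <;>
      simp only [Polynomial.eval_add, Polynomial.eval_mul, Polynomial.eval_C, Polynomial.eval_one]
    · nlinarith
    · omega

/-- A loop that is run `T a` times. -/
lemma while_loop {e : Exp k} {I : α → ℕ → Store k → Prop} {T : α → ℕ} {M' : α × ℕ → ℕ}
    (hbody : Triple (fun a : α × ℕ => N a.1) M' (fun a s => I a.1 a.2 s ∧ a.2 < T a.1) c
      (fun a s => I a.1 (a.2 + 1) s))
    (htrue : ∀ a i s, i < T a → I a i s → e.eval s ≠ Val.nil)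
    (hfalse : ∀ a s, I a (T a) s → e.eval s = Val.nil)
    (hsize : ∃ q : Polynomial ℕ, ∀ a i s, i ≤ T a → I a i s → s.size ≤ q.eval (N a)) :
    Triple N (fun a => ∑ i ∈ Finset.range (T a), (M' (a, i) + 1)) (fun a s => I a 0 s)
      (Cmd.while e c) (fun a s => I a (T a) s) := by
  -- Iterating the polynomial bound of the body `T a` times need not give a polynomial. So the bound
  -- at entry is discarded, and every round starts from the bound `q` that the invariant guarantees.
  intro _
  obtain ⟨q, hq⟩ := hsize
  obtain ⟨p, hp⟩ := hbody q
  obtain ⟨C, hC⟩ := e.exists_cost_le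
  refine ⟨q + Polynomial.C C * (q + 1) + p, fun a s hs _ => ?_⟩
  have hc : ∀ i s, i ≤ T a → I a i s → e.cost s ≤ C * (q.eval (N a) + 1) := fun i s hi h =>
    (hC s).trans (Nat.mul_le_mul_left _ (by have := hq a i s hi h; omega))
  have key : ∀ n i s, i + n = T a → I a i s → ∃ s' t w, Exec (Cmd.while e c) s s' t w ∧
      I a (T a) s' ∧ t ≤ (C * (q.eval (N a) + 1) + p.eval (N a)) *
        (∑ j ∈ Finset.Ico i (T a), (M' (a, j) + 1) + 1) ∧
      w ≤ q.eval (N a) + C * (q.eval (N a) + 1) + p.eval (N a) := by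
    intro n
    induction n with
    | zero =>
      intro i s hi h
      obtain rfl : i = T a := by omega
      have h1 := hc _ s le_rfl h
      have h2 := hq _ _ s le_rfl h
      refine ⟨s, _, _, Exec.while_false (hfalse a s h), h, ?_, ?_⟩
      · simp only [Finset.Ico_self, Finset.sum_empty]; omega
      · omega
    | succ n ih =>
      intro i s hi h
      have h1 := hc i s (by omega) h
      have h2 := hq a i s (by omega) h
      obtain ⟨s₁, t₁, w₁, e₁, hI, ht₁, hw₁⟩ := hp (a, i) s ⟨h, by simp; omega⟩ h2
      obtain ⟨s₂, t₂, w₂, e₂, hI₂, ht₂, hw₂⟩ := ih (i + 1) s₁ (by omega) hI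
      refine ⟨s₂, _, _, Exec.while_true (htrue a i s (by omega) h) e₁ e₂, hI₂, ?_, ?_⟩
      · rw [Finset.sum_eq_sum_Ico_succ_bot (by omega : i < T a)]
        simp only at ht₁
        have : C * (q.eval (N a) + 1) ≤ C * (q.eval (N a) + 1) * (M' (a, i) + 1) :=
          Nat.le_mul_of_pos_right _ (by omega)
        calc _ ≤ C * (q.eval (N a) + 1) * (M' (a, i) + 1) + p.eval (N a) * (M' (a, i) + 1) +
              (C * (q.eval (N a) + 1) + p.eval (N a)) *
                (∑ j ∈ Finset.Ico (i + 1) (T a), (M' (a, j) + 1) + 1) := by omega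
          _ = _ := by ring
      · simp only at hw₁
        omega
  obtain ⟨s', t, w, h1, h2, h3, h4⟩ := key (T a) 0 s (by omega) hs
  refine ⟨s', t, w, h1, h2, h3.trans ?_, h4.trans ?_⟩ <;>
    simp only [Polynomial.eval_add, Polynomial.eval_mul, Polynomial.eval_C, Polynomial.eval_one,
      ← Finset.range_eq_Ico]
  · exact Nat.mul_le_mul_right _ (by omega)
  · exact le_rfl

/-- In `I a l l'`, the list is split into the visited part `l` and the remaining part `l'`. The
number of rounds is polynomial without further hypotheses, because the whole list is stored in the
register `w` at the beginning and its length is less than its size. -/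
lemma foreach {β : Type*} [Enc β] {x w : Fin k} {e : Exp k} {L : α → List β}
    {I : α → List β → List β → Store k → Prop}
    (hbody : Triple (fun a : α × List β × β × List β => N a.1) 0
      (fun a s => L a.1 = a.2.1 ++ a.2.2.1 :: a.2.2.2 ∧ ∃ s₀, I a.1 a.2.1 (a.2.2.1 :: a.2.2.2) s₀ ∧
        s = Function.update (Function.update s₀ x (enc a.2.2.1)) w (enc a.2.2.2)) c
      (fun a s => s w = enc a.2.2.2 ∧ I a.1 (a.2.1 ++ [a.2.2.1]) a.2.2.2 s))
    (hinit : ∀ a s, P a s → e.eval s = enc (L a) ∧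
      I a [] (L a) (Function.update s w (enc (L a))))
    (hfinal : ∀ a s, I a (L a) [] s → s w = Val.nil → Q a s)
    (hsize : ∃ q : Polynomial ℕ, ∀ a l l' s, L a = l ++ l' → I a l l' s → s w = enc l' →
      s.size ≤ q.eval (N a)) (hxw : x ≠ w) :
    Triple N M P (Cmd.foreach x w e c) Q := by
  have hloop := while_loop (N := N) (M' := 0) (T := fun a => (L a).length) (e := Exp.var w)
    (c := x ::= Exp.hd w ;; w ::= Exp.tl w ;; c)
    (I := fun a i s => s w = enc ((L a).drop i) ∧ I a ((L a).take i) ((L a).drop i) s) ?_ ?_ ?_ ?_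
  · refine seq (assign (Q := fun a s => s w = enc (L a) ∧ I a [] (L a) s) fun a s hs => ?_)
      (((hloop.weaken (M' := M) ?_ ?_).conseq ?_ ?_))
    · rw [(hinit a s hs).1]
      exact ⟨by simp, (hinit a s hs).2⟩
    · exact hsize.choose + 1
    · rintro a s ⟨h1, h2⟩
      have h3 := hsize.choose_spec a _ _ s (by simp) h2 h1
      have h4 := s.size_le_size w
      rw [h1] at h4
      have h5 := length_lt_size_enc (L a)
      simp only [List.drop_zero] at h4
      simp only [Pi.zero_apply, zero_add, Finset.sum_const, Finset.card_range, smul_eq_mul,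
        Polynomial.eval_add, Polynomial.eval_one]
      nlinarith
    · exact fun a s h => by simpa using h
    · rintro a s ⟨h1, h2⟩
      rw [List.drop_length] at h1 h2
      rw [List.take_length] at h2
      exact hfinal a s h2 h1
  · refine assign_seq (assign_seq (hbody.reindex ?_))
    rintro ⟨a, i⟩ s ⟨s₁, ⟨s₀, ⟨⟨h1, h2⟩, hi⟩, rfl⟩, rfl⟩
    simp only at hi h1 h2
    rw [List.drop_eq_getElem_cons hi] at h1 h2
    rw [enc_cons] at h1
    refine ⟨⟨a, (L a).take i, (L a)[i], (L a).drop (i + 1)⟩, ⟨by simp, s₀, h2, ?_⟩, rfl, le_rfl, ?_⟩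
    · simp [Exp.eval, h1, Val.head, Val.tail, Function.update_of_ne hxw.symm]
    · intro s' h
      simpa using h
  · rintro a i s hi ⟨h1, -⟩
    rw [List.drop_eq_getElem_cons hi, enc_cons] at h1
    simp [Exp.eval, h1]
  · rintro a s ⟨h1, -⟩
    simpa [Exp.eval, enc_nil] using h1
  · obtain ⟨q, hq⟩ := hsize
    exact ⟨q, fun a i s _ ⟨h1, h2⟩ => hq a _ _ s (by simp) h2 h1⟩

end Triple

/-- The program `c` computes the function `f` in polynomial time and space. -/
def Computes {β γ : Type*} [Enc β] [Enc γ] {m : ℕ} (c : Cmd (m + 1)) (f : β → γ) : Prop :=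
  ∃ p : Polynomial ℕ, ∀ b, ∃ s t w, Exec c (Store.input m (enc b)) s t w ∧ s 0 = enc (f b) ∧
    t ≤ p.eval (enc b).size ∧ w ≤ p.eval (enc b).size

lemma Triple.computes {β γ : Type*} [Enc β] [Enc γ] {m : ℕ} {c : Cmd (m + 1)} {f : β → γ}
    (h : Triple (fun b => (enc b).size) 0 (fun b s => s = Store.input m (enc b)) c
      (fun b s => s 0 = enc (f b))) : Computes c f := by
  obtain ⟨p, hp⟩ := h (Polynomial.X + Polynomial.C (m + 1))
  refine ⟨p, fun b => ?_⟩
  obtain ⟨s, t, w, h1, h2, h3, h4⟩ := hp b _ rfl (by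
    have := Store.size_input_le m (enc b); simp; omega)
  exact ⟨s, t, w, h1, h2, by simpa using h3, h4⟩

namespace Triple

variable {α : Type*} {k : ℕ} {N M : α → ℕ} {P Q : α → Store k → Prop} {d : Cmd k}

lemma call {β γ : Type*} [Enc β] [Enc γ] {m : ℕ} {c : Cmd (m + 1)} {f : β → γ}
    (hc : Computes c f) {x : Fin k} {e : Exp k}
    (h : ∀ a s, P a s → ∃ b, e.eval s = enc b ∧ Q a (Function.update s x (enc (f b)))) :
    Triple N M P (Cmd.call x c e) Q := by
  intro q
  obtain ⟨p, hp⟩ := hc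
  obtain ⟨C, hC⟩ := e.exists_cost_le
  refine ⟨q + Polynomial.C C * (q + 1) + p.comp (Polynomial.C C * (q + 1)), fun a s hs hq => ?_⟩
  obtain ⟨b, hb, hQ⟩ := h a s hs
  obtain ⟨s', t, w, h1, h2, h3, h4⟩ := hp b
  have h5 := hC s
  have h6 : C * (s.size + 1) ≤ C * (q.eval (N a) + 1) := Nat.mul_le_mul_left _ (by omega)
  have h7 := e.size_eval_le_cost s
  rw [← hb] at h1 h3 h4
  have h8 : p.eval (e.eval s).size ≤ p.eval (C * (q.eval (N a) + 1)) := p.eval_mono_nat (by omega)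
  refine ⟨_, _, _, Exec.call h1, by rw [h2]; exact hQ, ?_, ?_⟩ <;>
    simp only [Polynomial.eval_add, Polynomial.eval_mul, Polynomial.eval_C, Polynomial.eval_one,
      Polynomial.eval_comp]
  · refine le_trans ?_ (Nat.le_mul_of_pos_right _ (by omega))
    omega
  · omega

lemma call_seq {β γ : Type*} [Enc β] [Enc γ] {m : ℕ} {c : Cmd (m + 1)} {f : β → γ}
    (hc : Computes c f) {x : Fin k} {e : Exp k} (h : ∀ a s, P a s → ∃ b : β, e.eval s = enc b)
    (hd : Triple N M (fun a s => ∃ s₀ b, P a s₀ ∧ e.eval s₀ = enc b ∧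
      s = Function.update s₀ x (enc (f b))) d Q) :
    Triple N M P (Cmd.call x c e ;; d) Q :=
  seq (call hc fun a s hs => by
    obtain ⟨b, hb⟩ := h a s hs
    exact ⟨b, hb, s, b, hs, hb, rfl⟩) hd

end Triple

/-! ## Functions computable in polynomial time and space -/

lemma Computes.size_le {β γ : Type*} [Enc β] [Enc γ] {m : ℕ} {c : Cmd (m + 1)} {f : β → γ}
    (h : Computes c f) : ∃ p : Polynomial ℕ, ∀ b, (enc (f b)).size ≤ p.eval (enc b).size := by
  obtain ⟨p, hp⟩ := h
  refine ⟨p, fun b => ?_⟩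
  obtain ⟨s, t, w, h1, h2, -, h4⟩ := hp b
  rw [← h2]
  exact (s.size_le_size 0).trans (h1.size_le.trans h4)

def PolyTime {β γ : Type*} [Enc β] [Enc γ] (f : β → γ) : Prop :=
  ∃ (m : ℕ) (c : Cmd (m + 1)), Computes c f

/-- An expression whose value is `v` in every store. -/
def Exp.const (k : ℕ) : Val → Exp k
  | Val.nil => Exp.nil
  | Val.cons a b => Exp.cons (Exp.const k a) (Exp.const k b)

lemma Exp.eval_const {k : ℕ} (s : Store k) (v : Val) : (Exp.const k v).eval s = v := by
  induction v with
  | nil => rfl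
  | cons a b iha ihb => simp [Exp.const, Exp.eval, iha, ihb]

lemma Store.input_zero (m : ℕ) (v : Val) : Store.input m v 0 = v := by simp [Store.input]

namespace PolyTime

variable {α β γ δ : Type*} [Enc α] [Enc β] [Enc γ] [Enc δ]

lemma of_exp {f : α → β} (e : Exp 1) (h : ∀ a, e.eval (Store.input 0 (enc a)) = enc (f a)) :
    PolyTime f :=
  ⟨0, 0 ::= e, Triple.computes (Triple.assign fun a s hs => by simp [hs, h])⟩

lemma id : PolyTime (fun a : α => a) :=
  of_exp (Exp.var 0) fun a => by simp [Exp.eval, Store.input_zero]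

lemma const (b : β) : PolyTime (fun _ : α => b) :=
  of_exp (Exp.const 1 (enc b)) fun _ => by rw [Exp.eval_const]

lemma comp {g : β → γ} {f : α → β} (hg : PolyTime g) (hf : PolyTime f) :
    PolyTime (fun a => g (f a)) := by
  obtain ⟨m, c, hc⟩ := hf
  obtain ⟨m', c', hc'⟩ := hg
  refine ⟨0, Cmd.call 0 c (Exp.var 0) ;; Cmd.call 0 c' (Exp.var 0), Triple.computes ?_⟩
  refine Triple.call_seq hc (fun a s hs => ⟨a, by simp [hs, Exp.eval, Store.input_zero]⟩)
    (Triple.call hc' ?_)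
  rintro a s ⟨s₀, b, rfl, hb, rfl⟩
  obtain rfl : a = b := Enc.inj (by simpa [Exp.eval, Store.input_zero] using hb)
  exact ⟨f a, by simp [Exp.eval], by simp⟩

lemma pair {f : α → β} {g : α → γ} (hf : PolyTime f) (hg : PolyTime g) :
    PolyTime (fun a => (f a, g a)) := by
  obtain ⟨m, c, hc⟩ := hf
  obtain ⟨m', c', hc'⟩ := hg
  refine ⟨1, Cmd.call 1 c (Exp.var 0) ;; Cmd.call 0 c' (Exp.var 0) ;;
    0 ::= Exp.cons (Exp.var 1) (Exp.var 0), Triple.computes ?_⟩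
  refine Triple.call_seq hc (fun a s hs => ⟨a, by simp [hs, Exp.eval, Store.input_zero]⟩)
    (Triple.call_seq hc' ?_ (Triple.assign ?_))
  · rintro a s ⟨s₀, b, rfl, hb, rfl⟩
    exact ⟨a, by simp [Exp.eval, Store.input_zero]⟩
  · rintro a s ⟨s₀, b, ⟨s₁, b', rfl, hb, rfl⟩, hb', rfl⟩
    obtain rfl : a = b' := Enc.inj (by simpa [Exp.eval, Store.input_zero] using hb)
    obtain rfl : a = b := Enc.inj (by simpa [Exp.eval, Store.input_zero] using hb')
    simp [Exp.eval, enc_pair]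

lemma fst {f : α → β × γ} (hf : PolyTime f) : PolyTime (fun a => (f a).1) :=
  comp (g := Prod.fst) (of_exp (Exp.hd (Exp.var 0)) fun a => by
    simp [Exp.eval, Store.input_zero, enc_pair, Val.head]) hf

lemma snd {f : α → β × γ} (hf : PolyTime f) : PolyTime (fun a => (f a).2) :=
  comp (g := Prod.snd) (of_exp (Exp.tl (Exp.var 0)) fun a => by
    simp [Exp.eval, Store.input_zero, enc_pair, Val.tail]) hf

lemma cons {f : α → β} {g : α → List β} (hf : PolyTime f) (hg : PolyTime g) :
    PolyTime (fun a => f a :: g a) :=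
  comp (g := fun x : β × List β => x.1 :: x.2) (of_exp (Exp.var 0) fun a => by
    simp [Exp.eval, Store.input_zero, enc_pair, enc_cons]) (pair hf hg)

lemma beq [DecidableEq β] {f g : α → β} (hf : PolyTime f) (hg : PolyTime g) :
    PolyTime (fun a => decide (f a = g a)) :=
  comp (g := fun x : β × β => decide (x.1 = x.2))
    (of_exp (Exp.eq (Exp.hd (Exp.var 0)) (Exp.tl (Exp.var 0))) fun a => by
      simp [Exp.eval, Store.input_zero, enc_pair, Val.head, Val.tail, enc_bool, Enc.inj.eq_iff])
    (pair hf hg)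

lemma not {f : α → Bool} (hf : PolyTime f) : PolyTime (fun a => !f a) :=
  comp (g := fun b => !b) (of_exp (Exp.eq (Exp.var 0) Exp.nil) fun a => by
    cases a <;> simp [Exp.eval, Store.input_zero, enc_bool, Val.ofBool]) hf

lemma ite {f : α → Bool} {g h : α → β} (hf : PolyTime f) (hg : PolyTime g) (hh : PolyTime h) :
    PolyTime (fun a => if f a = true then g a else h a) := by
  obtain ⟨m, c, hc⟩ := hf
  obtain ⟨m', c', hc'⟩ := hg
  obtain ⟨m'', c'', hc''⟩ := hh
  refine ⟨1, Cmd.call 1 c (Exp.var 0) ;; Cmd.ite (Exp.var 1) (Cmd.call 0 c' (Exp.var 0))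
    (Cmd.call 0 c'' (Exp.var 0)), Triple.computes ?_⟩
  refine Triple.call_seq hc (fun a s hs => ⟨a, by simp [hs, Exp.eval, Store.input_zero]⟩)
    (Triple.ite (Triple.call hc' ?_) (Triple.call hc'' ?_))
  all_goals
    rintro a s ⟨⟨s₀, b, rfl, hb, rfl⟩, h⟩
    obtain rfl : a = b := Enc.inj (by simpa [Exp.eval, Store.input_zero] using hb)
    refine ⟨a, by simp [Exp.eval, Store.input_zero], ?_⟩
    simp only [Exp.eval, Function.update_self, enc_bool, ne_eq, ofBool_eq_nil] at h
    simp [h]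

lemma list_cases {f : α → List β} {g : α → γ} {h : α × β × List β → γ} (hf : PolyTime f)
    (hg : PolyTime g) (hh : PolyTime h) :
    PolyTime (fun a => match f a with | [] => g a | b :: l => h (a, b, l)) := by
  obtain ⟨m, c, hc⟩ := hf
  obtain ⟨m', c', hc'⟩ := hg
  obtain ⟨m'', c'', hc''⟩ := hh
  refine ⟨1, Cmd.call 1 c (Exp.var 0) ;; Cmd.ite (Exp.var 1)
    (Cmd.call 0 c'' (Exp.cons (Exp.var 0) (Exp.var 1))) (Cmd.call 0 c' (Exp.var 0)),
    Triple.computes ?_⟩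
  refine Triple.call_seq hc (fun a s hs => ⟨a, by simp [hs, Exp.eval, Store.input_zero]⟩)
    (Triple.ite (Triple.call hc'' ?_) (Triple.call hc' ?_))
  all_goals
    rintro a s ⟨⟨s₀, b, rfl, hb, rfl⟩, h⟩
    obtain rfl : a = b := Enc.inj (by simpa [Exp.eval, Store.input_zero] using hb)
    simp only [Exp.eval, Function.update_self, ne_eq, enc_list_eq_nil] at h
  · obtain ⟨b, l, hl⟩ := List.exists_cons_of_ne_nil h
    exact ⟨(a, b, l), by simp [Exp.eval, Store.input_zero, hl, enc_pair, enc_cons], by simp [hl]⟩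
  · exact ⟨a, by simp [Exp.eval, Store.input_zero], by simp [h]⟩

/-- Iterating a polynomial-time function can make values grow exponentially; `hsize` excludes this
by bounding the result on every prefix `l` of the list. -/
lemma foldl {f : α → List β} {g : α → γ} {h : α × γ × β → γ} (hf : PolyTime f)
    (hg : PolyTime g) (hh : PolyTime h)
    (hsize : ∃ q : Polynomial ℕ, ∀ a l l', f a = l ++ l' →
      (enc (l.foldl (fun x b => h (a, x, b)) (g a))).size ≤ q.eval (enc a).size) :
    PolyTime (fun a => (f a).foldl (fun x b => h (a, x, b)) (g a)) := by
  obtain ⟨m, c, hc⟩ := hf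
  obtain ⟨m', c', hc'⟩ := hg
  obtain ⟨m'', c'', hc''⟩ := hh
  obtain ⟨p, hp⟩ := hc.size_le
  obtain ⟨q, hq⟩ := hsize
  refine ⟨4, Cmd.call 4 c (Exp.var 0) ;; Cmd.call 1 c' (Exp.var 0) ;;
    Cmd.foreach 2 3 (Exp.var 4)
      (Cmd.call 1 c'' (Exp.cons (Exp.var 0) (Exp.cons (Exp.var 1) (Exp.var 2)))) ;;
    0 ::= Exp.var 1, Triple.computes ?_⟩
  refine Triple.call_seq hc (fun a s hs => ⟨a, by simp [hs, Exp.eval, Store.input_zero]⟩)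
    (Triple.call_seq hc' ?_ (Triple.seq (Q := fun a s => s 1 =
      enc ((f a).foldl (fun x b => h (a, x, b)) (g a))) (Triple.foreach (L := f)
      (I := fun a l _ s => s 0 = enc a ∧ s 1 = enc (l.foldl (fun x b => h (a, x, b)) (g a)) ∧
        s 4 = enc (f a) ∧ (s 2).size ≤ (enc (f a)).size) ?_ ?_ ?_ ?_ (by decide))
      (Triple.assign ?_)))
  · rintro a s ⟨s₀, b, rfl, hb, rfl⟩
    exact ⟨a, by simp [Exp.eval, Store.input_zero]⟩
  · refine Triple.call hc'' ?_
    rintro ⟨a, l, b, l'⟩ s ⟨hl, s₀, ⟨h0, h1, h4, h2⟩, rfl⟩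
    simp only at hl h0 h1 h4 h2
    refine ⟨(a, l.foldl (fun x b => h (a, x, b)) (g a), b), ?_, ?_⟩
    · simp [Exp.eval, h0, h1, enc_pair]
    · have : b ∈ f a := by simp [hl]
      simp [h0, h4, (size_enc_mem this).le]
  · rintro a s ⟨s₀, b, ⟨s₁, b', rfl, hb, rfl⟩, hb', rfl⟩
    obtain rfl : a = b' := Enc.inj (by simpa [Exp.eval, Store.input_zero] using hb)
    obtain rfl : a = b := Enc.inj (by simpa [Exp.eval, Store.input_zero] using hb')
    refine ⟨by simp [Exp.eval], by simp [Store.input_zero], by simp, by simp, ?_⟩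
    simp [Store.input, Val.size, Val.one_le_size]
  · rintro a s ⟨h0, h1, -⟩ -
    exact h1
  · refine ⟨Polynomial.X + q + p + p + p, ?_⟩
    rintro a l l' s hl ⟨h0, h1, h4, h2⟩ h3
    have := hp a
    have := hq a l l' hl
    have h5 := size_enc_append l l'
    have h6 := (enc l).one_le_size
    rw [← hl] at h5
    have h7 : s.size = (s 0).size + (s 1).size + (s 2).size + (s 3).size + (s 4).size :=
      Fin.sum_univ_five _
    rw [h0, h1, h3, h4] at h7
    simp only [Polynomial.eval_add, Polynomial.eval_X]
    omega
  · rintro a s h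
    simpa [Exp.eval] using h

lemma size_le {f : α → β} (hf : PolyTime f) :
    ∃ p : Polynomial ℕ, ∀ a, (enc (f a)).size ≤ p.eval (enc a).size :=
  let ⟨_, _, hc⟩ := hf
  hc.size_le

lemma reverse {f : α → List β} (hf : PolyTime f) : PolyTime (fun a => (f a).reverse) := by
  have key : ∀ l l' : List β, l.foldl (fun x b => b :: x) l' = l.reverse ++ l' := by
    intro l
    induction l with
    | nil => simp
    | cons b l ih => simp [ih]
  have hs : ∀ l : List β, (enc l.reverse).size = (enc l).size := by
    intro l
    induction l with
    | nil => rfl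
    | cons b l ih =>
      have := size_enc_append l.reverse [b]
      simp only [List.reverse_cons, enc_cons, enc_nil, Val.size] at this ⊢
      omega
  have := foldl (h := fun x : α × List β × β => x.2.2 :: x.2.1) hf (const []) 
    (cons (snd (snd id)) (fst (snd id))) ?_
  · simpa [key] using this
  · obtain ⟨p, hp⟩ := hf.size_le
    refine ⟨p, fun a l l' hl => ?_⟩
    have h1 := hp a
    rw [hl] at h1
    have h2 := size_enc_append l l'
    have h3 := (enc l').one_le_size
    simp only [key, List.append_nil, hs]
    omega

lemma append {f g : α → List β} (hf : PolyTime f) (hg : PolyTime g) :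
    PolyTime (fun a => f a ++ g a) := by
  have key : ∀ l l' : List β, l.foldl (fun x b => b :: x) l' = l.reverse ++ l' := by
    intro l
    induction l with
    | nil => simp
    | cons b l ih => simp [ih]
  have := foldl (h := fun x : α × List β × β => x.2.2 :: x.2.1) hf.reverse hg
    (cons (snd (snd id)) (fst (snd id))) ?_
  · simpa [key] using this
  · obtain ⟨p, hp⟩ := hf.size_le
    obtain ⟨q, hq⟩ := hg.size_le
    refine ⟨p + q, fun a l l' hl => ?_⟩
    have h0 : f a = l'.reverse ++ l.reverse := by
      rw [← List.reverse_append, ← hl, List.reverse_reverse]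
    have h1 := hp a
    rw [h0] at h1
    have h2 := size_enc_append l'.reverse l.reverse
    have h3 := (enc l'.reverse).one_le_size
    have h4 := size_enc_append l.reverse (g a)
    have h5 := hq a
    simp only [key, Polynomial.eval_add]
    omega

lemma flatMap {f : α → List β} {h : α × β → List γ} (hf : PolyTime f) (hh : PolyTime h) :
    PolyTime (fun a => (f a).flatMap fun b => h (a, b)) := by
  have key : ∀ (a : α) (l : List β) (l' : List γ),
      l.foldl (fun x b => x ++ h (a, b)) l' = l' ++ l.flatMap fun b => h (a, b) := by
    intro a l
    induction l with
    | nil => simp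
    | cons b l ih => simp [ih]
  have := foldl (h := fun x : α × List γ × β => x.2.1 ++ h (x.1, x.2.2)) hf (const [])
    (append (fst (snd id)) (comp hh (pair (fst id) (snd (snd id))))) ?_
  · simpa [key] using this
  · obtain ⟨p, hp⟩ := hf.size_le
    obtain ⟨q, hq⟩ := hh.size_le
    refine ⟨p * q.comp (1 + Polynomial.X + p) + 1, fun a l l' hl => ?_⟩
    simp only [key, List.nil_append, Polynomial.eval_add, Polynomial.eval_mul,
      Polynomial.eval_comp, Polynomial.eval_one, Polynomial.eval_X]
    have h1 : ∀ b ∈ l, (enc (h (a, b))).size ≤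
        q.eval (1 + (enc a).size + p.eval (enc a).size) := by
      intro b hb
      refine (hq (a, b)).trans (q.eval_mono_nat ?_)
      have h2 : b ∈ f a := by rw [hl]; exact List.mem_append_left _ hb
      have h3 := size_enc_mem h2
      have h4 := hp a
      simp only [enc_pair, Val.size]
      omega
    have h2 : l.length ≤ p.eval (enc a).size := by
      have h3 := length_lt_size_enc (f a)
      have h4 := hp a
      rw [hl, List.length_append] at h3
      rw [hl] at h4
      omega
    refine le_trans ?_ (Nat.add_le_add_right (Nat.mul_le_mul_right _ h2) 1)
    clear hl h2
    induction l with
    | nil => simp [enc_nil, Val.size]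
    | cons b l ih =>
      have h3 := ih fun c hc => h1 c (List.mem_cons_of_mem _ hc)
      have h4 := h1 b List.mem_cons_self
      have h5 := size_enc_append (h (a, b)) (l.flatMap fun b => h (a, b))
      rw [List.flatMap_cons, List.length_cons, add_mul]
      omega

lemma map {f : α → List β} {h : α × β → γ} (hf : PolyTime f) (hh : PolyTime h) :
    PolyTime (fun a => (f a).map fun b => h (a, b)) := by
  have := flatMap hf (cons hh (const []))
  simpa only [← List.map_eq_flatMap] using this

lemma filter {f : α → List β} {h : α × β → Bool} (hf : PolyTime f) (hh : PolyTime h) :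
    PolyTime (fun a => (f a).filter fun b => h (a, b)) := by
  have := flatMap hf (ite hh (cons (snd id) (const [])) (const []))
  have key : ∀ a, ((f a).flatMap fun b => if h (a, b) = true then [b] else []) =
      (f a).filter fun b => h (a, b) := by
    intro a
    induction f a with
    | nil => simp
    | cons b l ih => by_cases hb : h (a, b) = true <;> simp [ih, hb]
  simpa [key] using this

lemma any {f : α → List β} {h : α × β → Bool} (hf : PolyTime f) (hh : PolyTime h) :
    PolyTime (fun a => (f a).any fun b => h (a, b)) := by
  have := list_cases (filter hf hh) (const false) (h := fun _ => true) (const true)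
  convert this using 2 with a
  split
  · rename_i h0
    simpa [List.filter_eq_nil_iff] using h0
  · rename_i b l h0
    have : b ∈ (f a).filter fun b => h (a, b) := by simp [h0]
    simp only [List.mem_filter] at this
    simpa using ⟨b, this⟩

lemma mem [DecidableEq β] {f : α → List β} {g : α → β} (hf : PolyTime f) (hg : PolyTime g) :
    PolyTime (fun a => decide (g a ∈ f a)) := by
  have := any (h := fun x : α × β => decide (x.2 = g x.1)) hf (beq (snd id) (comp hg (fst id)))
  convert this using 2 with a
  rw [Bool.eq_iff_iff]
  simp

end PolyTime

/-! ## The subprograms of the algorithm `P` -/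

/-- A literal, as a pair of its sign and a value that names its variable. -/
abbrev RawLit := Bool × Val

lemma Triple.mono_factor {α : Type*} {k : ℕ} {N M : α → ℕ} {P Q : α → Store k → Prop} {c : Cmd k}
    (h : Triple N 0 P c Q) : Triple N M P c Q :=
  h.weaken 1 fun a s _ => by simp

lemma computes_memberProg :
    Computes memberProg (fun x : Val × List Val => decide (x.1 ∈ x.2)) := by
  refine Triple.computes (Triple.assign_seq (Triple.assign_seq (Triple.seq
    (Q := fun a s => s 4 = Val.ofBool (decide (a.1 ∈ a.2)))
    (Triple.foreach (L := fun a : Val × List Val => a.2) (I := fun a l _ s => s 0 = enc a ∧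
      s 1 = a.1 ∧ s 4 = Val.ofBool (decide (a.1 ∈ l)) ∧ (s 2).size ≤ (enc a).size)
      ?_ ?_ ?_ ?_ (by decide)) (Triple.assign ?_))))
  · refine Triple.ite (Triple.assign ?_) (Triple.skip ?_)
    all_goals
      rintro ⟨a, l, b, l'⟩ s ⟨⟨hl, s₀, ⟨h0, h1, h4, h2⟩, rfl⟩, h⟩
      simp only at hl h0 h1 h4 h2
      have hb : (enc b).size < (enc a).size := by
        have : b ∈ a.2 := by simp [hl]
        have := size_enc_mem this
        simp only [enc_pair, Val.size]
        omega
      simp only [Exp.eval] at h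
      simp [h1, ofBool_eq_nil, enc_val] at h
    · subst h; simp [h0, h1, hb.le, Exp.eval, Val.ofBool]
    · simp [h0, h1, hb.le, h4, Ne.symm h]
  · rintro a s ⟨s₀, ⟨s₁, rfl, rfl⟩, rfl⟩
    have h1 := Val.one_le_size (enc a)
    refine ⟨by simp [Store.input, Exp.eval, enc_pair, Val.tail], by simp [Store.input],
      by simp [Store.input, Exp.eval, enc_pair, Val.head, enc_val],
      by simp [Exp.eval, Val.ofBool], ?_⟩
    simpa [Store.input, Val.size] using h1
  · rintro a s ⟨h0, h1, h4, h2⟩ -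
    exact h4
  · refine ⟨5 * (Polynomial.X + 3), ?_⟩
    rintro a l l' s hl ⟨h0, h1, h4, h2⟩ h3
    have h5 := size_enc_append l l'
    have h6 := (enc l).one_le_size
    rw [← hl] at h5
    have h7 := Val.size_ofBool_le (decide (a.1 ∈ l))
    have h8 : s.size = (s 0).size + (s 1).size + (s 2).size + (s 3).size + (s 4).size :=
      Fin.sum_univ_five _
    have h9 : (enc a).size = 1 + a.1.size + (enc a.2).size := rfl
    simp only [h0, h1, h3, h4] at h8
    simp only [Polynomial.eval_mul, Polynomial.eval_ofNat, Polynomial.eval_add, Polynomial.eval_X]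
    omega
  · rintro a s h
    simpa [Exp.eval, enc_bool] using h

def addVars (V : List Val) (c : List RawLit) : List Val :=
  c.foldl (fun V l => if l.2 ∈ V then V else l.2 :: V) V

lemma addVars_concat (V : List Val) (c : List RawLit) (l : RawLit) :
    addVars V (c ++ [l]) = if l.2 ∈ addVars V c then addVars V c else l.2 :: addVars V c := by
  rw [addVars, List.foldl_append]
  rfl

lemma size_addVars_le (V : List Val) (c : List RawLit) :
    (enc (addVars V c)).size + 1 ≤ (enc V).size + (enc c).size := by
  unfold addVars
  induction c generalizing V with
  | nil => simp [enc_nil, Val.size]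
  | cons l c ih =>
    rw [List.foldl_cons]
    split_ifs with h
    · refine (ih V).trans ?_
      simp only [enc_cons, Val.size]
      omega
    · refine (ih _).trans ?_
      simp only [enc_cons, enc_pair, enc_val, Val.size]
      omega

lemma size_foldl_addVars_le (V : List Val) (F : List (List RawLit)) :
    (enc (F.foldl addVars V)).size ≤ (enc V).size + (enc F).size := by
  induction F generalizing V with
  | nil => simp
  | cons c F ih =>
    rw [List.foldl_cons]
    refine (ih _).trans ?_
    have := size_addVars_le V c
    simp only [enc_cons, Val.size]
    omega

lemma computes_varsProg :
    Computes varsProg (fun F : List (List RawLit) => F.foldl addVars []) := by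
  refine Triple.computes (Triple.assign_seq (Triple.seq
    (Q := fun F s => s 1 = enc (F.foldl addVars []))
    (Triple.foreach (L := fun F => F) (I := fun F l _ s => s 0 = enc F ∧
      s 1 = enc (l.foldl addVars []) ∧ ∀ i, i ≠ 3 → (s i).size ≤ (enc F).size + 3)
      ?_ ?_ ?_ ?_ (by decide)) (Triple.assign ?_)))
  · refine Triple.foreach (L := fun a => a.2.2.1) (I := fun a l _ s => s 0 = enc a.1 ∧
      s 1 = enc (addVars (a.2.1.foldl addVars []) l) ∧ s 3 = enc a.2.2.2 ∧
      a.1 = a.2.1 ++ a.2.2.1 :: a.2.2.2 ∧ ∀ i, i ≠ 5 → (s i).size ≤ (enc a.1).size + 3)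
      ?_ ?_ ?_ ?_ (by decide)
    · refine Triple.call_seq computes_memberProg (fun a s hs => ?_)
        (Triple.ite (Triple.skip ?_) (Triple.assign ?_))
      · rcases a with ⟨⟨F, G, c, G'⟩, d, l, d'⟩
        obtain ⟨hl, s₀, ⟨h0, h1, h3, hF, h2⟩, rfl⟩ := hs
        exact ⟨(l.2, addVars (G.foldl addVars []) d), by
          simp [Exp.eval, h1, enc_pair, Val.tail, enc_val]⟩
      all_goals
        rintro ⟨⟨F, G, c, G'⟩, d, l, d'⟩ s ⟨⟨s₁, ⟨x, V⟩, ⟨hl, s₀, ⟨h0, h1, h3, hF, h2⟩, rfl⟩,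
          hx, rfl⟩, h⟩
        simp only at hl h0 h1 h3 h2 hF
        simp only [Exp.eval, h1, enc_pair, Val.tail, enc_val, Function.update_self, ne_eq,
          Fin.isValue, not_false_eq_true, Function.update_of_ne, Val.cons.injEq,
          Fin.reduceEq, enc_bool, ofBool_eq_nil] at hx h
        obtain ⟨rfl, hx⟩ := hx
        obtain rfl := Enc.inj hx
        have hc := size_enc_mem (show l ∈ c by simp [hl])
        have hc' := size_enc_mem (show c ∈ F by simp [hF])
        have hlv : l.2.size < (enc l).size := by simp only [enc_pair, Val.size, enc_val]; omega
        have hb := Val.size_ofBool_le (decide (l.2 ∈ addVars (G.foldl addVars []) d))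
        -- The names collected so far come from the part of `F` already read, so their list is no
        -- larger than that part, up to a constant.
        have hd : (enc (addVars (G.foldl addVars []) (d ++ [l]))).size ≤ (enc F).size + 3 := by
          have e1 := size_foldl_addVars_le [] (G ++ [c])
          have e2 := size_enc_append (G ++ [c]) G'
          have e3 := size_addVars_le (G.foldl addVars []) (d ++ [l])
          have e4 := size_enc_append (d ++ [l]) d'
          have e5 := size_foldl_addVars_le [] G
          have e6 := size_enc_append G (c :: G')
          have e7 := (enc d').one_le_size
          have e8 := (enc G').one_le_size
          simp only [List.append_assoc, List.singleton_append, ← hF, ← hl, enc_nil, enc_cons,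
            Val.size] at e1 e2 e3 e4 e5 e6
          omega
      · have hd2 : addVars (G.foldl addVars []) (d ++ [l]) = addVars (G.foldl addVars []) d := by
          rw [addVars_concat, if_pos (by simpa using h)]
        simp only [hd2, h0, h1, h3, Fin.isValue, ne_eq, Fin.reduceEq, not_false_eq_true,
          Function.update_of_ne, Function.update_self, true_and]
        refine ⟨hF, ?_⟩
        intro i hi
        by_cases h6 : i = 6
        · subst h6; simp only [Function.update_self, enc_bool]; omega
        by_cases h4 : i = 4
        · subst h4; simp; omega
        simpa [h6, h4, hi] using h2 i hi
      · have hd2 : addVars (G.foldl addVars []) (d ++ [l]) =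
            l.2 :: addVars (G.foldl addVars []) d := by
          rw [addVars_concat, if_neg (by simpa using h)]
        simp only [hd2, h0, h1, h3, Fin.isValue, ne_eq, Fin.reduceEq, not_false_eq_true,
          Function.update_of_ne, Function.update_self, true_and, Exp.eval, enc_pair, Val.tail,
          enc_cons, enc_val]
        refine ⟨hF, ?_⟩
        intro i hi
        by_cases h1' : i = 1
        · subst h1'
          rw [hd2, enc_cons, enc_val] at hd
          simpa using hd
        by_cases h6 : i = 6
        · subst h6; simp [enc_bool]; omega
        by_cases h4 : i = 4
        · subst h4; simp only [enc_pair, enc_val, Val.size] at hc; simp [Val.size]; omega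
        simpa [h6, h4, hi, h1'] using h2 i hi
    · rintro ⟨F, G, c, G'⟩ s ⟨hF, s₀, ⟨h0, h1, h2⟩, rfl⟩
      simp only at hF h0 h1 h2
      have hc' := size_enc_mem (show c ∈ F by simp [hF])
      refine ⟨by simp [Exp.eval], by simp [h0], by simp [h1, addVars], by simp, hF, ?_⟩
      intro i hi
      by_cases h3 : i = 3
      · subst h3
        have e6 := size_enc_append G (c :: G')
        have e8 := (enc G).one_le_size
        rw [← hF] at e6
        simp only [enc_cons, Val.size] at e6
        simp
        omega
      by_cases h3' : i = 2
      · subst h3'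
        simp
        omega
      simpa [h3, hi, h3'] using h2 i h3
    · rintro ⟨F, G, c, G'⟩ s ⟨h0, h1, h3, hF, h2⟩ h5
      refine ⟨h3, h0, by simpa using h1, ?_⟩
      intro i hi
      by_cases h5' : i = 5
      · subst h5'; rw [h5]; simp [Val.size]
      · exact h2 i h5'
    · refine ⟨7 * (Polynomial.X + 3), ?_⟩
      rintro ⟨F, G, c, G'⟩ d d' s hl ⟨h0, h1, h3, hF, h2⟩ h5
      simp only at hl h0 h1 h3 h2 hF
      have := s.size_le_mul (J := (enc F).size + 3) fun i => by
        by_cases h5' : i = 5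
        · subst h5'
          have e1 := size_enc_append d d'
          have e2 := (enc d).one_le_size
          have hc' := size_enc_mem (show c ∈ F by simp [hF])
          rw [← hl] at e1
          rw [h5]
          omega
        · exact h2 i h5'
      simpa using this
  · rintro F s ⟨s₀, rfl, rfl⟩
    refine ⟨by simp [Exp.eval, Store.input], by simp [Store.input], by simp [Exp.eval, enc_nil], ?_⟩
    intro i hi
    simp only [Store.input, Function.update_apply, Exp.eval, hi, if_false]
    split_ifs <;> simp [Val.size]
  · rintro F s ⟨h0, h1, h2⟩ h3
    exact h1
  · refine ⟨7 * (Polynomial.X + 3), ?_⟩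
    rintro F G G' s hF ⟨h0, h1, h2⟩ h3
    have := s.size_le_mul (J := (enc F).size + 3) fun i => by
      by_cases h5' : i = 3
      · subst h5'
        have e1 := size_enc_append G G'
        have e2 := (enc G).one_le_size
        rw [← hF] at e1
        rw [h3]
        omega
      · exact h2 i h5'
    simpa using this
  · rintro F s h
    simpa [Exp.eval] using h

/-- The elements of `V` whose bit in `B` is set, in reverse order, in front of `X`. -/
def selectVals {β : Type*} (X : List β) : List Bool → List β → List β
  | _, [] => X
  | B, v :: V => selectVals (if B.headD false then v :: X else X) B.tail V

/-- `selectVals` is tail recursive, so the loop invariant is that its value on the current registers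
equals the final result. What `X` gains in size is lost by the unread part of `V`. -/
lemma computes_selectProg :
    Computes selectProg (fun x : List Bool × List Val => selectVals [] x.1 x.2) := by
  refine Triple.computes (Triple.assign_seq (Triple.assign_seq (Triple.assign_seq (Triple.seq
    (Q := fun a s => s 3 = enc (selectVals [] a.1 a.2))
    ((((Triple.while_loop (T := fun a => a.2.length) (M' := 0) (I := fun a i s =>
      ∃ (X : List Val) (B : List Bool) (V : List Val), s 1 = enc B ∧ s 2 = enc V ∧ s 3 = enc X ∧
        selectVals X B V = selectVals [] a.1 a.2 ∧ V.length + i = a.2.length ∧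
        (s 0).size ≤ (enc a).size ∧ (enc B).size ≤ (enc a).size ∧
        (enc X).size + (enc V).size ≤ (enc a).size) ?_ ?_ ?_ ?_).weaken Polynomial.X ?_).conseq
        ?_ ?_)) (Triple.assign ?_)))))
  · refine Triple.seq (Q := fun a s => a.2 < a.1.2.length ∧ ∃ (X : List Val) (B : List Bool) (v : Val) (V : List Val), s 1 = enc B ∧
      s 2 = enc (v :: V) ∧ s 3 = enc X ∧
        selectVals X B.tail V = selectVals [] a.1.1 a.1.2 ∧ V.length + (a.2 + 1) = a.1.2.length ∧
        (s 0).size ≤ (enc a.1).size ∧ (enc B).size ≤ (enc a.1).size ∧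
        (enc X).size + (enc V).size ≤ (enc a.1).size)
      (Triple.ite (Triple.assign ?_) (Triple.skip ?_)) (Triple.assign_seq (Triple.assign ?_))
    · rintro ⟨⟨B₀, V₀⟩, i⟩ s ⟨⟨⟨X, B, V, h1, h2, h3, h4, h5, h6, h7, h8⟩, hi⟩, h⟩
      simp only at h4 h5 h6 h7 h8 hi
      refine ⟨hi, ?_⟩
      obtain _ | ⟨v, V⟩ := V
      · simp at h5; omega
      obtain _ | ⟨b, B⟩ := B
      · simp [Exp.eval, h1, enc_nil, Val.head] at h
      obtain rfl : b = true := by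
        simpa [Exp.eval, h1, enc_cons, Val.head, enc_bool, ofBool_eq_nil] using h
      refine ⟨v :: X, true :: B, v, V, by simp [h1], by simp [h2],
        by simp [h2, h3, Exp.eval, enc_cons, Val.head], by simpa [selectVals] using h4, ?_,
        by simpa using h6, h7, ?_⟩
      · simp only [List.length_cons] at h5
        simp only
        omega
      · simp only [enc_cons, Val.size] at h8 ⊢
        omega
    · rintro ⟨⟨B₀, V₀⟩, i⟩ s ⟨⟨⟨X, B, V, h1, h2, h3, h4, h5, h6, h7, h8⟩, hi⟩, h⟩
      simp only at h4 h5 h6 h7 h8 hi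
      refine ⟨hi, ?_⟩
      obtain _ | ⟨v, V⟩ := V
      · simp at h5; omega
      have hb : B.headD false = false := by
        obtain _ | ⟨b, B⟩ := B
        · rfl
        · simpa [Exp.eval, h1, enc_cons, Val.head, enc_bool, ofBool_eq_nil] using h
      refine ⟨X, B, v, V, h1, h2, h3, by rw [selectVals, hb] at h4; simpa using h4, ?_, h6, h7, ?_⟩
      · simp only [List.length_cons] at h5
        simp only
        omega
      · simp only [enc_cons, Val.size] at h8
        simp only
        omega
    · rintro ⟨⟨B₀, V₀⟩, i⟩ s ⟨s₀, ⟨hi, X, B, v, V, h1, h2, h3, h4, h5, h6, h7, h8⟩, rfl⟩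
      refine ⟨X, B.tail, V, ?_, by simp [h2, Exp.eval, enc_cons, Val.tail], by simp [h3], h4, h5,
        by simpa using h6, ?_, h8⟩
      · obtain _ | ⟨b, B⟩ := B <;> simp [h1, Exp.eval, enc_cons, enc_nil, Val.tail]
      · obtain _ | ⟨b, B⟩ := B
        · exact h7
        · simp only [enc_cons, Val.size] at h7
          simp only [List.tail_cons]
          omega
  · rintro ⟨B₀, V₀⟩ i s hi ⟨X, B, V, h1, h2, h3, h4, h5, h6, h7, h8⟩
    obtain _ | ⟨v, V⟩ := V
    · simp at h5 hi; omega
    · simp [Exp.eval, h2, enc_cons]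
  · rintro ⟨B₀, V₀⟩ s ⟨X, B, V, h1, h2, h3, h4, h5, h6, h7, h8⟩
    obtain _ | ⟨v, V⟩ := V
    · simp [Exp.eval, h2, enc_nil]
    · simp at h5
  · refine ⟨4 * Polynomial.X, ?_⟩
    rintro ⟨B₀, V₀⟩ i s - ⟨X, B, V, h1, h2, h3, h4, h5, h6, h7, h8⟩
    have := s.size_le_mul (J := (enc (B₀, V₀)).size) fun i => by
      fin_cases i
      · exact h6
      · simpa [h1] using h7
      · simp only [Fin.reduceFinMk, h2]; omega
      · simp only [Fin.reduceFinMk, h3]; omega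
    simpa using this
  · rintro ⟨B₀, V₀⟩ s -
    have := length_lt_size_enc V₀
    simp only [Pi.zero_apply, zero_add, Finset.sum_const, Finset.card_range, smul_eq_mul, mul_one,
      Polynomial.eval_X, enc_pair, Val.size]
    omega
  · rintro ⟨B₀, V₀⟩ s ⟨s₀, ⟨s₁, ⟨s₂, rfl, rfl⟩, rfl⟩, rfl⟩
    refine ⟨[], B₀, V₀, by simp [Exp.eval, Store.input, enc_pair, Val.head],
      by simp [Exp.eval, Store.input, enc_pair, Val.tail], by simp [Exp.eval, enc_nil], rfl, rfl,
      by simp [Store.input], ?_, ?_⟩ <;> simp only [enc_pair, enc_nil, Val.size] <;> omega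
  · rintro ⟨B₀, V₀⟩ s ⟨X, B, V, h1, h2, h3, h4, h5, h6, h7, h8⟩
    obtain _ | ⟨v, V⟩ := V
    · rw [h3, ← h4]
      rfl
    · simp at h5
  · rintro a s h
    simpa [Exp.eval] using h

/-- The number of literals of a clause derived from the variables in `X`, in unary, and the clause
with these literals flipped, in reverse order. -/
def flipRaw (x : List RawLit × List Val) : List Val × List RawLit :=
  (List.replicate (x.1.countP fun l => l.2 ∈ x.2) Val.nil,
    (x.1.map fun l => if l.2 ∈ x.2 then (!l.1, l.2) else l).reverse)

lemma flipRaw_concat (c : List RawLit) (l : RawLit) (X : List Val) :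
    flipRaw (c ++ [l], X) = if l.2 ∈ X then
      (Val.nil :: (flipRaw (c, X)).1, (!l.1, l.2) :: (flipRaw (c, X)).2) else
      ((flipRaw (c, X)).1, l :: (flipRaw (c, X)).2) := by
  by_cases h : l.2 ∈ X <;> simp [flipRaw, h, List.countP_append, List.replicate_succ]

lemma size_enc_replicate (n : ℕ) : (enc (List.replicate n Val.nil)).size = 2 * n + 1 := by
  induction n with
  | zero => rfl
  | succ n ih =>
    simp only [List.replicate_succ, enc_cons, Val.size, ih, enc_val]
    omega

lemma size_flipRaw_fst_le (x : List RawLit × List Val) :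
    (enc (flipRaw x).1).size ≤ 2 * (enc x.1).size := by
  rw [flipRaw, size_enc_replicate]
  have h1 := List.countP_le_length (p := fun l : RawLit => decide (l.2 ∈ x.2)) (l := x.1)
  have h2 := length_lt_size_enc x.1
  omega

/-- Only the signs change, and a sign has one or three nodes; so no literal more than triples in
size. -/
lemma size_flipRaw_snd_le (x : List RawLit × List Val) :
    (enc (flipRaw x).2).size ≤ 3 * (enc x.1).size := by
  obtain ⟨c, X⟩ := x
  induction c using List.reverseRecOn with
  | nil => simp [flipRaw, enc_nil, Val.size]
  | append_singleton c l ih =>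
    have h0 := size_enc_append c [l]
    have h1 := Val.size_ofBool_le (!l.1)
    have h2 := (Val.ofBool l.1).one_le_size
    have h3 := l.2.one_le_size
    rw [flipRaw_concat]
    split_ifs with h <;>
      simp only [enc_cons, enc_nil, enc_pair, enc_bool, enc_val, Val.size] at ih h0 ⊢ <;> omega

lemma computes_flipProg : Computes flipProg flipRaw := by
  refine Triple.computes (Triple.assign_seq (Triple.assign_seq (Triple.assign_seq (Triple.seq
    (Q := fun a s => s 2 = enc (flipRaw a).1 ∧ s 3 = enc (flipRaw a).2)
    (Triple.foreach (L := fun a : List RawLit × List Val => a.1) (I := fun a l l' s => s 0 = enc a ∧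
      s 1 = enc a.2 ∧ s 2 = enc (flipRaw (l, a.2)).1 ∧ s 3 = enc (flipRaw (l, a.2)).2 ∧
      (s 4).size ≤ (enc a).size ∧ (s 6).size ≤ 3)
      ?_ ?_ ?_ ?_ (by decide)) (Triple.assign ?_)))))
  · refine Triple.call_seq computes_memberProg (fun a s hs => ?_)
        (Triple.ite (Triple.assign_seq (Triple.assign ?_)) (Triple.assign ?_))
    · rcases a with ⟨⟨c, X⟩, d, l, d'⟩
      obtain ⟨hl, s₀, ⟨h0, h1, -⟩, rfl⟩ := hs
      exact ⟨(l.2, X), by simp [Exp.eval, h1, enc_pair, Val.tail, enc_val]⟩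
    · rintro ⟨⟨c, X⟩, d, l, d'⟩ s ⟨s₂, ⟨⟨s₁, ⟨x, X'⟩, ⟨hl, s₀, ⟨h0, h1, h2, h3, h4, h6⟩, rfl⟩, hx,
        rfl⟩, h⟩, rfl⟩
      simp only at hl h0 h1 h2 h3 h4 h6
      simp only [Exp.eval, h1, enc_pair, Val.tail, enc_val, Function.update_self, ne_eq,
        Fin.isValue, not_false_eq_true, Function.update_of_ne, Val.cons.injEq,
        Fin.reduceEq, enc_bool, ofBool_eq_nil] at hx h
      obtain ⟨rfl, hx⟩ := hx
      obtain rfl := Enc.inj hx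
      have h : l.2 ∈ X := by simpa using h
      have hc := size_enc_mem (show l ∈ c by simp [hl])
      have hb := Val.size_ofBool_le (decide (l.2 ∈ X))
      have hc' : (enc (c, X)).size = 1 + (enc c).size + (enc X).size := rfl
      simp only [flipRaw_concat, if_pos h]
      refine ⟨by simp, by simp [h0], by simp [h1],
        by simp [Exp.eval, enc_cons, enc_val, h2], ?_, ?_, ?_⟩
      · simp [Exp.eval, enc_cons, enc_val, enc_pair, h3, Val.head, Val.tail, enc_bool,
          ofBool_eq_nil]
      · simp
        omega
      · simpa [enc_bool] using hb
    · rintro ⟨⟨c, X⟩, d, l, d'⟩ s ⟨⟨s₁, ⟨x, X'⟩, ⟨hl, s₀, ⟨h0, h1, h2, h3, h4, h6⟩, rfl⟩, hx,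
        rfl⟩, h⟩
      simp only at hl h0 h1 h2 h3 h4 h6
      simp only [Exp.eval, h1, enc_pair, Val.tail, enc_val, Function.update_self, ne_eq,
        Fin.isValue, not_false_eq_true, Function.update_of_ne, Val.cons.injEq,
        Fin.reduceEq, enc_bool, ofBool_eq_nil] at hx h
      obtain ⟨rfl, hx⟩ := hx
      obtain rfl := Enc.inj hx
      have h : l.2 ∉ X := by simpa using h
      have hc := size_enc_mem (show l ∈ c by simp [hl])
      have hb := Val.size_ofBool_le (decide (l.2 ∈ X))
      have hc' : (enc (c, X)).size = 1 + (enc c).size + (enc X).size := rfl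
      simp only [flipRaw_concat, if_neg h]
      refine ⟨by simp, by simp [h0], by simp [h1], by simp [h2], ?_, ?_, ?_⟩
      · simp [Exp.eval, enc_cons, h3]
      · simp
        omega
      · simpa [enc_bool] using hb
  · rintro ⟨c, X⟩ s ⟨s₀, ⟨s₁, ⟨s₂, rfl, rfl⟩, rfl⟩, rfl⟩
    have h1 := Val.one_le_size (enc (c, X))
    refine ⟨by simp [Exp.eval, Store.input, enc_pair, Val.head],
      by simp [Store.input], by simp [Store.input, Exp.eval, enc_pair, Val.tail],
      by simp [Exp.eval, flipRaw, enc_nil], by simp [Exp.eval, flipRaw, enc_nil], ?_, ?_⟩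
    · simpa [Store.input, Val.size] using h1
    · simp [Store.input, Val.size]
  · rintro a s ⟨h0, h1, h2, h3, -⟩ -
    exact ⟨h2, h3⟩
  · refine ⟨7 * (3 * Polynomial.X + 3), ?_⟩
    rintro ⟨c, X⟩ d d' s hl ⟨h0, h1, h2, h3, h4, h6⟩ h5
    have e1 := size_flipRaw_fst_le (d, X)
    have e2 := size_flipRaw_snd_le (d, X)
    have e3 := size_enc_append d d'
    have e4 := (enc d).one_le_size
    have e5 := (enc d').one_le_size
    have hc' : (enc (c, X)).size = 1 + (enc c).size + (enc X).size := rfl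
    simp only at hl h0 h1 h2 h3 h4 h6 e1 e2
    rw [← hl] at e3
    have := s.size_le_mul (J := 3 * (enc (c, X)).size + 3) fun i => by
      fin_cases i
      · simp only [Fin.zero_eta, h0]; omega
      · simp only [Fin.mk_one, h1]; omega
      · simp only [Fin.reduceFinMk, h2]; omega
      · simp only [Fin.reduceFinMk, h3]; omega
      · simp only [Fin.reduceFinMk]; omega
      · simp only [Fin.reduceFinMk, h5]; omega
      · simp only [Fin.reduceFinMk]; omega
    simpa using this
  · rintro a s ⟨h2, h3⟩
    simp [Exp.eval, h2, h3, enc_pair]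

/-! ## Strings of bits -/

/-- The `n` lowest bits of `i`, least significant bit first. -/
def lowBits : ℕ → ℕ → List Bool
  | 0, _ => []
  | n + 1, i => i.bodd :: lowBits n i.div2

lemma length_lowBits (n i : ℕ) : (lowBits n i).length = n := by
  induction n generalizing i with
  | zero => rfl
  | succ n ih => simp [lowBits, ih]

lemma lowBits_zero (n : ℕ) : lowBits n 0 = List.replicate n false := by
  induction n with
  | zero => rfl
  | succ n ih => simp [lowBits, ih, List.replicate_succ]

/-- Adding one to a binary number. -/
lemma lowBits_succ (n i : ℕ) (hi : i < 2 ^ n) :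
    (∃ j l, lowBits n i = List.replicate j true ++ false :: l ∧
      lowBits n (i + 1) = List.replicate j false ++ true :: l ∧ i + 1 < 2 ^ n) ∨
    (lowBits n i = List.replicate n true ∧ i + 1 = 2 ^ n) := by
  induction n generalizing i with
  | zero => right; simp at hi; simp [hi, lowBits]
  | succ n ih =>
    have h2 := Nat.bodd_add_div2 i
    rw [pow_succ] at hi ⊢
    cases hb : i.bodd
    · left
      rw [hb] at h2
      simp at h2
      refine ⟨0, lowBits n i.div2, by simp [lowBits, hb], ?_, by omega⟩
      simp [lowBits, hb, Nat.div2_succ]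
    · rw [hb] at h2
      simp at h2
      rcases ih i.div2 (by omega) with ⟨j, l, h3, h4, h5⟩ | ⟨h3, h4⟩
      · left
        refine ⟨j + 1, l, by simp [lowBits, hb, h3, List.replicate_succ], ?_, by omega⟩
        simp [lowBits, hb, Nat.div2_succ, h4, List.replicate_succ]
      · right
        exact ⟨by simp [lowBits, hb, h3, List.replicate_succ], by omega⟩

lemma selectVals_map {β γ : Type*} (f : β → γ) (X : List β) (B : List Bool) (V : List β) :
    selectVals (X.map f) B (V.map f) = (selectVals X B V).map f := by
  induction V generalizing X B with
  | nil => simp [selectVals]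
  | cons v V ih =>
    rw [List.map_cons, selectVals, selectVals, ← ih]
    split_ifs <;> simp

lemma toFinset_selectVals (X : List ℕ) (B : List Bool) (V : List ℕ) :
    (selectVals X B V).toFinset = X.toFinset ∪ (selectVals [] B V).toFinset := by
  induction V generalizing X B with
  | nil => simp [selectVals]
  | cons v V ih =>
    rw [selectVals, selectVals, ih, ih (if B.headD false = true then [v] else [])]
    ext x
    split_ifs <;> simp

lemma size_selectVals_le {β : Type*} [Enc β] (X : List β) (B : List Bool) (V : List β) :
    (enc (selectVals X B V)).size ≤ (enc X).size + (enc V).size := by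
  induction V generalizing X B with
  | nil => simp [selectVals]
  | cons v V ih =>
    rw [selectVals]
    refine (ih _ _).trans ?_
    split_ifs <;> simp only [enc_cons, Val.size] <;> omega

/-- The lowest bit decides about the head of the list: even indices give the subsets without `v`,
odd indices those with `v`, and halving the index leaves the same problem for the tail. -/
lemma sum_lowBits (V : List ℕ) (hV : V.Nodup) (f : Finset ℕ → ℕ) :
    ∑ i ∈ Finset.range (2 ^ V.length), f (selectVals [] (lowBits V.length i) V).toFinset =
      ∑ X ∈ V.toFinset.powerset, f X := by
  induction V generalizing f with
  | nil => simp [selectVals]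
  | cons v V ih =>
    rw [List.nodup_cons] at hV
    have h2 : ∀ (g : ℕ → ℕ) (m : ℕ), ∑ i ∈ Finset.range (2 * m), g i =
        ∑ i ∈ Finset.range m, (g (2 * i) + g (2 * i + 1)) := by
      intro g m
      induction m with
      | zero => simp
      | succ m ih => rw [Finset.sum_range_succ, ← ih, mul_add, mul_one, Finset.sum_range_succ,
          Finset.sum_range_succ]; ring
    rw [List.length_cons, pow_succ, mul_comm, h2, List.toFinset_cons,
      Finset.sum_powerset_insert (by simpa using hV.1), Finset.sum_add_distrib, ← ih hV.2,
      ← ih hV.2 (fun X => f (insert v X))]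
    congr 1
    · refine Finset.sum_congr rfl fun i _ => ?_
      simp [lowBits, selectVals]
    · refine Finset.sum_congr rfl fun i _ => ?_
      simp [lowBits, selectVals, Nat.div2_succ]
      rw [toFinset_selectVals]
      rfl

/-! ## Formulas as values -/

lemma Val.ofNat_injective : Function.Injective Val.ofNat := by
  intro a b h
  have h1 : a.bits = b.bits :=
    List.map_injective_iff.2 Val.ofBool_injective (Val.ofList_injective h)
  clear h
  induction a using Nat.binaryRec' generalizing b with
  | zero =>
    induction b using Nat.binaryRec' with
    | zero => rfl
    | bit y b hb _ =>
      rw [Nat.bits_append_bit b y hb] at h1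
      simp at h1
  | bit x a ha ih =>
    rw [Nat.bits_append_bit a x ha] at h1
    induction b using Nat.binaryRec' with
    | zero => simp at h1
    | bit y b hb _ =>
      rw [Nat.bits_append_bit b y hb, List.cons.injEq] at h1
      rw [h1.1, ih h1.2]

/-- The same representation as in `Formula.encode`, so that `Formula.encode_eq` holds by `rfl`. -/
instance : Enc Literal := ⟨fun l => Val.cons (Val.ofBool l.pos) (Val.ofNat l.var), fun x y h => by
  obtain ⟨x, a⟩ := x
  obtain ⟨y, b⟩ := y
  simp only [Val.cons.injEq] at h
  rw [Val.ofNat_injective h.2, Val.ofBool_injective h.1]⟩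

/-- Programs see a variable only as the value that names it. Passing to raw literals replaces
numbers by these values and leaves the stored formula unchanged. -/
def Literal.raw (l : Literal) : RawLit := (l.pos, Val.ofNat l.var)

def Clause.raw (c : Clause) : List RawLit := c.map Literal.raw

def Formula.raw (F : Formula) : List (List RawLit) := F.map Clause.raw

lemma enc_clause_raw (c : Clause) : enc (Clause.raw c) = enc c := by
  rw [enc_list, enc_list, Clause.raw, List.map_map]; rfl

lemma enc_formula_raw (F : Formula) : enc F.raw = enc F := by
  rw [enc_list, enc_list, Formula.raw, List.map_map]
  exact congrArg _ (List.map_congr_left fun c _ => enc_clause_raw c)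

lemma Formula.encode_eq (F : Formula) : F.encode = enc F := rfl

namespace Formula

/-- The list of the variables of a formula, without repetition. -/
def varList (F : Formula) : List ℕ :=
  F.flatten.foldl (fun V l => if l.var ∈ V then V else l.var :: V) []

lemma foldl_addVars (F : Formula) :
    F.raw.foldl addVars [] = F.varList.map Val.ofNat := by
  have h1 : ∀ (L : List Literal) (V : List ℕ), addVars (V.map Val.ofNat) (L.map Literal.raw) =
      (L.foldl (fun V l => if l.var ∈ V then V else l.var :: V) V).map Val.ofNat := by
    intro L
    induction L with
    | nil => intro V; rfl
    | cons l L ih =>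
      intro V
      have : (l.raw.2 ∈ V.map Val.ofNat) ↔ l.var ∈ V :=
        List.mem_map_of_injective Val.ofNat_injective
      rw [List.foldl_cons, ← ih, addVars, List.map_cons, List.foldl_cons, ← addVars]
      simp only [this]
      split_ifs <;> rfl
  have h2 : ∀ (F : Formula) (V : List ℕ), F.raw.foldl addVars (V.map Val.ofNat) =
      (F.flatten.foldl (fun V l => if l.var ∈ V then V else l.var :: V) V).map Val.ofNat := by
    intro F
    induction F with
    | nil => intro V; rfl
    | cons c F ih =>
      intro V
      rw [List.flatten_cons, List.foldl_append, ← ih, ← h1]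
      rfl
  exact h2 F []

lemma nodup_varList_and (F : Formula) : F.varList.Nodup ∧ F.varList.toFinset = F.vars := by
  have h1 : ∀ (L : List Literal) (V : List ℕ), V.Nodup →
      (L.foldl (fun V l => if l.var ∈ V then V else l.var :: V) V).Nodup ∧
      (L.foldl (fun V l => if l.var ∈ V then V else l.var :: V) V).toFinset =
        V.toFinset ∪ (L.map Literal.var).toFinset := by
    intro L
    induction L with
    | nil => intro V hV; simpa using hV
    | cons l L ih =>
      intro V hV
      rw [List.foldl_cons]
      split_ifs with h
      · refine ⟨(ih V hV).1, (ih V hV).2.trans ?_⟩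
        ext x
        simp only [Finset.mem_union, List.mem_toFinset, List.map_cons, List.mem_cons]
        constructor
        · tauto
        · rintro (h' | rfl | h') <;> tauto
      · refine ⟨(ih _ (List.nodup_cons.2 ⟨h, hV⟩)).1,
          (ih _ (List.nodup_cons.2 ⟨h, hV⟩)).2.trans ?_⟩
        ext x
        simp only [Finset.mem_union, List.mem_toFinset, List.map_cons, List.mem_cons]
        tauto
  simpa [varList, vars] using h1 F.flatten [] List.nodup_nil

lemma size_varList_le (F : Formula) : (enc (F.varList.map Val.ofNat)).size ≤ F.length + 1 := by
  rw [← foldl_addVars]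
  refine (size_foldl_addVars_le _ _).trans ?_
  rw [enc_formula_raw, enc_nil, Val.size, length, encode_eq, add_comm]

/-- The clause with the literals derived from `X` flipped, in reverse order. -/
def flipClause (X : Finset ℕ) (c : Clause) : Clause :=
  (c.map fun l => if l.var ∈ X then ⟨l.var, !l.pos⟩ else l).reverse

def Touched (X : Finset ℕ) (c : Clause) : Prop := ∃ l ∈ c, l.var ∈ X

instance (X : Finset ℕ) : DecidablePred (Touched X) :=
  fun c => inferInstanceAs (Decidable (∃ l ∈ c, l.var ∈ X))

/-- The flipped copies of the clauses of `F` that contain a literal derived from `X`. -/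
def flips (F : Formula) (X : Finset ℕ) : Formula :=
  ((F.filter fun c => Touched X c).map (flipClause X)).reverse

/-- Every clause contains 0 or 2 literals derived from `X`. -/
def Good (F : Formula) (X : Finset ℕ) : Prop :=
  ∀ c ∈ F, c.countP (fun l => l.var ∈ X) = 0 ∨ c.countP (fun l => l.var ∈ X) = 2

instance (F : Formula) (X : Finset ℕ) : Decidable (F.Good X) :=
  inferInstanceAs (Decidable (∀ c ∈ F, _ ∨ _))

lemma flipRaw_raw (c : Clause) (X : List ℕ) : flipRaw (Clause.raw c, X.map Val.ofNat) =
    (List.replicate (c.countP fun l => l.var ∈ X.toFinset) Val.nil,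
      Clause.raw (flipClause X.toFinset c)) := by
  have h : ∀ l : Literal, l.raw.2 ∈ X.map Val.ofNat ↔ l.var ∈ X := fun l =>
    List.mem_map_of_injective Val.ofNat_injective
  simp only [flipRaw, flipClause, Clause.raw, List.countP_map, List.map_map, List.map_reverse]
  congr 1
  · congr 1
    refine List.countP_congr fun l _ => ?_
    simp only [Function.comp, h, List.mem_toFinset]
  · congr 1
    refine List.map_congr_left fun l _ => ?_
    simp only [Function.comp, h, List.mem_toFinset]
    split_ifs <;> rfl

lemma flips_concat (F : Formula) (c : Clause) (X : Finset ℕ) :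
    flips (F ++ [c]) X = if Touched X c then flipClause X c :: flips F X else flips F X := by
  by_cases h : Touched X c <;> simp [flips, List.filter_append, h]

lemma good_concat (F : Formula) (c : Clause) (X : Finset ℕ) :
    Good (F ++ [c]) X ↔ Good F X ∧
      (c.countP (fun l => l.var ∈ X) = 0 ∨ c.countP (fun l => l.var ∈ X) = 2) := by
  simp only [Good, List.mem_append, List.mem_singleton]
  constructor
  · exact fun h => ⟨fun d hd => h d (Or.inl hd), h c (Or.inr rfl)⟩
  · rintro ⟨h1, h2⟩ d (hd | rfl)
    · exact h1 d hd
    · exact h2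

lemma touched_iff (X : Finset ℕ) (c : Clause) :
    Touched X c ↔ c.countP (fun l => l.var ∈ X) ≠ 0 := by
  simp [Touched, List.countP_eq_zero]

lemma size_flips_le (F : Formula) (X : Finset ℕ) : (enc (flips F X)).size ≤ 3 * (enc F).size := by
  induction F using List.reverseRecOn with
  | nil => simp [flips, enc_nil, Val.size]
  | append_singleton F c ih =>
    have h1 := size_enc_append F [c]
    have h2 : (enc (flipClause X c)).size ≤ 3 * (enc c).size := by
      have h3 := flipRaw_raw c X.toList
      have h4 := size_flipRaw_snd_le (Clause.raw c, X.toList.map Val.ofNat)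
      rw [h3] at h4
      simpa [enc_clause_raw] using h4
    rw [flips_concat]
    simp only [enc_cons, enc_nil, Val.size] at h1
    split_ifs
    · simp only [enc_cons, Val.size]
      omega
    · omega

lemma vars_flipClause (X : Finset ℕ) (c : Clause) :
    (flipClause X c).map Literal.var = (c.map Literal.var).reverse := by
  rw [flipClause, List.map_reverse, List.map_map]
  congr 1
  refine List.map_congr_left fun l _ => ?_
  simp only [Function.comp]
  split_ifs <;> rfl

lemma WellFormed.flips_append {F : Formula} (hF : F.WellFormed) (X : Finset ℕ) :
    WellFormed (flips F X ++ F) := by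
  intro c hc
  rcases List.mem_append.1 hc with hc | hc
  · simp only [flips, List.mem_reverse, List.mem_map, List.mem_filter] at hc
    obtain ⟨d, ⟨hd, -⟩, rfl⟩ := hc
    rw [vars_flipClause, List.nodup_reverse]
    exact hF d hd
  · exact hF c hc

/-- Flipping changes signs only. Hence all calls of the solver have the same parameter `n`, whatever
`X` is. -/
lemma vars_flips_append (F : Formula) (X : Finset ℕ) : vars (flips F X ++ F) = F.vars := by
  ext x
  simp only [vars, List.mem_toFinset, List.mem_map, List.mem_flatten, List.mem_append]
  constructor
  · rintro ⟨l, ⟨c, hc | hc, hl⟩, rfl⟩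
    · simp only [flips, List.mem_reverse, List.mem_map, List.mem_filter] at hc
      obtain ⟨d, ⟨hd, -⟩, rfl⟩ := hc
      have : l.var ∈ (flipClause X d).map Literal.var := List.mem_map_of_mem hl
      rw [vars_flipClause, List.mem_reverse, List.mem_map] at this
      obtain ⟨l', hl', h⟩ := this
      exact ⟨l', ⟨d, hd, hl'⟩, h⟩
    · exact ⟨l, ⟨c, hc, hl⟩, rfl⟩
  · rintro ⟨l, ⟨c, hc, hl⟩, rfl⟩
    exact ⟨l, ⟨c, Or.inr hc, hl⟩, rfl⟩

lemma length_flips_append_le (F : Formula) (X : Finset ℕ) :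
    length (flips F X ++ F) ≤ 4 * F.length := by
  have h1 := size_enc_append (flips F X) F
  have h2 := size_flips_le F X
  simp only [length, encode_eq]
  omega

end Formula

/-! ## The running time of the algorithm `P` -/

/-- The variables selected by a string of bits. -/
def Formula.select (F : Formula) (B : List Bool) : List ℕ := selectVals [] B F.varList

lemma Formula.size_select_le (F : Formula) (B : List Bool) :
    (enc ((F.select B).map Val.ofNat)).size ≤ F.length + 2 := by
  rw [select, ← selectVals_map]
  refine (size_selectVals_le _ _ _).trans ?_
  have := F.size_varList_le
  simp only [List.map_nil, enc_nil, Val.size]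
  omega

lemma Formula.length_varList_le (F : Formula) : F.varList.length ≤ F.length := by
  have h1 := F.size_varList_le
  have h2 := length_lt_size_enc (F.varList.map Val.ofNat)
  rw [List.length_map] at h2
  omega

lemma size_enc_bits_le (B : List Bool) : (enc B).size ≤ 4 * B.length + 1 := by
  have := size_enc_le B 3 fun b _ => Val.size_ofBool_le b
  omega

/-- The registers of `P` that are not changed while the subsets of size `k` are being enumerated,
and a bound for the sizes of all registers. -/
structure OuterInv (J : Formula → ℕ) (F : Formula) (k : ℕ) (s : Store 18) : Prop where
  wf : F.WellFormed
  le : k ≤ F.varList.length + 1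
  h0 : s 0 = enc F
  h1 : s 1 = enc (F.varList.map Val.ofNat)
  h3 : s 3 = enc (List.replicate k Val.nil)
  h4 : s 4 = enc ((Val.nil :: F.varList.map Val.ofNat).drop k)
  size : ∀ i, (s i).size ≤ J F

/-- The registers of `P` that are not changed while a subset `X` is being processed. -/
structure RegInv (J : Formula → ℕ) (F : Formula) (k : ℕ) (B : List Bool) (s : Store 18) : Prop
    extends OuterInv J F k s where
  len : B.length = F.varList.length
  h5 : s 5 = enc B
  h8 : s 8 = Val.ofBool true

lemma size_update_le_of {k J : ℕ} {s : Store k} (h : ∀ i, (s i).size ≤ J) (x : Fin k) {v : Val}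
    (hv : v.size ≤ J) (i : Fin k) : (Function.update s x v i).size ≤ J := by
  rcases eq_or_ne i x with rfl | hi
  · simpa using hv
  · rw [Function.update_of_ne hi]; exact h i

section

variable {J : Formula → ℕ} {F : Formula} {k : ℕ} {B : List Bool} {s : Store 18}

lemma OuterInv.update (h : OuterInv J F k s) {x : Fin 18} {v : Val} (hv : v.size ≤ J F)
    (hx : x ≠ 0 ∧ x ≠ 1 ∧ x ≠ 3 ∧ x ≠ 4) : OuterInv J F k (Function.update s x v) where
  wf := h.wf
  le := h.le
  h0 := by rw [Function.update_of_ne hx.1.symm, h.h0]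
  h1 := by rw [Function.update_of_ne hx.2.1.symm, h.h1]
  h3 := by rw [Function.update_of_ne hx.2.2.1.symm, h.h3]
  h4 := by rw [Function.update_of_ne hx.2.2.2.symm, h.h4]
  size := size_update_le_of h.size x hv

lemma RegInv.update (h : RegInv J F k B s) {x : Fin 18} {v : Val} (hv : v.size ≤ J F)
    (hx : (x ≠ 0 ∧ x ≠ 1 ∧ x ≠ 3 ∧ x ≠ 4) ∧ x ≠ 5 ∧ x ≠ 8) :
    RegInv J F k B (Function.update s x v) where
  toOuterInv := h.toOuterInv.update hv hx.1
  len := h.len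
  h5 := by rw [Function.update_of_ne hx.2.1.symm, h.h5]
  h8 := by rw [Function.update_of_ne hx.2.2.symm, h.h8]

lemma OuterInv.store_size (h : OuterInv J F k s) : s.size ≤ 18 * J F := s.size_le_mul h.size

end

lemma triple_select {J : Formula → ℕ} (hJ : ∀ F, 10 * F.length + 10 ≤ J F) (M) :
    Triple (fun a : Formula × ℕ × List Bool => a.1.length) M
      (fun a s => RegInv J a.1 a.2.1 a.2.2 s) (Cmd.call 9 selectProg (Exp.cons (Exp.var 5) (Exp.var 1)))
      (fun a s => RegInv J a.1 a.2.1 a.2.2 s ∧ s 9 = enc ((a.1.select a.2.2).map Val.ofNat)) := by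
  refine Triple.call computes_selectProg ?_
  rintro ⟨F, k, B⟩ s h
  refine ⟨(B, F.varList.map Val.ofNat), by simp [Exp.eval, h.h5, h.h1, enc_pair], h.update ?_
    (by decide), ?_⟩
  · have h1 := F.size_select_le B
    have h2 := hJ F
    have h3 := selectVals_map Val.ofNat [] B F.varList
    simp only [List.map_nil] at h3
    rw [h3, ← Formula.select]
    simp only
    omega
  · have h3 := selectVals_map Val.ofNat [] B F.varList
    simp only [List.map_nil] at h3
    rw [h3]
    simp [Formula.select]

lemma triple_count {J : Formula → ℕ} (hJ : ∀ F, 10 * F.length + 10 ≤ J F)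
    (hJ' : ∃ r : Polynomial ℕ, ∀ F : Formula, J F ≤ r.eval F.length) (M) :
    Triple (fun a : Formula × ℕ × List Bool => a.1.length) M
      (fun a s => RegInv J a.1 a.2.1 a.2.2 s ∧ s 9 = enc ((a.1.select a.2.2).map Val.ofNat) ∧
        s 10 = Val.nil)
      (Cmd.foreach 6 7 (Exp.var 9) (10 ::= Exp.cons Exp.nil (Exp.var 10)))
      (fun a s => RegInv J a.1 a.2.1 a.2.2 s ∧ s 9 = enc ((a.1.select a.2.2).map Val.ofNat)) := by
  refine Triple.foreach (L := fun a => (a.1.select a.2.2).map Val.ofNat)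
    (I := fun a l l' s => RegInv J a.1 a.2.1 a.2.2 s ∧ s 9 = enc ((a.1.select a.2.2).map Val.ofNat) ∧
      s 10 = enc (List.replicate l.length Val.nil)) ?_ ?_ ?_ ?_ (by decide)
  · refine Triple.assign ?_
    rintro ⟨⟨F, k, B⟩, l, b, l'⟩ s ⟨hl, s₀, ⟨h, h9, h10⟩, rfl⟩
    simp only at h h9 h10 hl
    have h1 := hJ F
    have h2 := F.size_select_le B
    have h3 := size_enc_mem (show b ∈ (F.select B).map Val.ofNat by simp [hl])
    have h4 := size_enc_append l (b :: l')
    rw [← hl] at h4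
    have h5 := length_lt_size_enc ((F.select B).map Val.ofNat)
    rw [hl, List.length_append, List.length_cons, ← hl] at h5
    have h6 := (enc l).one_le_size
    simp only [enc_cons, Val.size] at h4
    have h7 : (Val.cons Val.nil (s₀ 10)).size ≤ J F := by
      rw [h10]
      simp only [Val.size, size_enc_replicate]
      omega
    refine ⟨by simp, ((h.update ?_ (by decide)).update ?_ (by decide)).update ?_ (by decide), 
      by simp [h9], ?_⟩
    · simp only; omega
    · simp only; omega
    · simpa [Exp.eval] using h7
    · simp [Exp.eval, h10, List.replicate_succ, enc_cons, enc_val]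
  · rintro ⟨F, k, B⟩ s ⟨h, h9, h10⟩
    have h1 := hJ F
    have h2 := F.size_select_le B
    simp only at h h9
    refine ⟨by simp [Exp.eval, h9], h.update ?_ (by decide), by simp [h9], by simp [h10, enc_nil]⟩
    simp only; omega
  · rintro ⟨F, k, B⟩ s ⟨h, h9, h10⟩ -
    exact ⟨h, h9⟩
  · obtain ⟨r, hr⟩ := hJ'
    refine ⟨18 * r, ?_⟩
    rintro ⟨F, k, B⟩ l l' s - ⟨h, -⟩ -
    have h1 := h.toOuterInv.store_size
    have := hr F
    simp only [Polynomial.eval_mul, Polynomial.eval_ofNat] at h1 ⊢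
    omega

lemma enc_replicate_eq_two (n : ℕ) : enc (List.replicate n Val.nil) =
    Val.cons Val.nil (Val.cons Val.nil Val.nil) ↔ n = 2 := by
  change _ = enc (List.replicate 2 Val.nil) ↔ _
  rw [Enc.inj.eq_iff, List.replicate_left_inj]

lemma size_flips_append_le {F l l' : Formula} {c : Clause} (hl : F = l ++ c :: l')
    (X : Finset ℕ) : (enc (Formula.flips (l ++ [c]) X ++ F)).size ≤ 4 * F.length := by
  have h1 := size_enc_append (Formula.flips (l ++ [c]) X) F
  have h2 := Formula.size_flips_le (l ++ [c]) X
  have h3 := size_enc_append (l ++ [c]) l'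
  have h4 := (enc l').one_le_size
  rw [List.append_assoc, List.singleton_append, ← hl] at h3
  simp only [Formula.length, Formula.encode_eq]
  omega

/-- The unary count returned by `flipProg` is `nil` exactly for untouched clauses, which leave both
registers alone; a nonzero count adds the copy and is compared with two. The registers thus follow
the recursions `flips_concat` and `good_concat`. -/
lemma triple_flips {J : Formula → ℕ} (hJ : ∀ F, 10 * F.length + 10 ≤ J F)
    (hJ' : ∃ r : Polynomial ℕ, ∀ F : Formula, J F ≤ r.eval F.length) (M) :
    Triple (fun a : Formula × ℕ × List Bool => a.1.length) M
      (fun a s => RegInv J a.1 a.2.1 a.2.2 s ∧ s 9 = enc ((a.1.select a.2.2).map Val.ofNat) ∧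
        s 11 = enc a.1 ∧ s 12 = Val.ofBool true)
      (Cmd.foreach 13 14 (Exp.var 0) (
          Cmd.call 15 flipProg (Exp.cons (Exp.var 13) (Exp.var 9)) ;;
          Cmd.ite (Exp.hd (Exp.var 15)) (
            11 ::= Exp.cons (Exp.tl (Exp.var 15)) (Exp.var 11) ;;
            Cmd.ite (Exp.eq (Exp.hd (Exp.var 15)) (Exp.cons Exp.nil (Exp.cons Exp.nil Exp.nil)))
              Cmd.skip (12 ::= Exp.nil))
          Cmd.skip))
      (fun a s => RegInv J a.1 a.2.1 a.2.2 s ∧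
        s 11 = enc (Formula.flips a.1 (a.1.select a.2.2).toFinset ++ a.1) ∧
        s 12 = Val.ofBool (decide (a.1.Good (a.1.select a.2.2).toFinset))) := by
  refine Triple.foreach (L := fun a => a.1)
    (I := fun a l l' s => RegInv J a.1 a.2.1 a.2.2 s ∧ s 9 = enc ((a.1.select a.2.2).map Val.ofNat) ∧
      s 11 = enc (Formula.flips l (a.1.select a.2.2).toFinset ++ a.1) ∧
      s 12 = Val.ofBool (decide (Formula.Good l (a.1.select a.2.2).toFinset))) ?_ ?_ ?_ ?_
      (by decide)
  · refine Triple.seq (Q := fun a s => a.1.1 = a.2.1 ++ a.2.2.1 :: a.2.2.2 ∧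
      s 14 = enc a.2.2.2 ∧ RegInv J a.1.1 a.1.2.1 a.1.2.2 s ∧
      s 9 = enc ((a.1.1.select a.1.2.2).map Val.ofNat) ∧
      s 11 = enc (Formula.flips a.2.1 (a.1.1.select a.1.2.2).toFinset ++ a.1.1) ∧
      s 12 = Val.ofBool (decide (Formula.Good a.2.1 (a.1.1.select a.1.2.2).toFinset)) ∧
      s 15 = enc (List.replicate (a.2.2.1.countP fun l => l.var ∈ (a.1.1.select a.1.2.2).toFinset)
        Val.nil, Formula.flipClause (a.1.1.select a.1.2.2).toFinset a.2.2.1))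
      (Triple.call computes_flipProg ?_)
      (Triple.ite (Triple.assign_seq (Triple.ite (Triple.skip ?_) (Triple.assign ?_)))
        (Triple.skip ?_))
    · rintro ⟨⟨F, k, B⟩, l, c, l'⟩ s ⟨hl, s₀, ⟨h, h9, h11, h12⟩, rfl⟩
      simp only at h h9 h11 h12 hl
      have h1 := hJ F
      have h2 := F.size_select_le B
      have h3 := size_enc_append l (c :: l')
      have h4 := (enc l).one_le_size
      simp only [enc_cons, Val.size] at h3
      rw [← hl, ← Formula.encode_eq, ← Formula.length] at h3
      refine ⟨(Clause.raw c, (F.select B).map Val.ofNat), ?_, hl, by simp, ((h.update ?_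
        (by decide)).update ?_ (by decide)).update ?_ (by decide), by simp [h9], by simp [h11],
        by simp [h12], ?_⟩
      · simp [Exp.eval, enc_pair, enc_clause_raw, h9]
      · simp only; omega
      · simp only; omega
      · have h5 := size_flipRaw_fst_le (Clause.raw c, (F.select B).map Val.ofNat)
        have h6 := size_flipRaw_snd_le (Clause.raw c, (F.select B).map Val.ofNat)
        simp only [enc_clause_raw] at h5 h6
        simp only [enc_pair, Val.size]
        omega
      · rw [Formula.flipRaw_raw]
        simp [enc_pair, enc_clause_raw]
    · rintro ⟨⟨F, k, B⟩, l, c, l'⟩ s ⟨⟨s₀, ⟨⟨hl, h14, h, h9, h11, h12, h15⟩, h13⟩, rfl⟩, h2⟩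
      simp only at hl h14 h h9 h11 h12 h15
      have hc : Formula.Touched (F.select B).toFinset c := by
        rw [Formula.touched_iff]
        intro h0
        rw [h0] at h15
        simp [Exp.eval, h15, enc_pair, Val.head, enc_nil] at h13
      have hc2 : c.countP (fun l => l.var ∈ (F.select B).toFinset) = 2 := by
        simpa [Exp.eval, h15, enc_pair, Val.head, ofBool_eq_nil, enc_replicate_eq_two] using h2
      have h3 := size_flips_append_le hl (F.select B).toFinset
      rw [Formula.flips_concat, if_pos hc] at h3
      have h4 := hJ F
      refine ⟨by simp [h14], h.update ?_ (by decide), by simp [h9], ?_, ?_⟩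
      · simp only [Exp.eval, h15, h11, enc_pair, Val.tail]
        simp only [List.cons_append, enc_cons] at h3
        omega
      · simp [Exp.eval, h15, h11, enc_pair, Val.tail, Formula.flips_concat, hc, enc_cons]
      · simp only [Formula.good_concat, hc2]
        simp [h12]
    · rintro ⟨⟨F, k, B⟩, l, c, l'⟩ s ⟨⟨s₀, ⟨⟨hl, h14, h, h9, h11, h12, h15⟩, h13⟩, rfl⟩, h2⟩
      simp only at hl h14 h h9 h11 h12 h15
      have hc : Formula.Touched (F.select B).toFinset c := by
        rw [Formula.touched_iff]
        intro h0
        rw [h0] at h15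
        simp [Exp.eval, h15, enc_pair, Val.head, enc_nil] at h13
      have hc2 : c.countP (fun l => l.var ∈ (F.select B).toFinset) ≠ 2 := by
        simpa [Exp.eval, h15, enc_pair, Val.head, ofBool_eq_nil, enc_replicate_eq_two] using h2
      have h3 := size_flips_append_le hl (F.select B).toFinset
      rw [Formula.flips_concat, if_pos hc] at h3
      have h4 := hJ F
      refine ⟨by simp [h14], (h.update ?_ (by decide)).update ?_ (by decide), by simp [h9], ?_, ?_⟩
      · simp only [Exp.eval, h15, h11, enc_pair, Val.tail]
        simp only [List.cons_append, enc_cons] at h3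
        omega
      · simp only [Exp.eval, Val.size]
        omega
      · simp [Exp.eval, h15, h11, enc_pair, Val.tail, Formula.flips_concat, hc, enc_cons]
      · simp only [Formula.good_concat, hc2, or_false]
        rw [Formula.touched_iff] at hc
        rw [decide_eq_false fun h' => hc h'.2]
        simp [Exp.eval, Val.ofBool]
    · rintro ⟨⟨F, k, B⟩, l, c, l'⟩ s ⟨⟨hl, h14, h, h9, h11, h12, h15⟩, h13⟩
      simp only at hl h14 h h9 h11 h12 h15
      have hc : c.countP (fun l => l.var ∈ (F.select B).toFinset) = 0 := by
        simpa [Exp.eval, h15, enc_pair, Val.head, enc_list_eq_nil] using h13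
      have hc' : ¬ Formula.Touched (F.select B).toFinset c := by
        rw [Formula.touched_iff]
        exact fun h0 => h0 hc
      refine ⟨h14, h, h9, ?_, ?_⟩
      · simpa [Formula.flips_concat, hc'] using h11
      · simp only [Formula.good_concat, hc]
        simpa using h12
  · rintro ⟨F, k, B⟩ s ⟨h, h9, h11, h12⟩
    have h1 := hJ F
    simp only at h h9 h11 h12
    refine ⟨by simp [Exp.eval, h.h0], h.update ?_ (by decide), by simp [h9],
      by simp [h11, Formula.flips], by simp [h12, Formula.Good]⟩
    rw [← Formula.encode_eq, ← Formula.length]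
    simp only; omega
  · rintro ⟨F, k, B⟩ s ⟨h, h9, h11, h12⟩ -
    exact ⟨h, h11, h12⟩
  · obtain ⟨r, hr⟩ := hJ'
    refine ⟨18 * r, ?_⟩
    rintro ⟨F, k, B⟩ l l' s - ⟨h, -⟩ -
    have h1 := h.toOuterInv.store_size
    have := hr F
    simp only [Polynomial.eval_mul, Polynomial.eval_ofNat] at h1 ⊢
    omega

/-- The only step of `P` that may exceed polynomial time; its factor is charged only for good `X`.
The output of the solver is an arbitrary value that has to fit into a register, which is ensured by
`hJS`. -/
lemma triple_solver {J : Formula → ℕ} (hJ : ∀ F, 10 * F.length + 10 ≤ J F) {m : ℕ}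
    {S : Cmd (m + 1)} {p : Polynomial ℕ} {M : Formula → ℕ}
    (hS : ∀ G : Formula, G.WellFormed → ∃ s t w, Exec S (Store.input m G.encode) s t w ∧
      t ≤ p.eval G.length * M G ∧ w ≤ p.eval G.length)
    (hJS : ∀ F : Formula, p.eval (4 * F.length) ≤ J F) :
    Triple (fun a : Formula × ℕ × List Bool => a.1.length)
      (fun a => if a.1.Good (a.1.select a.2.2).toFinset then
        M (Formula.flips a.1 (a.1.select a.2.2).toFinset ++ a.1) else 0)
      (fun a s => RegInv J a.1 a.2.1 a.2.2 s ∧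
        s 11 = enc (Formula.flips a.1 (a.1.select a.2.2).toFinset ++ a.1) ∧
        s 12 = Val.ofBool (decide (a.1.Good (a.1.select a.2.2).toFinset)))
      (Cmd.ite (Exp.var 12) (
          Cmd.call 16 S (Exp.var 11) ;;
          Cmd.ite (Exp.var 16) (2 ::= Exp.cons Exp.nil (Exp.var 3)) Cmd.skip)
        Cmd.skip)
      (fun a s => RegInv J a.1 a.2.1 a.2.2 s) := by
  refine Triple.ite (Triple.seq (Q := fun a s => RegInv J a.1 a.2.1 a.2.2 s) ?_
    (Triple.ite (Triple.assign ?_) (Triple.skip fun a s h => h.1))) (Triple.skip fun a s h => h.1.1)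
  -- `S` need not run in polynomial time, so `Triple.call` does not apply and the bounds are read
  -- off from the execution itself.
  · intro q
    refine ⟨q + p.comp (4 * Polynomial.X) + q, ?_⟩
    rintro ⟨F, k, B⟩ s ⟨⟨h, h11, h12⟩, hg⟩ hq
    simp only at h h11 h12 hq
    have hgood : F.Good (F.select B).toFinset := by
      simpa [Exp.eval, h12, ofBool_eq_nil] using hg
    obtain ⟨s', t, w, h1, h2, h3⟩ := hS _ (h.wf.flips_append (F.select B).toFinset)
    have h4 := F.length_flips_append_le (F.select B).toFinset
    have h5 := p.eval_mono_nat h4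
    simp only at h5
    have h6 : (s 11).size ≤ q.eval F.length := (s.size_le_size 11).trans hq
    refine ⟨_, _, _, Exec.call (x := 16) (e := Exp.var 11) (s := s) (s' := s') (t := t) (w := w) ?_,
      h.update ?_ (by decide), ?_, ?_⟩
    · simpa only [Exp.eval, h11, ← Formula.encode_eq] using h1
    · exact (s'.size_le_size 0).trans (h1.size_le.trans (h3.trans (h5.trans (hJS F))))
    · simp only [Exp.cost, Polynomial.eval_add, Polynomial.eval_comp, Polynomial.eval_mul,
        Polynomial.eval_ofNat, Polynomial.eval_X, if_pos hgood]
      have h7 := h2.trans (Nat.mul_le_mul_right _ h5)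
      nlinarith
    · simp only [Exp.cost, Polynomial.eval_add, Polynomial.eval_comp, Polynomial.eval_mul,
        Polynomial.eval_ofNat, Polynomial.eval_X]
      omega
  · rintro ⟨F, k, B⟩ s ⟨h, -⟩
    refine h.update ?_ (by decide)
    have h1 := hJ F
    have h2 := h.le
    have h3 := F.length_varList_le
    simp only at h1 h2 h3 h
    simp only [Exp.eval, h.h3, Val.size, size_enc_replicate]
    omega

/-- The solver is charged for every good `X`, even if the size of `X` is not `k`. Over all rounds
this overcounts by a factor `n + 1` only, which is polynomial. -/
lemma triple_process {J : Formula → ℕ} (hJ : ∀ F, 10 * F.length + 10 ≤ J F)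
    (hJ' : ∃ r : Polynomial ℕ, ∀ F : Formula, J F ≤ r.eval F.length) {m : ℕ}
    {S : Cmd (m + 1)} {p : Polynomial ℕ} {M : Formula → ℕ}
    (hS : ∀ G : Formula, G.WellFormed → ∃ s t w, Exec S (Store.input m G.encode) s t w ∧
      t ≤ p.eval G.length * M G ∧ w ≤ p.eval G.length)
    (hJS : ∀ F : Formula, p.eval (4 * F.length) ≤ J F) :
    Triple (fun a : Formula × ℕ × List Bool => a.1.length)
      (fun a => if a.1.Good (a.1.select a.2.2).toFinset then
        M (Formula.flips a.1 (a.1.select a.2.2).toFinset ++ a.1) else 0)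
      (fun a s => RegInv J a.1 a.2.1 a.2.2 s ∧ s 9 = enc ((a.1.select a.2.2).map Val.ofNat))
      (Cmd.ite (Exp.eq (Exp.var 10) (Exp.var 3)) (
        11 ::= Exp.var 0 ;;
        12 ::= Exp.cons Exp.nil Exp.nil ;;
        Cmd.foreach 13 14 (Exp.var 0) (
          Cmd.call 15 flipProg (Exp.cons (Exp.var 13) (Exp.var 9)) ;;
          Cmd.ite (Exp.hd (Exp.var 15)) (
            11 ::= Exp.cons (Exp.tl (Exp.var 15)) (Exp.var 11) ;;
            Cmd.ite (Exp.eq (Exp.hd (Exp.var 15)) (Exp.cons Exp.nil (Exp.cons Exp.nil Exp.nil)))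
              Cmd.skip (12 ::= Exp.nil))
          Cmd.skip) ;;
        Cmd.ite (Exp.var 12) (
          Cmd.call 16 S (Exp.var 11) ;;
          Cmd.ite (Exp.var 16) (2 ::= Exp.cons Exp.nil (Exp.var 3)) Cmd.skip)
        Cmd.skip)
      Cmd.skip)
      (fun a s => RegInv J a.1 a.2.1 a.2.2 s) := by
  refine Triple.ite (Triple.assign_seq (Triple.assign_seq (Triple.seq
    ((triple_flips hJ hJ' _).conseq ?_ fun _ _ h => h) (triple_solver hJ hS hJS))))
    (Triple.skip fun a s h => h.1.1)
  rintro ⟨F, k, B⟩ s ⟨s₀, ⟨s₁, ⟨⟨h, h9⟩, -⟩, rfl⟩, rfl⟩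
  have h1 := hJ F
  simp only at h h9
  refine ⟨(h.update ?_ (by decide)).update ?_ (by decide), by simp [h9], by simp [Exp.eval, h.h0],
    by simp [Exp.eval, Val.ofBool]⟩
  · simp only [Exp.eval, h.h0]
    rw [← Formula.encode_eq, ← Formula.length]
    omega
  · simp only [Exp.eval, Val.size]
    omega

/-- The state of `P` before the `i`-th subset is processed. -/
def LoopInv (J : Formula → ℕ) (F : Formula) (k i : ℕ) (s : Store 18) : Prop :=
  (i < 2 ^ F.varList.length ∧ RegInv J F k (lowBits F.varList.length i) s) ∨
    (i = 2 ^ F.varList.length ∧ OuterInv J F k s ∧ s 8 = Val.nil)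

lemma enc_replicate_succ (n : ℕ) : enc (List.replicate (n + 1) Val.nil) =
    Val.cons Val.nil (enc (List.replicate n Val.nil)) := rfl

/-- The string is a run of `j` ones followed by a rest that is empty or begins with a zero; `headD
false = false` covers both cases. The ones are stripped and counted in register 17. Meanwhile the
string is shorter than `n`, so only `OuterInv` survives. -/
lemma triple_carry {J : Formula → ℕ} (hJ : ∀ F, 10 * F.length + 10 ≤ J F)
    (hJ' : ∃ r : Polynomial ℕ, ∀ F : Formula, J F ≤ r.eval F.length) :
    Triple (fun a : (Formula × ℕ) × ℕ × List Bool => a.1.1.length) 0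
      (fun a s => RegInv J a.1.1 a.1.2 (List.replicate a.2.1 true ++ a.2.2) s ∧
        a.2.2.headD false = false ∧ s 17 = Val.nil)
      (Cmd.while (Exp.hd (Exp.var 5)) (
        17 ::= Exp.cons Exp.nil (Exp.var 17) ;;
        5 ::= Exp.tl (Exp.var 5)))
      (fun a s => (OuterInv J a.1.1 a.1.2 s ∧ a.2.1 + a.2.2.length = a.1.1.varList.length ∧
        s 8 = Val.ofBool true ∧ s 5 = enc a.2.2 ∧ s 17 = enc (List.replicate a.2.1 Val.nil)) ∧
        a.2.2.headD false = false) := by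
  refine ((Triple.while_loop (T := fun a => a.2.1) (M' := 0) (I := fun a i s =>
    OuterInv J a.1.1 a.1.2 s ∧ a.2.1 + a.2.2.length = a.1.1.varList.length ∧
      a.2.2.headD false = false ∧ s 8 = Val.ofBool true ∧
      s 5 = enc (List.replicate (a.2.1 - i) true ++ a.2.2) ∧
      s 17 = enc (List.replicate i Val.nil)) ?_ ?_ ?_ ?_).weaken (Polynomial.X + 1) ?_).conseq ?_ ?_
  · refine Triple.assign_seq (Triple.assign ?_)
    rintro ⟨⟨⟨F, k⟩, j, T⟩, i⟩ s ⟨s₀, ⟨⟨h, hl, hT, h8, h5, h17⟩, hi⟩, rfl⟩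
    simp only at h hl hT h8 h5 h17 hi
    obtain ⟨d, hd⟩ : ∃ d, j - i = d + 1 := ⟨j - i - 1, by omega⟩
    have hd' : j - (i + 1) = d := by omega
    rw [hd, List.replicate_succ, List.cons_append, enc_cons] at h5
    have h1 := hJ F
    have h2 := F.length_varList_le
    have h3 := h.size 5
    simp only [h5, Val.size] at h3
    refine ⟨(h.update ?_ (by decide)).update ?_ (by decide), hl, hT, by simp [h8], ?_, ?_⟩
    · simp only [Exp.eval, h17, Val.size, size_enc_replicate]
      omega
    · simp only [Exp.eval, ne_eq, Fin.isValue, Fin.reduceEq, not_false_eq_true,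
        Function.update_of_ne, h5, Val.tail]
      omega
    · simp [Exp.eval, h5, Val.tail, hd']
    · simp [Exp.eval, h17, enc_replicate_succ]
  · rintro ⟨⟨F, k⟩, j, T⟩ i s hi ⟨h, hl, hT, h8, h5, h17⟩
    simp only at hi h5
    obtain ⟨d, hd⟩ : ∃ d, j - i = d + 1 := ⟨j - i - 1, by omega⟩
    rw [hd, List.replicate_succ, List.cons_append, enc_cons] at h5
    simp [Exp.eval, h5, Val.head, enc_bool, ofBool_eq_nil]
  · rintro ⟨⟨F, k⟩, j, T⟩ s ⟨h, hl, hT, h8, h5, h17⟩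
    simp only [tsub_self, List.replicate_zero, List.nil_append] at h5 hT
    obtain _ | ⟨b, T⟩ := T
    · simp [Exp.eval, h5, enc_nil, Val.head]
    · simp at hT
      simp [Exp.eval, h5, enc_cons, Val.head, enc_bool, ofBool_eq_nil, hT]
  · obtain ⟨r, hr⟩ := hJ'
    refine ⟨18 * r, ?_⟩
    rintro ⟨⟨F, k⟩, j, T⟩ i s - ⟨h, -⟩
    have h1 := h.store_size
    have := hr F
    simp only [Polynomial.eval_mul, Polynomial.eval_ofNat] at h1 ⊢
    omega
  · rintro ⟨⟨F, k⟩, j, T⟩ s ⟨h, hl, -⟩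
    have h2 := F.length_varList_le
    simp at hl ⊢
    omega
  · rintro ⟨⟨F, k⟩, j, T⟩ s ⟨h, hT, h17⟩
    exact ⟨h.toOuterInv, by simpa using h.len, hT, h.h8, by simpa using h.h5,
      by simpa [enc_nil] using h17⟩
  · rintro ⟨⟨F, k⟩, j, T⟩ s ⟨h, hl, hT, h8, h5, h17⟩
    exact ⟨⟨h, hl, h8, by simpa using h5, h17⟩, hT⟩

lemma triple_refill {J : Formula → ℕ} (hJ : ∀ F, 10 * F.length + 10 ≤ J F)
    (hJ' : ∃ r : Polynomial ℕ, ∀ F : Formula, J F ≤ r.eval F.length) :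
    Triple (fun a : (Formula × ℕ) × ℕ × List Bool => a.1.1.length) 0
      (fun a s => OuterInv J a.1.1 a.1.2 s ∧ a.2.1 + a.2.2.length = a.1.1.varList.length ∧
        s 8 = Val.ofBool true ∧ s 5 = enc a.2.2 ∧ s 17 = enc (List.replicate a.2.1 Val.nil))
      (Cmd.while (Exp.var 17) (
        5 ::= Exp.cons Exp.nil (Exp.var 5) ;;
        17 ::= Exp.tl (Exp.var 17)))
      (fun a s => RegInv J a.1.1 a.1.2 (List.replicate a.2.1 false ++ a.2.2) s) := by
  refine ((Triple.while_loop (T := fun a => a.2.1) (M' := 0) (I := fun a i s =>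
    OuterInv J a.1.1 a.1.2 s ∧ a.2.1 + a.2.2.length = a.1.1.varList.length ∧
      s 8 = Val.ofBool true ∧
      s 5 = enc (List.replicate i false ++ a.2.2) ∧
      s 17 = enc (List.replicate (a.2.1 - i) Val.nil)) ?_ ?_ ?_ ?_).weaken (Polynomial.X + 1) ?_).conseq
        ?_ ?_
  · refine Triple.assign_seq (Triple.assign ?_)
    rintro ⟨⟨⟨F, k⟩, j, T⟩, i⟩ s ⟨s₀, ⟨⟨h, hl, h8, h5, h17⟩, hi⟩, rfl⟩
    simp only at h hl h8 h5 h17 hi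
    obtain ⟨d, hd⟩ : ∃ d, j - i = d + 1 := ⟨j - i - 1, by omega⟩
    have hd' : j - (i + 1) = d := by omega
    rw [hd, enc_replicate_succ] at h17
    have h1 := hJ F
    have h2 := F.length_varList_le
    have h3 := h.size 17
    simp only [h17, Val.size] at h3
    have h4 := size_enc_bits_le (List.replicate i false ++ T)
    simp only [List.length_append, List.length_replicate] at h4
    refine ⟨(h.update ?_ (by decide)).update ?_ (by decide), hl, by simp [h8], ?_, ?_⟩
    · simp only [Exp.eval, h5, Val.size]
      omega
    · simp only [Exp.eval, ne_eq, Fin.isValue, Fin.reduceEq, not_false_eq_true,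
        Function.update_of_ne, h17, Val.tail]
      omega
    · simp [Exp.eval, h5, List.replicate_succ, enc_cons, enc_bool, Val.ofBool]
    · simp [Exp.eval, h17, hd', Val.tail]
  · rintro ⟨⟨F, k⟩, j, T⟩ i s hi ⟨h, hl, h8, h5, h17⟩
    simp only at hi h17
    obtain ⟨d, hd⟩ : ∃ d, j - i = d + 1 := ⟨j - i - 1, by omega⟩
    rw [hd, enc_replicate_succ] at h17
    simp [Exp.eval, h17]
  · rintro ⟨⟨F, k⟩, j, T⟩ s ⟨h, hl, h8, h5, h17⟩
    simpa [Exp.eval, enc_nil] using h17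
  · obtain ⟨r, hr⟩ := hJ'
    refine ⟨18 * r, ?_⟩
    rintro ⟨⟨F, k⟩, j, T⟩ i s - ⟨h, -⟩
    have h1 := h.store_size
    have := hr F
    simp only [Polynomial.eval_mul, Polynomial.eval_ofNat] at h1 ⊢
    omega
  · rintro ⟨⟨F, k⟩, j, T⟩ s ⟨h, hl, -⟩
    have h2 := F.length_varList_le
    simp at hl ⊢
    omega
  · rintro ⟨⟨F, k⟩, j, T⟩ s ⟨h, hl, h8, h5, h17⟩
    exact ⟨h, hl, h8, by simpa using h5, by simpa using h17⟩
  · rintro ⟨⟨F, k⟩, j, T⟩ s ⟨h, hl, h8, h5, h17⟩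
    exact ⟨h, by simpa using hl, by simpa using h5, h8⟩

lemma triple_next {J : Formula → ℕ} (hJ : ∀ F, 10 * F.length + 10 ≤ J F)
    (hJ' : ∃ r : Polynomial ℕ, ∀ F : Formula, J F ≤ r.eval F.length) :
    Triple (fun a : (Formula × ℕ) × ℕ => a.1.1.length) 0
      (fun a s => a.2 < 2 ^ a.1.1.varList.length ∧
        RegInv J a.1.1 a.1.2 (lowBits a.1.1.varList.length a.2) s)
      (17 ::= Exp.nil ;;
      Cmd.while (Exp.hd (Exp.var 5)) (
        17 ::= Exp.cons Exp.nil (Exp.var 17) ;;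
        5 ::= Exp.tl (Exp.var 5)) ;;
      Cmd.ite (Exp.var 5) (
        5 ::= Exp.cons (Exp.cons Exp.nil Exp.nil) (Exp.tl (Exp.var 5)) ;;
        Cmd.while (Exp.var 17) (
          5 ::= Exp.cons Exp.nil (Exp.var 5) ;;
          17 ::= Exp.tl (Exp.var 17)))
      (8 ::= Exp.nil))
      (fun a s => LoopInv J a.1.1 a.1.2 (a.2 + 1) s) := by
  -- The new parameters are the length `a.2.1` of the initial run of ones and the rest `a.2.2` of
  -- the string. An empty rest means that the last string has been reached.
  refine Triple.reindex (N := fun a : (Formula × ℕ) × ℕ × List Bool => a.1.1.length) (M := 0)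
    (P := fun a s => RegInv J a.1.1 a.1.2 (List.replicate a.2.1 true ++ a.2.2) s ∧
      a.2.2.headD false = false)
    (Q := fun a s => (∃ l, a.2.2 = false :: l ∧
        RegInv J a.1.1 a.1.2 (List.replicate a.2.1 false ++ true :: l) s) ∨
      (a.2.2 = [] ∧ OuterInv J a.1.1 a.1.2 s ∧ s 8 = Val.nil)) ?_ ?_
  · refine Triple.assign_seq (Triple.seq ((triple_carry hJ hJ').conseq ?_ fun _ _ h => h)
      (Triple.ite (Triple.assign_seq ((triple_refill hJ hJ').reindex ?_)) (Triple.assign ?_)))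
    · rintro ⟨⟨F, k⟩, j, T⟩ s ⟨s₀, ⟨h, hT⟩, rfl⟩
      refine ⟨h.update ?_ (by decide), hT, by simp [Exp.eval]⟩
      have h1 := hJ F
      simp only [Exp.eval, Val.size]
      omega
    · rintro ⟨⟨F, k⟩, j, T⟩ s ⟨s₀, ⟨⟨⟨h, hl, h8, h5, h17⟩, hT⟩, hne⟩, rfl⟩
      simp only at h hl h8 h5 h17 hT
      obtain ⟨b, l, rfl⟩ : ∃ b l, T = b :: l := List.exists_cons_of_ne_nil fun h0 => by
        simp [Exp.eval, h5, h0, enc_nil] at hne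
      obtain rfl : b = false := by simpa using hT
      have h1 := hJ F
      have h2 := F.length_varList_le
      have h3 := size_enc_bits_le l
      simp only [List.length_cons] at hl
      refine ⟨((F, k), j, true :: l), ⟨h.update ?_ (by decide), by simpa using hl, by simp [h8],
        by simp [Exp.eval, h5, enc_cons, Val.tail, enc_bool, Val.ofBool], by simp [h17]⟩, rfl,
        le_rfl, fun s' hs' => Or.inl ⟨l, rfl, hs'⟩⟩
      simp only [Exp.eval, h5, enc_cons, Val.tail, Val.size]
      omega
    · rintro ⟨⟨F, k⟩, j, T⟩ s ⟨⟨⟨h, hl, h8, h5, h17⟩, hT⟩, he⟩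
      simp only at h hl h8 h5 h17 hT
      right
      refine ⟨by simpa [Exp.eval, h5, enc_list_eq_nil] using he, h.update ?_ (by decide),
        by simp [Exp.eval]⟩
      have h1 := hJ F
      simp only [Exp.eval, Val.size]
      omega
  · rintro ⟨⟨F, k⟩, i⟩ s ⟨hi, h⟩
    simp only at hi h
    rcases lowBits_succ _ i hi with ⟨j, l, h1, h2, h3⟩ | ⟨h1, h2⟩
    · refine ⟨((F, k), j, false :: l), ⟨by simpa [h1] using h, rfl⟩, rfl, le_rfl, ?_⟩
      rintro s' (⟨l', hl', hs'⟩ | ⟨h0, -⟩)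
      · simp only [List.cons.injEq, true_and] at hl'
        subst hl'
        exact Or.inl ⟨h3, by simpa [h2] using hs'⟩
      · simp at h0
    · refine ⟨((F, k), F.varList.length, []), ⟨by simpa [h1] using h, rfl⟩, rfl, le_rfl, ?_⟩
      rintro s' (⟨l', hl', hs'⟩ | ⟨-, h0⟩)
      · simp at hl'
      · exact Or.inr ⟨h2, h0⟩

lemma enc_tail {β : Type*} [Enc β] (l : List β) : (enc l).tail = enc l.tail := by
  cases l <;> rfl

lemma Formula.sum_select (F : Formula) (f : Finset ℕ → ℕ) :
    ∑ i ∈ Finset.range (2 ^ F.varList.length),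
      f (F.select (lowBits F.varList.length i)).toFinset = ∑ X ∈ F.vars.powerset, f X := by
  rw [← F.nodup_varList_and.2]
  exact sum_lowBits _ F.nodup_varList_and.1 f

/-- The factor in the running time of the solver on the formula built for `X`. -/
def solverCost (M : Formula → ℕ) (F : Formula) (X : Finset ℕ) : ℕ :=
  if F.Good X then M (Formula.flips F X ++ F) else 0

section

variable {J : Formula → ℕ} {m : ℕ} {S : Cmd (m + 1)} {p : Polynomial ℕ} {M : Formula → ℕ}

lemma triple_inner (hJ : ∀ F, 10 * F.length + 10 ≤ J F)
    (hJ' : ∃ r : Polynomial ℕ, ∀ F : Formula, J F ≤ r.eval F.length) 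
    (hS : ∀ G : Formula, G.WellFormed → ∃ s t w, Exec S (Store.input m G.encode) s t w ∧
      t ≤ p.eval G.length * M G ∧ w ≤ p.eval G.length)
    (hJS : ∀ F : Formula, p.eval (4 * F.length) ≤ J F) :
    Triple (fun a : Formula × ℕ => a.1.length)
      (fun a => ∑ X ∈ a.1.vars.powerset, (solverCost M a.1 X + 1))
      (fun a s => LoopInv J a.1 a.2 0 s)
      (Cmd.while (Exp.var 8) (
        Cmd.call 9 selectProg (Exp.cons (Exp.var 5) (Exp.var 1)) ;;
        10 ::= Exp.nil ;;
        Cmd.foreach 6 7 (Exp.var 9) (10 ::= Exp.cons Exp.nil (Exp.var 10)) ;;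
        Cmd.ite (Exp.eq (Exp.var 10) (Exp.var 3)) (
          11 ::= Exp.var 0 ;;
          12 ::= Exp.cons Exp.nil Exp.nil ;;
          Cmd.foreach 13 14 (Exp.var 0) (
            Cmd.call 15 flipProg (Exp.cons (Exp.var 13) (Exp.var 9)) ;;
            Cmd.ite (Exp.hd (Exp.var 15)) (
              11 ::= Exp.cons (Exp.tl (Exp.var 15)) (Exp.var 11) ;;
              Cmd.ite (Exp.eq (Exp.hd (Exp.var 15)) (Exp.cons Exp.nil (Exp.cons Exp.nil Exp.nil)))
                Cmd.skip (12 ::= Exp.nil))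
            Cmd.skip) ;;
          Cmd.ite (Exp.var 12) (
            Cmd.call 16 S (Exp.var 11) ;;
            Cmd.ite (Exp.var 16) (2 ::= Exp.cons Exp.nil (Exp.var 3)) Cmd.skip)
          Cmd.skip)
        Cmd.skip ;;
        17 ::= Exp.nil ;;
        Cmd.while (Exp.hd (Exp.var 5)) (
          17 ::= Exp.cons Exp.nil (Exp.var 17) ;;
          5 ::= Exp.tl (Exp.var 5)) ;;
        Cmd.ite (Exp.var 5) (
          5 ::= Exp.cons (Exp.cons Exp.nil Exp.nil) (Exp.tl (Exp.var 5)) ;;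
          Cmd.while (Exp.var 17) (
            5 ::= Exp.cons Exp.nil (Exp.var 5) ;;
            17 ::= Exp.tl (Exp.var 17)))
        (8 ::= Exp.nil)))
      (fun a s => OuterInv J a.1 a.2 s) := by
  refine ((Triple.while_loop (T := fun a => 2 ^ a.1.varList.length)
    (M' := fun a => solverCost M a.1.1 (a.1.1.select (lowBits a.1.1.varList.length a.2)).toFinset)
    (I := fun a i s => LoopInv J a.1 a.2 i s) ?_ ?_ ?_ ?_).weaken 1 ?_).conseq (fun _ _ h => h) ?_
  · refine Triple.seq (Q := fun a s => a.2 < 2 ^ a.1.1.varList.length ∧ 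
        RegInv J a.1.1 a.1.2 (lowBits a.1.1.varList.length a.2) s ∧
        s 9 = enc ((a.1.1.select (lowBits a.1.1.varList.length a.2)).map Val.ofNat))
      ((triple_select hJ 0).reindex ?_)
      (Triple.assign_seq (Triple.seq (Q := fun a s => a.2 < 2 ^ a.1.1.varList.length ∧ 
        RegInv J a.1.1 a.1.2 (lowBits a.1.1.varList.length a.2) s ∧
        s 9 = enc ((a.1.1.select (lowBits a.1.1.varList.length a.2)).map Val.ofNat))
        ((triple_count hJ hJ' 0).reindex ?_)
      (Triple.seq (Q := fun a s => a.2 < 2 ^ a.1.1.varList.length ∧ 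
        RegInv J a.1.1 a.1.2 (lowBits a.1.1.varList.length a.2) s)
        ((triple_process hJ hJ' hS hJS).reindex ?_) (triple_next hJ hJ').mono_factor)))
    · rintro ⟨⟨F, k⟩, i⟩ s ⟨h | h, hi⟩
      · exact ⟨(F, k, lowBits F.varList.length i), h.2, rfl, Nat.zero_le _, fun s' hs' => ⟨hi, hs'⟩⟩
      · exact absurd hi h.1.not_lt
    · rintro ⟨⟨F, k⟩, i⟩ s ⟨s₀, ⟨hi, h, h9⟩, rfl⟩
      refine ⟨(F, k, lowBits F.varList.length i), ⟨h.update ?_ (by decide), by simp [h9], 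
        by simp [Exp.eval]⟩, rfl, Nat.zero_le _, fun s' hs' => ⟨hi, hs'⟩⟩
      have := hJ F
      simp only [Exp.eval, Val.size]
      omega
    · rintro ⟨⟨F, k⟩, i⟩ s ⟨hi, h⟩
      exact ⟨(F, k, lowBits F.varList.length i), h, rfl, le_rfl, fun s' hs' => ⟨hi, hs'⟩⟩
  · rintro ⟨F, k⟩ i s hi (h | h)
    · simp [Exp.eval, h.2.h8, ofBool_eq_nil]
    · exact absurd hi h.1.not_lt
  · rintro ⟨F, k⟩ s (h | h)
    · exact absurd h.1 (lt_irrefl _)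
    · exact h.2.2
  · obtain ⟨r, hr⟩ := hJ'
    refine ⟨18 * r, ?_⟩
    rintro ⟨F, k⟩ i s - (⟨-, h⟩ | ⟨-, h, -⟩)
    · have h1 := h.toOuterInv.store_size
      have := hr F
      simp only [Polynomial.eval_mul, Polynomial.eval_ofNat] at h1 ⊢
      omega
    · have h1 := h.store_size
      have := hr F
      simp only [Polynomial.eval_mul, Polynomial.eval_ofNat] at h1 ⊢
      omega
  · rintro ⟨F, k⟩ s -
    -- Every set of variables is selected by exactly one string of bits, so the sum over the rounds
    -- becomes a sum over subsets.
    rw [F.sum_select fun X => solverCost M F X + 1]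
    simp
  · rintro ⟨F, k⟩ s (h | h)
    · exact absurd h.1 (lt_irrefl _)
    · exact h.2.1

lemma triple_clear (hJ : ∀ F, 10 * F.length + 10 ≤ J F)
    (hJ' : ∃ r : Polynomial ℕ, ∀ F : Formula, J F ≤ r.eval F.length) :
    Triple (fun a : Formula × ℕ => a.1.length) 0
      (fun a s => (OuterInv J a.1 a.2 s ∧ a.2 < a.1.varList.length + 1) ∧ s 5 = Val.nil)
      (Cmd.foreach 6 7 (Exp.var 1) (5 ::= Exp.cons Exp.nil (Exp.var 5)))
      (fun a s => (OuterInv J a.1 a.2 s ∧ a.2 < a.1.varList.length + 1) ∧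
        s 5 = enc (lowBits a.1.varList.length 0)) := by
  refine Triple.foreach (L := fun a => a.1.varList.map Val.ofNat)
    (I := fun a l l' s => (OuterInv J a.1 a.2 s ∧ a.2 < a.1.varList.length + 1) ∧
      s 5 = enc (List.replicate l.length false)) ?_ ?_ ?_ ?_ (by decide)
  · refine Triple.assign ?_
    rintro ⟨⟨F, k⟩, l, b, l'⟩ s ⟨hl, s₀, ⟨⟨h, hk⟩, h5⟩, rfl⟩
    simp only at h h5 hl hk
    have h1 := hJ F
    have h2 := F.size_varList_le
    have h3 := size_enc_mem (show b ∈ F.varList.map Val.ofNat by simp [hl])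
    have h4 := size_enc_append l (b :: l')
    rw [← hl] at h4
    have h5' := F.length_varList_le
    have h5'' := congrArg List.length hl
    simp only [List.length_map, List.length_append, List.length_cons] at h5''
    have h6 := (enc l).one_le_size
    simp only [enc_cons, Val.size] at h4
    have h7 := size_enc_bits_le (List.replicate l.length false)
    rw [List.length_replicate] at h7
    refine ⟨by simp, ⟨((h.update ?_ (by decide)).update ?_ (by decide)).update ?_ (by decide), hk⟩,
      ?_⟩
    · simp only; omega
    · simp only; omega
    · simp only [Exp.eval, ne_eq, Fin.isValue, Fin.reduceEq, not_false_eq_true,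
        Function.update_of_ne, h5, Val.size]
      omega
    · simp [Exp.eval, h5, List.replicate_succ, enc_cons, enc_bool, Val.ofBool]
  · rintro ⟨F, k⟩ s ⟨⟨h, hk⟩, h5⟩
    have h1 := hJ F
    have h2 := F.size_varList_le
    refine ⟨by simp [Exp.eval, h.h1], ⟨h.update ?_ (by decide), hk⟩, by simp [h5, enc_nil]⟩
    simp only; omega
  · rintro ⟨F, k⟩ s ⟨h, h5⟩ -
    rw [lowBits_zero]
    exact ⟨h, by simpa using h5⟩
  · obtain ⟨r, hr⟩ := hJ'
    refine ⟨18 * r, ?_⟩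
    rintro ⟨F, k⟩ l l' s - ⟨⟨h, -⟩, -⟩ -
    have h1 := h.store_size
    have := hr F
    simp only [Polynomial.eval_mul, Polynomial.eval_ofNat] at h1 ⊢
    omega

/-- The running time of `P`, when the total cost of the calls of the solver is `O(2 ^ n)`. -/
theorem runs_algorithmP
    (hS : ∀ G : Formula, G.WellFormed → ∃ s t w, Exec S (Store.input m G.encode) s t w ∧
      t ≤ p.eval G.length * M G ∧ w ≤ p.eval G.length)
    (hM : ∃ r : Polynomial ℕ, ∀ F : Formula, F.WellFormed →
      ∑ X ∈ F.vars.powerset, solverCost M F X ≤ r.eval F.length * 2 ^ F.vars.card) :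
    RunsInPolySpaceAndTime 2 (algorithmP S) := by
  obtain ⟨r, hr⟩ := hM
  -- Room for the output of the solver, whose input has length at most `4 * F.length`, and for the
  -- registers of `P` itself.
  let J : Formula → ℕ := fun F => p.eval (4 * F.length) + 10 * F.length + 10
  have hJ : ∀ F, 10 * F.length + 10 ≤ J F := fun F => by simp only [J]; omega
  have hJ' : ∃ r : Polynomial ℕ, ∀ F : Formula, J F ≤ r.eval F.length :=
    ⟨p.comp (4 * Polynomial.X) + 10 * Polynomial.X + 10, fun F => by simp [J]⟩
  have hJS : ∀ F : Formula, p.eval (4 * F.length) ≤ J F := fun F => by simp only [J]; omega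
  have main : Triple (fun F : Formula => F.length) (fun F => 2 ^ F.vars.card)
      (fun F s => F.WellFormed ∧ s = Store.input 17 (enc F)) (algorithmP S) (fun _ _ => True) := by
    refine Triple.call_seq computes_varsProg (fun F s h => ⟨F.raw, by
      simp [h.2, Exp.eval, Store.input_zero, enc_formula_raw]⟩) (Triple.assign_seq
      (Triple.assign_seq (Triple.assign_seq (Triple.seq (Q := fun _ _ => True)
        (((Triple.while_loop (T := fun F => F.varList.length + 1)
          (M' := fun a => ∑ X ∈ a.1.vars.powerset, (solverCost M a.1 X + 1))
          (I := fun F k s => OuterInv J F k s) ?_ ?_ ?_ ?_).weaken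
            ((Polynomial.X + 1) * (r + 2)) ?_).conseq ?_ fun _ _ _ => trivial)
        (Triple.assign fun _ _ _ => trivial)))))
    · refine Triple.assign_seq (Triple.seq ((triple_clear hJ hJ').mono_factor.conseq ?_
        fun _ _ h => h) (Triple.assign_seq (Triple.seq (Q := fun a s => OuterInv J a.1 a.2 s ∧
          a.2 < a.1.varList.length + 1) (Triple.reindex
          (triple_inner (M := M) hJ hJ' hS hJS) ?_) (Triple.assign_seq (Triple.assign ?_)))))
      · rintro ⟨F, k⟩ s ⟨s₀, ⟨h, hk⟩, rfl⟩
        refine ⟨⟨h.update ?_ (by decide), hk⟩, by simp [Exp.eval]⟩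
        have := hJ F
        simp only [Exp.eval, Val.size]
        omega
      · rintro ⟨F, k⟩ s ⟨s₀, ⟨⟨h, hk⟩, h5⟩, rfl⟩
        refine ⟨(F, k), Or.inl ⟨by positivity, ⟨h.update ?_ (by decide), length_lowBits _ _,
          by simpa using h5, by simp [Exp.eval, Val.ofBool]⟩⟩, rfl, le_rfl, fun s' h' => ⟨h', hk⟩⟩
        have := hJ F
        simp only [Exp.eval, Val.size]
        omega
      · rintro ⟨F, k⟩ s ⟨s₀, ⟨h, hk⟩, rfl⟩
        simp only at h hk
        have h1 := hJ F
        have h2 := F.length_varList_le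
        have h3 : (Val.nil.cons (s₀ 3)).size ≤ J F := by
          simp only [h.h3, Val.size, size_enc_replicate]
          omega
        have h4 : (s₀ 4).tail.size ≤ J F := (Val.size_tail_le _).trans (h.size 4)
        refine ⟨h.wf, hk, by simp [h.h0], by simp [h.h1],
          by simp [Exp.eval, h.h3, enc_replicate_succ], ?_,
          size_update_le_of (size_update_le_of h.size _ ?_) _ ?_⟩
        · simp [Exp.eval, h.h4, enc_tail]
        · simpa [Exp.eval] using h3
        · simpa [Exp.eval] using h4
    · rintro F k s hk h
      simp only [Exp.eval, h.h4, ne_eq, enc_list_eq_nil, List.drop_eq_nil_iff, List.length_cons,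
        List.length_map, not_le]
      exact hk
    · rintro F s h
      rw [Exp.eval, h.h4, List.drop_eq_nil_of_le (by simp), enc_nil]
    · obtain ⟨r, hr⟩ := hJ'
      refine ⟨18 * r, ?_⟩
      rintro F k s - h
      have h1 := h.store_size
      have := hr F
      simp only [Polynomial.eval_mul, Polynomial.eval_ofNat] at h1 ⊢
      omega
    · rintro F s h
      have h1 := hr F h.wf
      have h2 := F.length_varList_le
      simp only [Finset.sum_add_distrib, Finset.sum_const, Finset.card_powerset, smul_eq_mul,
        mul_one, Finset.card_range, Polynomial.eval_mul, Polynomial.eval_add, Polynomial.eval_X,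
        Polynomial.eval_one, Polynomial.eval_ofNat]
      generalize 2 ^ F.vars.card = y at *
      calc _ ≤ (F.length + 1) * (r.eval F.length * y) + (F.length + 1) * y + (F.length + 1) + 1 := by
            gcongr ?_ + 1
            have : (F.varList.length + 1) * (∑ X ∈ F.vars.powerset, solverCost M F X + y + 1) ≤
              (F.length + 1) * (r.eval F.length * y + y + 1) := by gcongr
            linarith
        _ ≤ (F.length + 1) * (r.eval F.length + 2) * (y + 1) := by
            nlinarith [Nat.zero_le (F.length * y), Nat.zero_le (F.length * r.eval F.length),
              Nat.zero_le (r.eval F.length)]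
    · rintro F s ⟨s₃, ⟨s₂, ⟨s₁, ⟨s₀, G, ⟨hF, rfl⟩, hG, rfl⟩, rfl⟩, rfl⟩, rfl⟩
      obtain rfl : F.raw = G := Enc.inj (by
        simpa [Exp.eval, Store.input_zero, enc_formula_raw] using hG)
      have h1 := hJ F
      have h2 := F.size_varList_le
      rw [F.foldl_addVars]
      have h3 : (enc F).size ≤ J F := by
        rw [← F.encode_eq, ← Formula.length]
        omega
      refine ⟨hF, by omega, by simp [Store.input], by simp [Exp.eval], by simp [Exp.eval, enc_nil],
        by simp [Exp.eval, enc_cons, enc_val], ?_⟩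
      refine size_update_le_of (size_update_le_of (size_update_le_of (size_update_le_of
        (size_update_le_of (fun i => ?_) _ ?_) _ ?_) _ ?_) _ ?_) _ ?_
      · simp only [Val.size]; omega
      · exact h3
      · omega
      · simp only [Exp.eval, Val.size]; omega
      · simp only [Exp.eval, Val.size]; omega
      · simp [Exp.eval, Val.size]; omega
  obtain ⟨q, hq⟩ := main (Polynomial.X + 18)
  -- The factor 2 absorbs the `+ 1` in the time factor of a triple: `2 ^ n + 1 ≤ 2 * 2 ^ n`.
  refine ⟨2 * q, fun F hF => ?_⟩
  obtain ⟨s, t, w, h1, -, h3, h4⟩ := hq F _ ⟨hF, rfl⟩ (by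
    have := Store.size_input_le 17 (enc F)
    simp only [Formula.length, F.encode_eq, Polynomial.eval_add, Polynomial.eval_X,
      Polynomial.eval_ofNat]
    omega)
  refine ⟨s, t, w, h1, ?_, ?_⟩
  · have h5 : 1 ≤ 2 ^ F.vars.card := Nat.one_le_two_pow
    have h6 : t ≤ 2 * q.eval F.length * 2 ^ F.vars.card := by nlinarith
    simpa using (Nat.cast_le (α := ℝ)).2 h6
  · replace h4 : w ≤ q.eval F.length := h4
    simp only [Polynomial.eval_mul, Polynomial.eval_ofNat]
    omega

end

/-! ## Counting the subsets on which the solver is called -/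

namespace Formula

def clauseVars (c : Clause) : Finset ℕ := (c.map Literal.var).toFinset

lemma mem_clauseVars {c : Clause} {x : ℕ} : x ∈ clauseVars c ↔ ∃ l ∈ c, l.var = x := by
  simp [clauseVars]

lemma vars_cons (c : Clause) (F : Formula) : vars (c :: F) = clauseVars c ∪ vars F := by
  simp [vars, clauseVars]

/-- The product of `φ r` over the clauses that are not touched by `X`, where `r` is the number of
variables of the clause that are neither in `D` nor in an earlier clause. -/
def weight (φ : ℕ → ℕ) (X : Finset ℕ) : Finset ℕ → Formula → ℕ
  | _, [] => 1
  | D, c :: F => (if Touched X c then 1 else φ (clauseVars c \ D).card) *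
      weight φ X (D ∪ clauseVars c) F

lemma countP_mem_eq_card {c : Clause} (hc : (c.map Literal.var).Nodup) (X : Finset ℕ) :
    c.countP (fun l => l.var ∈ X) = (clauseVars c ∩ X).card := by
  have h : c.countP (fun l => l.var ∈ X) = (c.map Literal.var).countP (fun x => x ∈ X) := by
    rw [List.countP_map]; rfl
  rw [h, List.countP_eq_length_filter, ← List.toFinset_card_of_nodup (hc.filter _),
    List.toFinset_filter, clauseVars]
  congr 1
  ext x
  simp

lemma sum_powerset_union {N R : Finset ℕ} (h : Disjoint N R) (f : Finset ℕ → ℝ) :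
    ∑ Y ∈ (N ∪ R).powerset, f Y = ∑ A ∈ N.powerset, ∑ B ∈ R.powerset, f (A ∪ B) := by
  rw [← Finset.sum_product']
  refine Finset.sum_nbij' (fun Y => (Y ∩ N, Y ∩ R)) (fun p => p.1 ∪ p.2) ?_ ?_ ?_ ?_ ?_
  · intro Y hY
    simp
  · intro p hp
    simp only [Finset.mem_product, Finset.mem_powerset] at hp ⊢
    exact Finset.union_subset_union hp.1 hp.2
  · intro Y hY
    rw [Finset.mem_powerset] at hY
    simp only
    rw [← Finset.inter_union_distrib_left, Finset.inter_eq_left.2 hY]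
  · rintro ⟨A, B⟩ hp
    simp only [Finset.mem_product, Finset.mem_powerset] at hp
    have h1 : Disjoint B N := (h.mono_right hp.2).symm
    have h2 : Disjoint A R := h.mono_left hp.1
    simp only [Finset.union_inter_distrib_right, Finset.disjoint_iff_inter_eq_empty.1 h1,
      Finset.disjoint_iff_inter_eq_empty.1 h2, Finset.inter_eq_left.2 hp.1,
      Finset.inter_eq_left.2 hp.2, Finset.union_empty, Finset.empty_union]
  · intro Y hY
    rw [Finset.mem_powerset] at hY
    simp only
    rw [← Finset.inter_union_distrib_left, Finset.inter_eq_left.2 hY]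

/-- The number of possibilities for the intersection of a good set `X` with a clause, of which `j`
elements are given and `r` variables are free. -/
lemma sum_choices_le {φ : ℕ → ℕ} {β : ℝ} (h1 : ∀ r, 1 ≤ φ r)
    (hφ : ∀ r, ((φ r + r.choose 2 : ℕ) : ℝ) ≤ β ^ r) (N : Finset ℕ) (j : ℕ) :
    ∑ Y ∈ N.powerset, (if j + Y.card = 0 then (φ N.card : ℝ) else
      if j + Y.card = 2 then 1 else 0) ≤ β ^ N.card := by
  rw [Finset.sum_powerset_apply_card (fun i => if j + i = 0 then (φ N.card : ℝ) else
      if j + i = 2 then 1 else 0)]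
  refine le_trans ?_ (hφ N.card)
  generalize N.card = r
  -- The added terms have vanishing binomial coefficients; with `r + 3` terms, those for `i = 0, 1,
  -- 2` can be split off for every `r`.
  have h2 : ∑ i ∈ Finset.range (r + 1), r.choose i • (if j + i = 0 then (φ r : ℝ) else
      if j + i = 2 then 1 else 0) = ∑ i ∈ Finset.range (r + 3), r.choose i •
        (if j + i = 0 then (φ r : ℝ) else if j + i = 2 then 1 else 0) := by
    refine Finset.sum_subset (by simp) fun i _ hi => ?_
    rw [Finset.mem_range, not_lt] at hi
    rw [Nat.choose_eq_zero_of_lt (by omega), zero_smul]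
  rw [h2, Finset.sum_range_succ', Finset.sum_range_succ', Finset.sum_range_succ',
    Finset.sum_eq_zero fun i _ => by rw [if_neg (by omega), if_neg (by omega), smul_zero]]
  -- Needed for `j = 1`, where exactly one of the `r` free variables has to be chosen.
  have hr : r ≤ 1 + r.choose 2 := by
    induction r with
    | zero => simp
    | succ r ih =>
      rw [Nat.choose_succ_succ' r 1, Nat.choose_one_right]
      rcases Nat.eq_zero_or_pos r with rfl | h
      · simp
      · rcases Nat.lt_or_ge r 2 with h' | h'
        · interval_cases r; simp
        · have := Nat.choose_pos h'
          omega
  have h1' : (1 : ℝ) ≤ φ r := by exact_mod_cast h1 r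
  have hr' : (r : ℝ) ≤ 1 + r.choose 2 := by exact_mod_cast hr
  -- The sum equals `φ r + r.choose 2`, `r`, `1` and `0` in the four cases.
  rcases j with _ | _ | _ | j
  · simp; linarith
  · simp; linarith
  · simp; linarith
  · simp only [show j + 1 + 1 + 1 + (0 + 1 + 1) ≠ 0 by omega,
      show j + 1 + 1 + 1 + (0 + 1 + 1) ≠ 2 by omega, show j + 1 + 1 + 1 + (0 + 1) ≠ 0 by omega,
      show j + 1 + 1 + 1 + (0 + 1) ≠ 2 by omega, show j + 1 + 1 + 1 + 0 ≠ 0 by omega,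
      show j + 1 + 1 + 1 + 0 ≠ 2 by omega, if_false, smul_zero, add_zero]
    positivity

lemma touched_iff_card {X : Finset ℕ} {c : Clause} (hc : (c.map Literal.var).Nodup) :
    Touched X c ↔ (clauseVars c ∩ X).card ≠ 0 := by
  rw [touched_iff, countP_mem_eq_card hc]

/-- `D` contains the variables already revealed, and `X₀` is the part of `X` inside `D`. For the
first clause `c`, both its weight and the condition on it depend only on `X₀` and on the part `A` of
`X` among the new variables `N` of `c`. So the sum over `A` is bounded by `sum_choices_le`, and for
each `A` the sum over the rest is bounded by induction with `X₀ ∪ A`. -/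
lemma sum_weight_le {φ : ℕ → ℕ} {β : ℝ} (h1 : ∀ r, 1 ≤ φ r)
    (hφ : ∀ r, ((φ r + r.choose 2 : ℕ) : ℝ) ≤ β ^ r) (hβ : 0 ≤ β) (F : Formula)
    (hF : F.WellFormed) (D X₀ : Finset ℕ) (hX₀ : X₀ ⊆ D) :
    ∑ Y ∈ (F.vars \ D).powerset, (if F.Good (X₀ ∪ Y) then (weight φ (X₀ ∪ Y) D F : ℝ) else 0) ≤
      β ^ (F.vars \ D).card := by
  induction F generalizing D X₀ with
  | nil => simp [vars, Good, weight]
  | cons c F ih =>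
    have hc := hF c List.mem_cons_self
    have hF' : WellFormed F := fun d hd => hF d (List.mem_cons_of_mem _ hd)
    set N := clauseVars c \ D with hN
    set R := vars F \ (D ∪ clauseVars c) with hR
    have hNR : Disjoint N R := by
      rw [Finset.disjoint_left]
      intro x hx hx'
      simp only [hN, hR, Finset.mem_sdiff, Finset.mem_union] at hx hx'
      tauto
    have hu : vars (c :: F) \ D = N ∪ R := by
      rw [vars_cons]
      ext x
      simp only [hN, hR, Finset.mem_sdiff, Finset.mem_union]
      tauto
    rw [hu, sum_powerset_union hNR, Finset.card_union_of_disjoint hNR, pow_add]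
    calc _ ≤ ∑ A ∈ N.powerset, (if (clauseVars c ∩ X₀).card + A.card = 0 then (φ N.card : ℝ) else
            if (clauseVars c ∩ X₀).card + A.card = 2 then 1 else 0) * β ^ R.card := ?_
      _ ≤ _ := by
        rw [← Finset.sum_mul]
        exact mul_le_mul_of_nonneg_right (sum_choices_le h1 hφ N _) (by positivity)
    refine Finset.sum_le_sum fun A hA => ?_
    rw [Finset.mem_powerset] at hA
    refine le_trans ?_ (mul_le_mul_of_nonneg_left (ih hF' (D ∪ clauseVars c) (X₀ ∪ A) ?_) ?_)
    · rw [Finset.mul_sum]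
      refine Finset.sum_le_sum fun B hB => ?_
      rw [Finset.mem_powerset] at hB
      have hcard : (clauseVars c ∩ (X₀ ∪ (A ∪ B))).card = (clauseVars c ∩ X₀).card + A.card := by
        have : clauseVars c ∩ (X₀ ∪ (A ∪ B)) = (clauseVars c ∩ X₀) ∪ A := by
          ext x
          have hA' := @hA x
          have hB' := @hB x
          have hX' := @hX₀ x
          simp only [hN, hR, Finset.mem_sdiff, Finset.mem_union, Finset.mem_inter] at *
          tauto
        rw [this, Finset.card_union_of_disjoint]
        rw [Finset.disjoint_left]
        intro x hx hx'
        have hA' := hA hx'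
        simp only [hN, Finset.mem_sdiff, Finset.mem_inter] at *
        exact hA'.2 (hX₀ hx.2)
      have hgood : Good (c :: F) (X₀ ∪ (A ∪ B)) ↔ ((clauseVars c ∩ X₀).card + A.card = 0 ∨
          (clauseVars c ∩ X₀).card + A.card = 2) ∧ Good F (X₀ ∪ A ∪ B) := by
        simp only [Good, List.forall_mem_cons, countP_mem_eq_card hc, hcard, Finset.union_assoc]
      have ht := touched_iff_card (X := X₀ ∪ (A ∪ B)) hc
      rw [hcard] at ht
      rw [weight, ← hN, Finset.union_assoc]
      by_cases hg : Good F (X₀ ∪ (A ∪ B))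
      · rw [Finset.union_assoc] at hgood
        by_cases h0 : (clauseVars c ∩ X₀).card + A.card = 0
        · rw [if_pos (hgood.2 ⟨Or.inl h0, hg⟩), if_pos h0, if_neg fun h => ht.1 h h0, if_pos hg]
          push_cast
          exact le_rfl
        by_cases h2 : (clauseVars c ∩ X₀).card + A.card = 2
        · rw [if_pos (hgood.2 ⟨Or.inr h2, hg⟩), if_neg h0, if_pos h2, if_pos (ht.2 h0), if_pos hg]
          push_cast
          exact le_rfl
        · rw [if_neg fun h => (hgood.1 h).1.elim h0 h2, if_neg h0, if_neg h2]
          simp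
      · rw [Finset.union_assoc] at hgood
        rw [if_neg fun h => hg (hgood.1 h).2, if_neg hg, mul_zero]
    · refine Finset.union_subset_union hX₀ (hA.trans ?_)
      exact Finset.sdiff_subset
    · split_ifs <;> positivity

lemma sum_good_weight_le {φ : ℕ → ℕ} {β : ℝ} (h1 : ∀ r, 1 ≤ φ r)
    (hφ : ∀ r, ((φ r + r.choose 2 : ℕ) : ℝ) ≤ β ^ r) (hβ : 0 ≤ β) (F : Formula)
    (hF : F.WellFormed) :
    ∑ X ∈ F.vars.powerset, (if F.Good X then (weight φ X ∅ F : ℝ) else 0) ≤ β ^ F.vars.card := by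
  simpa using sum_weight_le h1 hφ hβ F hF ∅ ∅ subset_rfl

/-- With this weight, `sum_good_weight_le` simply counts the good sets. -/
lemma weight_one (X D : Finset ℕ) (F : Formula) : weight (fun _ => 1) X D F = 1 := by
  induction F generalizing D with
  | nil => rfl
  | cons c F ih => simp [weight, ih]

end Formula

/-- Here `2 / 1.1749` is about `1.702`. The `r`-th root of the left side is largest at `r = 4`,
where it is about `1.627`. From `r = 4` on, the left side grows by a factor of at most `1.7` in each
step, because `3 * r ≤ 2 * r.choose 2`. -/
lemma one_add_choose_two_le (r : ℕ) : ((1 + r.choose 2 : ℕ) : ℝ) ≤ (2 / 1.1749) ^ r := by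
  rcases Nat.lt_or_ge r 4 with h | h
  · interval_cases r <;> norm_num [Nat.choose]
  · induction r, h using Nat.le_induction with
    | base => norm_num [Nat.choose]
    | succ r hr ih =>
      rw [pow_succ, Nat.choose_succ_succ' r 1, Nat.choose_one_right]
      have h2 : (r : ℝ) * 3 ≤ 2 * r.choose 2 := by
        rw [Nat.cast_choose_two]
        have : (4 : ℝ) ≤ r := by exact_mod_cast hr
        nlinarith
      push_cast at ih ⊢
      have h3 : (0 : ℝ) ≤ r := by positivity
      have h4 : (1.7 : ℝ) ≤ 2 / 1.1749 := by norm_num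
      calc _ ≤ (1 + (r.choose 2 : ℝ)) * 1.7 := by linarith
        _ ≤ _ := by gcongr

/-- The left side is the number of subsets of an `r`-element set with at most two elements. Equality
holds for `r ≤ 2`, so the base 2 cannot be lowered. -/
lemma succ_add_choose_two_le (r : ℕ) : r + 1 + r.choose 2 ≤ 2 ^ r := by
  induction r with
  | zero => simp
  | succ r ih =>
    rw [pow_succ, Nat.choose_succ_succ' r 1, Nat.choose_one_right, one_add_one_eq_two]
    omega

/-- With a solver in time `O(1.1749 ^ n)`, the algorithm `P` runs in time `O(2 ^ n)`. -/
theorem runs_algorithmP_of_fast {m : ℕ} (S : Cmd (m + 1)) (hS : RunsInPolySpaceAndTime 1.1749 S) :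
    RunsInPolySpaceAndTime 2 (algorithmP S) := by
  obtain ⟨p, hp⟩ := hS
  -- The time factor has to be a natural number. Rounding up at most doubles it, as `1.1749 ^ n ≥
  -- 1`.
  refine runs_algorithmP (p := p) (M := fun G => ⌈(1.1749 : ℝ) ^ G.vars.card⌉₊) ?_ ?_
  · intro G hG
    obtain ⟨s, t, w, h1, h2, h3⟩ := hp G hG
    refine ⟨s, t, w, h1, ?_, h3⟩
    have : (t : ℝ) ≤ (p.eval G.length * ⌈(1.1749 : ℝ) ^ G.vars.card⌉₊ : ℕ) := by
      push_cast
      exact h2.trans (mul_le_mul_of_nonneg_left (Nat.le_ceil _) (by positivity))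
    exact_mod_cast this
  · refine ⟨2, fun F hF => ?_⟩
    have h := Formula.sum_good_weight_le (φ := fun _ => 1) (β := 2 / 1.1749) (fun _ => le_rfl)
      one_add_choose_two_le (by norm_num) F hF
    simp only [Formula.weight_one] at h
    have h1 : (1 : ℝ) ≤ (1.1749 : ℝ) ^ F.vars.card := one_le_pow₀ (by norm_num)
    have h2 : (⌈(1.1749 : ℝ) ^ F.vars.card⌉₊ : ℝ) ≤ 2 * (1.1749 : ℝ) ^ F.vars.card := by
      have := (Nat.ceil_lt_add_one (R := ℝ) (a := (1.1749 : ℝ) ^ F.vars.card) (by positivity)).le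
      linarith
    have h3 : ((∑ X ∈ F.vars.powerset,
        solverCost (fun G => ⌈(1.1749 : ℝ) ^ G.vars.card⌉₊) F X : ℕ) : ℝ) ≤
        2 * 2 ^ F.vars.card := by
      simp only [solverCost, Formula.vars_flips_append]
      push_cast
      have h4 : ∀ X, ((if F.Good X then ⌈(1.1749 : ℝ) ^ F.vars.card⌉₊ else 0 : ℕ) : ℝ) =
          ⌈(1.1749 : ℝ) ^ F.vars.card⌉₊ * (if F.Good X then ((1 : ℕ) : ℝ) else 0) := by
        intro X; split_ifs <;> simp
      push_cast at h4
      simp only [h4, ← Finset.mul_sum]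
      push_cast at h
      calc _ ≤ 2 * (1.1749 : ℝ) ^ F.vars.card * (2 / 1.1749) ^ F.vars.card :=
            mul_le_mul h2 h (by positivity) (by positivity)
        _ = _ := by rw [mul_assoc, ← mul_pow]; norm_num
    rw [Polynomial.eval_ofNat]
    exact_mod_cast h3

/-! ## A solver for XSAT: equations between literals -/

namespace RawLit

/-- The complementary literal. -/
def neg (l : RawLit) : RawLit := (!l.1, l.2)

/-- The truth value of a literal under an assignment. -/
def holds (v : Val → Bool) (l : RawLit) : Bool := v l.2 == l.1

/-- A literal that stands for the truth value `true`. -/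
def top : RawLit := (true, Val.cons (Val.cons Val.nil (Val.cons Val.nil Val.nil)) Val.nil)

lemma holds_neg (v : Val → Bool) (l : RawLit) : holds v (neg l) = !holds v l := by
  cases h : v l.2 <;> cases h' : l.1 <;> simp [holds, neg, h, h']

lemma neg_neg (l : RawLit) : neg (neg l) = l := by simp [neg]

lemma neg_ne (l : RawLit) : neg l ≠ l := by
  intro h
  have := congrArg Prod.fst h
  simp [neg] at this

lemma eq_or_eq_neg_of_snd_eq {a b : RawLit} (h : a.2 = b.2) : a = b ∨ a = neg b := by
  obtain ⟨a, x⟩ := a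
  obtain ⟨b, y⟩ := b
  simp only at h
  subst h
  cases a <;> cases b <;> simp [neg]

/-- Replace the literal `a` by the literal `b`. -/
def subst (a b l : RawLit) : RawLit := if l = a then b else if l = neg a then neg b else l

end RawLit

open RawLit

/-- A list of equations between literals. -/
abbrev Equations := List (RawLit × RawLit)

namespace Equations

/-- The assignments that satisfy the equations, with `top` being true. -/
def models (E : Equations) : Set (Val → Bool) :=
  {v | holds v top = true ∧ ∀ e ∈ E, holds v e.1 = holds v e.2}

/-- Eliminate the first equation; the Boolean records whether a contradiction was found. -/
def elim (x : Equations × Bool) : Equations × Bool :=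
  match x.1 with
  | [] => x
  | e :: E => if e.1 = e.2 then (E, x.2) else if e.1 = neg e.2 then (E, false) else
    (E.map fun d => (subst e.1 e.2 d.1, subst e.1 e.2 d.2), x.2)

/-- The list being folded over serves only as a counter: each elimination removes one equation, so
as many rounds as there are equations suffice. -/
def consistent (E : Equations) : Bool := (E.foldl (fun x _ => elim x) (E, true)).2

def Solvable (E : Equations) : Prop := ∃ v, ∀ e ∈ E, holds v e.1 = holds v e.2

/-- Giving the variable of `a` the value that makes `a` agree with `b` amounts to substituting `b`
for `a`. The value of `b` is not disturbed, because the two variables differ. -/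
lemma holds_update {v : Val → Bool} {a b : RawLit} (hab : a.2 ≠ b.2) (l : RawLit) :
    holds (Function.update v a.2 (holds v b == a.1)) l = holds v (subst a b l) := by
  by_cases h : l.2 = a.2
  · rcases eq_or_eq_neg_of_snd_eq h with rfl | rfl
    · simp only [subst, if_true, holds, Function.update_self]
      cases v b.2 <;> cases b.1 <;> cases l.1 <;> rfl
    · simp only [subst, if_neg (neg_ne a), if_true]
      rw [holds_neg, holds_neg]
      congr 1
      simp only [holds, Function.update_self]
      cases v b.2 <;> cases b.1 <;> cases a.1 <;> rfl
  · have h1 : l ≠ a := fun h' => h (by rw [h'])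
    have h2 : l ≠ neg a := fun h' => h (by rw [h']; rfl)
    simp [subst, h1, h2, holds, h]

lemma elim_solvable (x : Equations × Bool) :
    ((elim x).2 = true ∧ Solvable (elim x).1) ↔ (x.2 = true ∧ Solvable x.1) := by
  obtain ⟨E, b⟩ := x
  obtain _ | ⟨⟨l, l'⟩, E⟩ := E
  · rfl
  simp only [elim, Solvable, List.forall_mem_cons]
  split_ifs with h1 h2
  · subst h1
    simp
  · subst h2
    simp [holds_neg]
  · refine and_congr_right fun _ => ⟨?_, ?_⟩
    · rintro ⟨v, hv⟩
      have hne : l.2 ≠ l'.2 := fun h => (eq_or_eq_neg_of_snd_eq h).elim h1 h2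
      refine ⟨Function.update v l.2 (holds v l' == l.1), ?_, ?_⟩
      · have h3 : l' ≠ l := Ne.symm h1
        have h4 : l' ≠ neg l := fun h => h2 (by rw [h, neg_neg])
        rw [holds_update hne, holds_update hne]
        simp [subst, h3, h4]
      · intro e he
        rw [holds_update hne, holds_update hne]
        exact hv _ (List.mem_map_of_mem he)
    · rintro ⟨v, hv, hE⟩
      have key : ∀ d, holds v (subst l l' d) = holds v d := by
        intro d
        rw [subst]
        split_ifs with h3 h4
        · rw [h3, hv]
        · rw [h4, holds_neg, holds_neg, hv]
        · rfl
      refine ⟨v, ?_⟩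
      intro e he
      obtain ⟨d, hd, rfl⟩ := List.mem_map.1 he
      simp only [key]
      exact hE d hd

lemma length_elim (x : Equations × Bool) : (elim x).1.length = x.1.length - 1 := by
  obtain ⟨E, b⟩ := x
  obtain _ | ⟨e, E⟩ := E
  · rfl
  simp only [elim]
  split_ifs <;> simp

lemma consistent_iff_solvable (E : Equations) : consistent E = true ↔ Solvable E := by
  have key : ∀ (L : Equations) (x : Equations × Bool), x.1.length ≤ L.length →
      ((L.foldl (fun x _ => elim x) x).2 = true ↔ x.2 = true ∧ Solvable x.1) := by
    intro L
    induction L with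
    | nil =>
      rintro ⟨E, b⟩ hx
      simp at hx
      simp [hx, Solvable]
    | cons e L ih =>
      intro x hx
      rw [List.foldl_cons, ih, elim_solvable]
      rw [length_elim]
      simp at hx
      omega
  rw [consistent, key E _ le_rfl]
  simp

/-- Equations between literals are invariant under complementing all variables. So a solution in
which `top` is false can be exchanged for one in which it is true. -/
lemma consistent_iff (E : Equations) : consistent E = true ↔ E.models.Nonempty := by
  rw [consistent_iff_solvable]
  constructor
  · rintro ⟨v, hv⟩
    cases h : holds v top
    · refine ⟨fun x => !v x, ?_, ?_⟩
      · simpa [holds, top] using h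
      · intro e he
        have := hv e he
        simp only [holds] at this ⊢
        revert this
        cases v e.1.2 <;> cases v e.2.2 <;> cases e.1.1 <;> cases e.2.1 <;> simp
    · exact ⟨v, h, hv⟩
  · rintro ⟨v, -, hv⟩
    exact ⟨v, hv⟩

end Equations

/-! ## The search -/

def Exact (c : List RawLit) (v : Val → Bool) : Prop := c.countP (holds v) = 1

lemma exact_cons {a : RawLit} {l : List RawLit} {v : Val → Bool} :
    Exact (a :: l) v ↔ (holds v a = true ∧ ∀ x ∈ l, holds v x = false) ∨
      (holds v a = false ∧ Exact l v) := by
  cases h : holds v a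
  · simp [Exact, h]
  · simp [Exact, h, List.countP_eq_zero]

/-- The equations that make the first literal of a clause true and the other ones false. -/
def pickEqs (a : RawLit) (l : List RawLit) : Equations :=
  (a, top) :: l.map fun x => (x, neg top)

/-- A node of the search tree: equations between literals, and clauses to be satisfied. -/
abbrev Node := Equations × List (List RawLit)

namespace Node

def Sat (s : Node) : Prop := ∃ v ∈ s.1.models, ∀ c ∈ s.2, Exact c v

lemma models_pick (a : RawLit) (l : List RawLit) (E : Equations) :
    Equations.models (pickEqs a l ++ E) =
      E.models ∩ {v | holds v a = true ∧ ∀ x ∈ l, holds v x = false} := by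
  ext v
  simp only [Equations.models, pickEqs, List.cons_append, List.forall_mem_cons, List.forall_mem_append,
    List.forall_mem_map, Set.mem_inter_iff, Set.mem_ofPred_eq, holds_neg]
  constructor
  · rintro ⟨h1, h2, h3, h4⟩
    rw [h1] at h2 h3
    exact ⟨⟨h1, h4⟩, h2, h3⟩
  · rintro ⟨⟨h1, h4⟩, h2, h3⟩
    rw [h1]
    exact ⟨rfl, h2, h3, h4⟩

lemma models_drop (a : RawLit) (E : Equations) :
    Equations.models ((a, neg top) :: E) = E.models ∩ {v | holds v a = false} := by
  ext v
  simp only [Equations.models, List.forall_mem_cons, Set.mem_inter_iff, Set.mem_ofPred_eq, holds_neg]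
  constructor
  · rintro ⟨h1, h2, h4⟩
    rw [h1] at h2
    exact ⟨⟨h1, h4⟩, h2⟩
  · rintro ⟨⟨h1, h4⟩, h2⟩
    rw [h1]
    exact ⟨rfl, h2, h4⟩

lemma sat_cons (E : Equations) (a : RawLit) (l : List RawLit) (C : List (List RawLit)) :
    Sat (E, (a :: l) :: C) ↔ Sat (pickEqs a l ++ E, C) ∨ Sat ((a, neg top) :: E, l :: C) := by
  simp only [Sat, models_pick, models_drop, List.forall_mem_cons, exact_cons, Set.mem_inter_iff,
    Set.mem_ofPred_eq]
  constructor
  · rintro ⟨v, hv, h1 | h1, h2⟩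
    · exact Or.inl ⟨v, ⟨hv, h1⟩, h2⟩
    · exact Or.inr ⟨v, ⟨hv, h1.1⟩, h1.2, h2⟩
  · rintro (⟨v, ⟨hv, h1⟩, h2⟩ | ⟨v, ⟨hv, h1⟩, h2, h3⟩)
    · exact ⟨v, hv, Or.inl h1, h2⟩
    · exact ⟨v, hv, Or.inr ⟨h1, h2⟩, h3⟩

/-- A measure for the clauses still to be satisfied. -/
def measure (C : List (List RawLit)) : ℕ := (C.map fun c => c.length + 1).sum

lemma measure_cons (c : List RawLit) (C : List (List RawLit)) :
    measure (c :: C) = c.length + 1 + measure C := by simp [measure]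

end Node

open Classical in
/-- The number of nodes of the search tree below the node with the models `M` and the clauses `C`. -/
noncomputable def work (M : Set (Val → Bool)) : List (List RawLit) → ℕ
  | [] => 1
  | [] :: _ => 1
  | (a :: l) :: C => if M = ∅ then 1 else
      1 + work (M ∩ {v | holds v a = true ∧ ∀ x ∈ l, holds v x = false}) C +
        work (M ∩ {v | holds v a = false}) (l :: C)
  termination_by C => Node.measure C
  decreasing_by all_goals simp [Node.measure_cons]; try omega

/-- One step of the depth-first search: the list of open nodes, and whether a model was found. -/
def searchStep (x : List Node × Bool) : List Node × Bool :=
  match x.1 with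
  | [] => x
  | s :: L =>
    if Equations.consistent s.1 = true then
      match s.2 with
      -- Emptying the stack makes the main loop stop.
      | [] => ([], true)
      | c :: C =>
        match c with
        | [] => (L, false)
        | a :: l => ((pickEqs a l ++ s.1, C) :: ((a, neg top) :: s.1, l :: C) :: L, false)
    else (L, false)

lemma one_le_work (M : Set (Val → Bool)) (C : List (List RawLit)) : 1 ≤ work M C := by
  rcases C with _ | ⟨_ | ⟨a, l⟩, C⟩
  · simp [work]
  · simp [work]
  · rw [work]
    split_ifs <;> omega

/-- The number of steps the search takes at most. -/
noncomputable def stackWork (L : List Node) : ℕ := (L.map fun s => work s.1.models s.2).sum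

lemma stackWork_cons (s : Node) (L : List Node) :
    stackWork (s :: L) = work s.1.models s.2 + stackWork L := by simp [stackWork]

/-- A branching step replaces a node by two children whose work is one less in total; any other
unsuccessful step removes a node, whose work is at least 1. So `stackWork` bounds the number of
steps. -/
lemma searchStep_spec (s : Node) (L : List Node) :
    (searchStep (s :: L, false) = ([], true) ∧ s.Sat) ∨
    ((searchStep (s :: L, false)).2 = false ∧
      stackWork (searchStep (s :: L, false)).1 < stackWork (s :: L) ∧
      ((∃ d ∈ (searchStep (s :: L, false)).1, d.Sat) ↔ ∃ d ∈ s :: L, d.Sat)) := by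
  obtain ⟨E, C⟩ := s
  have hw := one_le_work E.models C
  simp only [searchStep]
  split_ifs with h
  · have hE := (Equations.consistent_iff E).1 h
    rcases C with _ | ⟨_ | ⟨a, l⟩, C⟩
    · obtain ⟨v, hv⟩ := hE
      exact Or.inl ⟨rfl, v, hv, by simp⟩
    · refine Or.inr ⟨rfl, ?_, ?_⟩
      · simp only [stackWork_cons]
        omega
      · simp [Node.Sat, Exact]
    · refine Or.inr ⟨rfl, ?_, ?_⟩
      · simp only [stackWork_cons, Node.models_pick, Node.models_drop]
        rw [work, if_neg hE.ne_empty]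
        omega
      · simp only [List.exists_mem_cons_iff, Node.sat_cons]
        tauto
  · refine Or.inr ⟨rfl, ?_, ?_⟩
    · simp only [stackWork_cons]
      omega
    · have hE : ¬ Node.Sat (E, C) := by
        rintro ⟨v, hv, -⟩
        exact h ((Equations.consistent_iff E).2 ⟨v, hv⟩)
      simp [hE]

/-- The search terminates with the right answer. -/
lemma exists_iterate_searchStep (L : List Node) :
    ∃ i ≤ stackWork L, (searchStep^[i] (L, false)).1 = [] ∧
      ((searchStep^[i] (L, false)).2 = true ↔ ∃ s ∈ L, s.Sat) := by
  induction h : stackWork L using Nat.strong_induction_on generalizing L with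
  | _ n ih =>
    subst h
    obtain _ | ⟨s, L⟩ := L
    · exact ⟨0, Nat.zero_le _, rfl, by simp⟩
    rcases searchStep_spec s L with ⟨h1, h2⟩ | ⟨h1, h2, h3⟩
    · refine ⟨1, ?_, ?_, ?_⟩
      · rw [stackWork_cons]
        have := one_le_work s.1.models s.2
        omega
      · simp [h1]
      · simp [h1, h2]
    · obtain ⟨i, hi, h4, h5⟩ := ih _ h2 (searchStep (s :: L, false)).1 rfl
      have h6 : ((searchStep (s :: L, false)).1, false) = searchStep (s :: L, false) :=
        Prod.ext rfl h1.symm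
      rw [h6] at h4 h5
      refine ⟨i + 1, by omega, ?_, ?_⟩
      · rw [Function.iterate_succ_apply]
        exact h4
      · rw [Function.iterate_succ_apply, h5, h3]

/-! ## The initial node -/

/-- If two literals `x`, `y` of the clause `c` occur negated in `d`, exactly one of them is true and
the other literals of `c` are false. -/
def pairEqs (c d : List RawLit) : Equations :=
  match c.filter fun l => neg l ∈ d with
  | [] => []
  | x :: l =>
    match l with
    | [] => []
    | y :: _ => (x, neg y) :: (c.filter fun l => !(decide (l = x) || decide (l = y))).map
        fun l => (l, neg top)

def mateEqs (G : List (List RawLit)) (c : List RawLit) : Equations := G.flatMap fun d => pairEqs c d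

/-- A clause with a mate is implied by the equations of the pair and can be dropped. Only clauses
without a mate are left for branching. -/
def initNode (G : List (List RawLit)) : Node :=
  (G.flatMap fun c => mateEqs G c, G.filter fun c => decide (mateEqs G c = []))

lemma pairEqs_cases (c d : List RawLit) (hc : c.Nodup) :
    pairEqs c d = [] ∨ ∃ x y r, c.Perm (x :: y :: r) ∧ neg x ∈ d ∧ neg y ∈ d ∧
      pairEqs c d = (x, neg y) :: r.map fun l => (l, neg top) := by
  unfold pairEqs
  split
  · exact Or.inl rfl
  rename_i x l h
  split
  · exact Or.inl rfl
  rename_i y l'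
  right
  have hx : x ∈ c.filter fun l => neg l ∈ d := by simp [h]
  have hy : y ∈ c.filter fun l => neg l ∈ d := by simp [h]
  have hn := hc.filter fun l => decide (neg l ∈ d)
  rw [h] at hn
  have hxy : x ≠ y := by
    rintro rfl
    simp at hn
  simp only [List.mem_filter, decide_eq_true_eq] at hx hy
  refine ⟨x, y, _, ?_, hx.2, hy.2, rfl⟩
  rw [List.perm_ext_iff_of_nodup hc]
  · intro z
    simp only [List.mem_cons, List.mem_filter, Bool.not_eq_true', Bool.or_eq_false_iff,
      decide_eq_false_iff_not]
    constructor
    · intro hz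
      tauto
    · rintro (rfl | rfl | h)
      · exact hx.1
      · exact hy.1
      · exact h.1
  · simp [hxy, hc.filter]

lemma exact_of_pairEqs {c d : List RawLit} (hc : c.Nodup) (h : pairEqs c d ≠ []) {v : Val → Bool}
    (hv : v ∈ (pairEqs c d).models) : Exact c v := by
  rcases pairEqs_cases c d hc with h' | ⟨x, y, r, h1, -, -, h2⟩
  · exact absurd h' h
  rw [h2] at hv
  simp only [Equations.models, List.forall_mem_cons, List.forall_mem_map, Set.mem_ofPred_eq,
    holds_neg] at hv
  obtain ⟨h3, h4, h5⟩ := hv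
  rw [h3] at h5
  have h6 : r.countP (holds v) = 0 := by
    rw [List.countP_eq_zero]
    intro l hl
    simp [h5 l hl]
  rw [Exact, h1.countP_eq, List.countP_cons, List.countP_cons, h6, h4]
  cases holds v y <;> rfl

/-- If `x` and `y` were both false, their negations would be two true literals of `d`. So one of
them is true, and as `c` has only one true literal, the other one and all remaining literals are
false. -/
lemma models_of_exact {c d : List RawLit} (hc : c.Nodup) {v : Val → Bool}
    (h₀ : holds v top = true) (hvc : Exact c v) (hvd : Exact d v) : v ∈ (pairEqs c d).models := by
  rcases pairEqs_cases c d hc with h' | ⟨x, y, r, h1, hx, hy, h2⟩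
  · rw [h']
    exact ⟨h₀, by simp⟩
  have hxy : x ≠ y := by
    have := h1.nodup_iff.1 hc
    rintro rfl
    simp at this
  have hor : holds v x = true ∨ holds v y = true := by
    by_contra hcon
    simp only [not_or, Bool.not_eq_true] at hcon
    have h3 : [neg x, neg y].Subperm d := by
      refine List.subperm_of_subset ?_ (by simp [hx, hy])
      have : neg x ≠ neg y := fun h => hxy (by rw [← neg_neg x, h, neg_neg])
      simp [this]
    have h4 := h3.countP_le (holds v)
    rw [hvd] at h4
    simp [holds_neg, hcon] at h4
  rw [Exact, h1.countP_eq, List.countP_cons, List.countP_cons] at hvc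
  have h5 : r.countP (holds v) = 0 ∧ holds v x = !holds v y := by
    cases h6 : holds v x <;> cases h7 : holds v y <;> simp_all
  rw [List.countP_eq_zero] at h5
  rw [h2]
  simp only [Equations.models, List.forall_mem_cons, List.forall_mem_map, Set.mem_ofPred_eq,
    holds_neg, h₀]
  exact ⟨trivial, h5.2, fun l hl => by simpa using h5.1 l hl⟩

lemma models_initNode (G : List (List RawLit)) (v : Val → Bool) :
    v ∈ (initNode G).1.models ↔
      holds v top = true ∧ ∀ c ∈ G, ∀ d ∈ G, v ∈ (pairEqs c d).models := by
  simp only [initNode, mateEqs, Equations.models, List.mem_flatMap, Set.mem_ofPred_eq]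
  constructor
  · rintro ⟨h1, h2⟩
    exact ⟨h1, fun c hc d hd => ⟨h1, fun e he => h2 e ⟨c, hc, d, hd, he⟩⟩⟩
  · rintro ⟨h1, h2⟩
    refine ⟨h1, ?_⟩
    rintro e ⟨c, hc, d, hd, he⟩
    exact (h2 c hc d hd).2 e he

/-- The assignments that satisfy the equations of the initial node satisfy all clauses that were
removed. -/
lemma exact_of_models_initNode {G : List (List RawLit)} (hG : ∀ c ∈ G, c.Nodup) {v : Val → Bool}
    (hv : v ∈ (initNode G).1.models) {c : List RawLit} (hc : c ∈ G)
    (hm : mateEqs G c ≠ []) : Exact c v := by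
  rw [models_initNode] at hv
  have : ∃ d ∈ G, pairEqs c d ≠ [] := by
    by_contra! h
    exact hm (by simpa [mateEqs, List.flatMap_eq_nil_iff] using h)
  obtain ⟨d, hd, h⟩ := this
  exact exact_of_pairEqs (hG c hc) h (hv.2 c hc d hd)

/-- The name of `top` occurs in no clause, so an assignment may be changed to make `top` true
without affecting the clauses. -/
lemma sat_initNode {G : List (List RawLit)} (hG : ∀ c ∈ G, c.Nodup)
    (htop : ∀ c ∈ G, ∀ l ∈ c, l.2 ≠ top.2) :
    (initNode G).Sat ↔ ∃ v, ∀ c ∈ G, Exact c v := by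
  constructor
  · rintro ⟨v, hv, h⟩
    refine ⟨v, fun c hc => ?_⟩
    by_cases hm : mateEqs G c = []
    · exact h c (by simp [initNode, hc, hm])
    · exact exact_of_models_initNode hG hv hc hm
  · rintro ⟨v, hv⟩
    have h1 : ∀ c ∈ G, Exact c (Function.update v top.2 true) := by
      intro c hc
      rw [Exact, ← hv c hc]
      refine List.countP_congr fun l hl => ?_
      simp [holds, htop c hc l hl]
    refine ⟨Function.update v top.2 true, ?_, fun c hc => ?_⟩
    · rw [models_initNode]
      have h2 : holds (Function.update v top.2 true) top = true := by
        simp [holds]; rfl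
      exact ⟨h2, fun c hc d hd => models_of_exact (hG c hc) h2 (h1 c hc) (h1 d hd)⟩
    · simp only [initNode, List.mem_filter] at hc
      exact h1 c hc.1

/-! ## The search runs in polynomial space -/

namespace PolyTime

variable {α : Type*} [Enc α]

lemma neg {f : α → RawLit} (hf : PolyTime f) : PolyTime (fun a => RawLit.neg (f a)) :=
  pair (not (fst hf)) (snd hf)

lemma subst {f g h : α → RawLit} (hf : PolyTime f) (hg : PolyTime g) (hh : PolyTime h) :
    PolyTime (fun a => RawLit.subst (f a) (g a) (h a)) := by
  simpa only [RawLit.subst, decide_eq_true_eq] using ite (beq hh hf) hg (ite (beq hh (neg hf)) (neg hg) hh)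

lemma elim : PolyTime Equations.elim := by
  have h1 : PolyTime fun z : (Equations × Bool) × (RawLit × RawLit) × Equations => z.2.1.1 :=
    fst (fst (snd id))
  have h2 : PolyTime fun z : (Equations × Bool) × (RawLit × RawLit) × Equations => z.2.1.2 :=
    snd (fst (snd id))
  have h3 : PolyTime fun z : (Equations × Bool) × (RawLit × RawLit) × Equations =>
      z.2.2.map fun d => (RawLit.subst z.2.1.1 z.2.1.2 d.1, RawLit.subst z.2.1.1 z.2.1.2 d.2) :=
    map (h := fun y : ((Equations × Bool) × (RawLit × RawLit) × Equations) × RawLit × RawLit =>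
      (RawLit.subst y.1.2.1.1 y.1.2.1.2 y.2.1, RawLit.subst y.1.2.1.1 y.1.2.1.2 y.2.2))
      (snd (snd id)) (pair
      (subst (h1.comp (fst id)) (h2.comp (fst id)) (fst (snd id)))
      (subst (h1.comp (fst id)) (h2.comp (fst id)) (snd (snd id))))
  have := list_cases (f := fun x : Equations × Bool => x.1) (fst id) id
    (ite (beq h1 h2) (pair (snd (snd id)) (snd (fst id)))
      (ite (beq h1 (neg h2)) (pair (snd (snd id)) (const false)) (pair h3 (snd (fst id)))))
  refine (congrArg PolyTime (funext fun x => ?_)).mp this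
  obtain ⟨_ | ⟨e, E⟩, b⟩ := x
  · rfl
  · simp only [decide_eq_true_eq, Equations.elim]

end PolyTime

namespace Equations

/-- A bound for the sizes of the names of the variables. -/
def Bounded (K : ℕ) (E : Equations) : Prop := ∀ e ∈ E, e.1.2.size ≤ K ∧ e.2.2.size ≤ K

lemma bounded_elim {K : ℕ} {x : Equations × Bool} (h : Bounded K x.1) : Bounded K (elim x).1 := by
  obtain ⟨_ | ⟨e, E⟩, b⟩ := x
  · exact h
  have hE : Bounded K E := fun d hd => h d (List.mem_cons_of_mem _ hd)
  have he := h e List.mem_cons_self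
  have key : ∀ l : RawLit, l.2.size ≤ K → (RawLit.subst e.1 e.2 l).2.size ≤ K := by
    intro l hl
    rw [RawLit.subst]
    split_ifs
    · exact he.2
    · exact he.2
    · exact hl
  simp only [elim]
  split_ifs
  · exact hE
  · exact hE
  · intro d' hd'
    obtain ⟨d, hd, rfl⟩ := List.mem_map.1 hd'
    exact ⟨key _ (hE d hd).1, key _ (hE d hd).2⟩

lemma size_enc_lit_le (l : RawLit) : (enc l).size ≤ l.2.size + 4 := by
  have := Val.size_ofBool_le l.1
  simp only [enc_pair, enc_bool, enc_val, Val.size]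
  omega

lemma size_enc_le_of_bounded {K : ℕ} {E : Equations} (h : Bounded K E) :
    (enc E).size ≤ E.length * (2 * K + 10) + 1 := by
  refine _root_.size_enc_le E (2 * K + 9) fun e he => ?_
  have h1 := size_enc_lit_le e.1
  have h2 := size_enc_lit_le e.2
  have h3 := h e he
  rw [enc_pair]
  simp only [Val.size]
  omega

lemma bounded_size_enc (E : Equations) : Bounded (enc E).size E := by
  intro e he
  have := size_enc_mem he
  simp only [enc_pair e, enc_pair e.1, enc_pair e.2, enc_val, Val.size] at this
  omega

end Equations

namespace PolyTime

variable {α : Type*} [Enc α]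

/-- Elimination adds neither equations nor names of variables, so all intermediate systems have size
at most quadratic in the size of `E`. -/
lemma consistent : PolyTime Equations.consistent := by
  refine snd (foldl (f := fun E : Equations => E) (g := fun E : Equations => (E, true))
    (h := fun z => Equations.elim z.2.1) id (pair id (const true)) (elim.comp (fst (snd id))) ?_)
  refine ⟨Polynomial.X * (2 * Polynomial.X + 10) + 5, fun E l l' _ => ?_⟩
  have key : ∀ (l : Equations) (x : Equations × Bool), Equations.Bounded (enc E).size x.1 →
      x.1.length ≤ E.length →
      Equations.Bounded (enc E).size (l.foldl (fun x _ => Equations.elim x) x).1 ∧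
      (l.foldl (fun x _ => Equations.elim x) x).1.length ≤ E.length := by
    intro l
    induction l with
    | nil => exact fun x h1 h2 => ⟨h1, h2⟩
    | cons e l ih =>
      intro x h1 h2
      refine ih _ (Equations.bounded_elim h1) ?_
      rw [Equations.length_elim]
      omega
  obtain ⟨h1, h2⟩ := key l (E, true) (Equations.bounded_size_enc E) le_rfl
  have h3 := Equations.size_enc_le_of_bounded h1
  have h4 := length_lt_size_enc E
  have h5 := Val.size_ofBool_le (l.foldl (fun x _ => Equations.elim x) (E, true)).2
  rw [enc_pair, enc_bool]
  simp only [Val.size, Polynomial.eval_add, Polynomial.eval_mul, Polynomial.eval_X,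
    Polynomial.eval_ofNat]
  have h6 := Nat.mul_le_mul_right (2 * (enc E).size + 10) (h2.trans h4.le)
  omega

lemma pickEqs {f : α → RawLit} {g : α → List RawLit} (hf : PolyTime f) (hg : PolyTime g) :
    PolyTime (fun a => _root_.pickEqs (f a) (g a)) :=
  cons (pair hf (const _)) (map hg (h := fun x => (x.2, RawLit.neg RawLit.top))
    (pair (snd id) (const _)))

lemma searchStep : PolyTime _root_.searchStep := by
  let β := List Node × Bool
  let γ := β × Node × List Node
  have hE : PolyTime fun z : γ => z.2.1.1 := fst (fst (snd id))
  have hC : PolyTime fun z : γ => z.2.1.2 := snd (fst (snd id))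
  have hL : PolyTime fun z : γ => z.2.2 := snd (snd id)
  let δ := γ × List RawLit × List (List RawLit)
  let ε := δ × RawLit × List RawLit
  have h1 : PolyTime fun z : ε => (_root_.pickEqs z.2.1 z.2.2 ++ z.1.1.2.1.1, z.1.2.2) :=
    pair (append (pickEqs (fst (snd id)) (snd (snd id))) (hE.comp (fst (fst id))))
      (snd (snd (fst id)))
  have h2 : PolyTime fun z : ε =>
      ((z.2.1, RawLit.neg RawLit.top) :: z.1.1.2.1.1, z.2.2 :: z.1.2.2) :=
    pair (cons (pair (fst (snd id)) (const _)) (hE.comp (fst (fst id))))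
      (cons (snd (snd id)) (snd (snd (fst id))))
  have h3 := list_cases (f := fun z : δ => z.2.1) (g := fun z : δ => (z.1.2.2, false))
    (fst (snd id)) (pair (hL.comp (fst id)) (const false))
    (pair (cons h1 (cons h2 (hL.comp (fst (fst id))))) (const false))
  have h4 := list_cases (f := fun z : γ => z.2.1.2) (g := fun _ : γ => (([] : List Node), true))
    hC (const _) h3
  refine (congrArg PolyTime (funext fun x => ?_)).mp
    (list_cases (f := fun x : β => x.1) (fst id) id
      (ite (consistent.comp hE) h4 (pair hL (const false))))
  obtain ⟨_ | ⟨⟨E, _ | ⟨_ | ⟨a, l⟩, C⟩⟩, L⟩, b⟩ := x <;> rfl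

lemma pairEqs {f g : α → List RawLit} (hf : PolyTime f) (hg : PolyTime g) :
    PolyTime (fun a => _root_.pairEqs (f a) (g a)) := by
  have h1 : PolyTime fun a => (f a).filter fun l => decide (RawLit.neg l ∈ g a) :=
    filter (h := fun x : α × RawLit => decide (RawLit.neg x.2 ∈ g x.1)) hf (by
      convert mem (hg.comp (fst id)) (neg (snd id)))
  let γ := α × RawLit × List RawLit
  let δ := γ × RawLit × List RawLit
  have h2 : PolyTime fun z : δ => (f z.1.1).filter fun l =>
      !(decide (l = z.1.2.1) || decide (l = z.2.1)) := by
    have h3 : PolyTime fun x : δ × RawLit => decide (x.2 = x.1.1.2.1) :=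
      beq (snd id) (fst (snd (fst (fst id))))
    have h4 : PolyTime fun x : δ × RawLit => decide (x.2 = x.1.2.1) :=
      beq (snd id) (fst (snd (fst id)))
    refine filter (h := fun x : δ × RawLit => !(decide (x.2 = x.1.1.2.1) || decide (x.2 = x.1.2.1)))
      (hf.comp (fst (fst id))) (not ?_)
    convert ite h3 (const true) h4 using 2 with x
    cases decide (x.2 = x.1.1.2.1) <;> simp
  have h5 := list_cases (f := fun z : γ => z.2.2) (g := fun _ => []) (snd (snd id))
    (const ([] : Equations)) (cons (pair (fst (snd (fst id))) (neg (fst (snd id))))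
      (map h2 (h := fun x => (x.2, RawLit.neg RawLit.top)) (pair (snd id) (const _))))
  refine (congrArg PolyTime (funext fun x => ?_)).mp (list_cases h1 (const ([] : Equations)) h5)
  rw [_root_.pairEqs]
  split
  · rename_i h
    rw [h]
  · rename_i x l h
    rw [h]
    obtain _ | ⟨y, l'⟩ := l <;> rfl

lemma mateEqs {f : α → List (List RawLit)} {g : α → List RawLit} (hf : PolyTime f)
    (hg : PolyTime g) : PolyTime (fun a => _root_.mateEqs (f a) (g a)) :=
  flatMap hf (h := fun x : α × List RawLit => _root_.pairEqs (g x.1) x.2)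
    (pairEqs (hg.comp (fst id)) (snd id))

lemma initNode : PolyTime _root_.initNode := by
  have h : PolyTime fun x : List (List RawLit) × List RawLit => _root_.mateEqs x.1 x.2 :=
    mateEqs (fst id) (snd id)
  exact pair (flatMap id h) (filter id (beq h (const [])))

end PolyTime

namespace Node

/-- `total` is never increased by branching: every new equation is paid for by a literal that
disappears from the clauses. -/
structure Bounded (K n : ℕ) (s : Node) : Prop where
  eqs : s.1.Bounded K
  clauses : ∀ c ∈ s.2, ∀ l ∈ c, l.2.size ≤ K
  total : s.1.length + measure s.2 ≤ n

lemma measure_le_size_enc (C : List (List RawLit)) : measure C ≤ (enc C).size := by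
  induction C with
  | nil => simp [measure]
  | cons c C ih =>
    have := length_lt_size_enc c
    rw [measure_cons, enc_cons]
    simp only [Val.size]
    omega

lemma length_le_measure {C : List (List RawLit)} :
    C.length ≤ measure C ∧ ∀ c ∈ C, c.length ≤ measure C := by
  induction C with
  | nil => simp [measure]
  | cons c C ih =>
    simp only [measure_cons, List.forall_mem_cons, List.length_cons]
    refine ⟨by omega, by omega, fun d hd => ?_⟩
    have := ih.2 d hd
    omega

lemma bounded_size_enc (s : Node) : s.Bounded (enc s).size (enc s).size := by
  obtain ⟨E, C⟩ := s
  have h1 := length_lt_size_enc E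
  have h2 := measure_le_size_enc C
  have h0 : (enc (E, C)).size = 1 + (enc E).size + (enc C).size := rfl
  refine ⟨fun e he => ?_, fun c hc l hl => ?_, ?_⟩
  · have := Equations.bounded_size_enc E e he
    omega
  · have h3 := size_enc_mem hc
    have h4 := size_enc_mem hl
    simp only [enc_pair l, enc_val, Val.size] at h4
    have h5 : (enc (E, C).2).size = (enc C).size := rfl
    omega
  · simp only
    omega

lemma size_enc_le {K n : ℕ} {s : Node} (h : s.Bounded K n) :
    (enc s).size ≤ n * (2 * K + 10) + n * (n * (K + 5) + 2) + 3 := by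
  obtain ⟨E, C⟩ := s
  obtain ⟨h1, h2, h3⟩ := h
  simp only at h1 h2 h3
  have h4 := Equations.size_enc_le_of_bounded h1
  have h5 := length_le_measure (C := C)
  have h6 : (enc C).size ≤ C.length * (n * (K + 5) + 1 + 1) + 1 := by
    refine _root_.size_enc_le C _ fun c hc => ?_
    refine (_root_.size_enc_le c (K + 4) fun l hl => ?_).trans ?_
    · have := Equations.size_enc_lit_le l
      have := h2 c hc l hl
      omega
    · have := h5.2 c hc
      gcongr
      omega
  have h7 : E.length * (2 * K + 10) ≤ n * (2 * K + 10) := Nat.mul_le_mul_right _ (by omega)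
  have h8 : C.length * (n * (K + 5) + 1 + 1) ≤ n * (n * (K + 5) + 2) :=
    Nat.mul_le_mul_right _ (by omega)
  rw [enc_pair]
  simp only [Val.size]
  omega

end Node

/-- An invariant of the search that bounds the size of the stack. -/
structure StackBounded (K n : ℕ) (L : List Node) : Prop where
  nodes : ∀ s ∈ L, s.Bounded K n
  sorted : L.Pairwise fun s d => Node.measure s.2 < Node.measure d.2

namespace StackBounded

/-- Along the stack the measures are distinct numbers between 0 and `n`. -/
lemma length_le {K n : ℕ} {L : List Node} (h : StackBounded K n L) : L.length ≤ n + 1 := by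
  have h1 : (L.map fun s => Node.measure s.2).Nodup :=
    List.pairwise_map.2 (h.sorted.imp fun h => h.ne)
  have h2 : (L.map fun s => Node.measure s.2) ⊆ List.range (n + 1) := by
    intro x hx
    obtain ⟨s, hs, rfl⟩ := List.mem_map.1 hx
    have := (h.nodes s hs).total
    simp only [List.mem_range]
    omega
  simpa using (h1.subperm h2).length_le

/-- The first child loses a whole clause and the second one only a literal. So the measures of the
two children increase in this order, and both stay below the measure of the parent, which was below
those of all other open nodes. -/
lemma step {K n : ℕ} (hK : RawLit.top.2.size ≤ K) {x : List Node × Bool} (h : StackBounded K n x.1) :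
    StackBounded K n (searchStep x).1 := by
  obtain ⟨_ | ⟨⟨E, C⟩, L⟩, b⟩ := x
  · exact h
  have hL : StackBounded K n L :=
    ⟨fun s hs => h.nodes s (List.mem_cons_of_mem _ hs), h.sorted.of_cons⟩
  have hs := h.nodes (E, C) List.mem_cons_self
  have hd : ∀ d ∈ L, Node.measure C < Node.measure d.2 := fun d hd =>
    List.rel_of_pairwise_cons h.sorted hd
  simp only [searchStep]
  split_ifs
  · rcases C with _ | ⟨_ | ⟨a, l⟩, C⟩
    · exact ⟨by simp, List.Pairwise.nil⟩
    · exact hL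
    · obtain ⟨h1, h2, h3⟩ := hs
      simp only [List.forall_mem_cons] at h1 h2
      simp only [Node.measure_cons, List.length_cons] at h3 hd
      refine ⟨?_, ?_⟩
      · simp only [List.forall_mem_cons]
        refine ⟨⟨?_, h2.2, ?_⟩, ⟨?_, ?_, ?_⟩, hL.nodes⟩
        · intro e he
          simp only [pickEqs, List.cons_append, List.mem_cons, List.mem_append, List.mem_map] at he
          rcases he with rfl | ⟨y, hy, rfl⟩ | he
          · exact ⟨h2.1.1, hK⟩
          · exact ⟨h2.1.2 y hy, hK⟩
          · exact h1 e he
        · simp only [pickEqs, List.length_append, List.length_cons, List.length_map]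
          omega
        · intro e he
          rcases List.mem_cons.1 he with rfl | he
          · exact ⟨h2.1.1, hK⟩
          · exact h1 e he
        · simp only [List.forall_mem_cons]
          exact ⟨h2.1.2, h2.2⟩
        · simp only [List.length_cons, Node.measure_cons]
          omega
      · refine List.pairwise_cons.2 ⟨?_, List.pairwise_cons.2 ⟨?_, hL.sorted⟩⟩
        · intro s hs
          rcases List.mem_cons.1 hs with rfl | hs
          · simp only [Node.measure_cons]
            omega
          · have := hd s hs
            simp only
            omega
        · intro s hs
          have := hd s hs
          simp only [Node.measure_cons]
          omega
  · exact hL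

lemma iterate {K n : ℕ} (hK : RawLit.top.2.size ≤ K) {x : List Node × Bool}
    (h : StackBounded K n x.1) (i : ℕ) : StackBounded K n (searchStep^[i] x).1 := by
  induction i with
  | zero => exact h
  | succ i ih =>
    rw [Function.iterate_succ_apply']
    exact ih.step hK

lemma size_enc_le {K n : ℕ} {L : List Node} (h : StackBounded K n L) :
    (enc L).size ≤ (n + 1) * (n * (2 * K + 10) + n * (n * (K + 5) + 2) + 4) + 1 := by
  refine (_root_.size_enc_le L _ fun s hs => Node.size_enc_le (h.nodes s hs)).trans ?_
  gcongr
  exact h.length_le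

end StackBounded

lemma exists_size_iterate_searchStep_le : ∃ p : Polynomial ℕ, ∀ (G : List (List RawLit)) (i : ℕ),
    (enc (searchStep^[i] ([initNode G], false))).size ≤ p.eval (enc G).size := by
  obtain ⟨r, hr⟩ := PolyTime.initNode.size_le
  -- The constant 7 is the size of the name of `top`, which may exceed all names in the input.
  let q : Polynomial ℕ := (Polynomial.X + 7 + 1) * ((Polynomial.X + 7) * (2 * (Polynomial.X + 7) + 10) +
    (Polynomial.X + 7) * ((Polynomial.X + 7) * (Polynomial.X + 7 + 5) + 2) + 4) + 5
  refine ⟨q.comp r, fun G i => ?_⟩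
  have h0 : (initNode G).Bounded ((enc (initNode G)).size + 7) ((enc (initNode G)).size + 7) := by
    obtain ⟨h1, h2, h3⟩ := Node.bounded_size_enc (initNode G)
    refine ⟨fun e he => ?_, fun c hc l hl => ?_, by omega⟩
    · have := h1 e he
      omega
    · have := h2 c hc l hl
      omega
  have h1 : StackBounded ((enc (initNode G)).size + 7) ((enc (initNode G)).size + 7)
      (searchStep^[i] ([initNode G], false)).1 :=
    StackBounded.iterate (by simp [RawLit.top, Val.size]) ⟨by simpa using h0, by simp⟩ i
  have h2 := h1.size_enc_le
  have h3 := Val.size_ofBool_le (searchStep^[i] ([initNode G], false)).2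
  have h4 : (enc (searchStep^[i] ([initNode G], false))).size ≤ q.eval (enc (initNode G)).size := by
    rw [enc_pair, enc_bool]
    simp only [q, Val.size, Polynomial.eval_add, Polynomial.eval_mul, Polynomial.eval_X,
      Polynomial.eval_ofNat, Polynomial.eval_one]
    omega
  rw [Polynomial.eval_comp]
  exact h4.trans (q.eval_mono_nat (hr G))

/-- The search as a program. -/
lemma exists_solver : ∃ (S : Cmd 2) (p : Polynomial ℕ), ∀ G : List (List RawLit), ∃ s t w,
    Exec S (Store.input 1 (enc G)) s t w ∧ (s 0 ≠ Val.nil ↔ (initNode G).Sat) ∧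
    t ≤ p.eval (enc G).size * work (initNode G).1.models (initNode G).2 ∧
    w ≤ p.eval (enc G).size := by
  classical
  have hex := fun G : List (List RawLit) => exists_iterate_searchStep [initNode G]
  choose j hj1 hj2 hj3 using hex
  have hex' : ∀ G, ∃ i, (searchStep^[i] ([initNode G], false)).1 = [] := fun G => ⟨j G, hj2 G⟩
  have hfix : ∀ G i, (searchStep^[i] ([initNode G], false)).1 = [] → ∀ k,
      searchStep^[i + k] ([initNode G], false) = searchStep^[i] ([initNode G], false) := by
    intro G i hi k
    induction k with
    | zero => rfl
    | succ k ih =>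
      rw [← Nat.add_assoc, Function.iterate_succ_apply', ih]
      simp only [searchStep, hi]
  obtain ⟨m₁, c₁, hc₁⟩ : PolyTime fun G : List (List RawLit) => ([initNode G], false) :=
    PolyTime.pair (PolyTime.cons PolyTime.initNode (PolyTime.const [])) (PolyTime.const false)
  obtain ⟨m₂, c₂, hc₂⟩ := PolyTime.searchStep
  obtain ⟨q, hq⟩ := exists_size_iterate_searchStep_le
  -- The first time at which the stack is empty. From then on `searchStep` changes nothing, so the
  -- answer is the same as at time `j G`, where it is known to be correct.
  let T := fun G => Nat.find (hex' G)
  let I : List (List RawLit) → ℕ → Store 2 → Prop := fun G i s =>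
    s 0 = enc G ∧ s 1 = enc (searchStep^[i] ([initNode G], false))
  have hloop : Triple (fun G : List (List RawLit) => (enc G).size)
      (fun G => ∑ i ∈ Finset.range (T G), ((0 : List (List RawLit) × ℕ → ℕ) (G, i) + 1))
      (fun G s => I G 0 s)
      (Cmd.while (Exp.hd (Exp.var 1)) (Cmd.call 1 c₂ (Exp.var 1))) (fun G s => I G (T G) s) := by
    refine Triple.while_loop (M' := 0) (T := T) (Triple.call hc₂ ?_) ?_ ?_ ?_
    · rintro ⟨G, i⟩ s ⟨⟨h1, h2⟩, -⟩
      refine ⟨_, h2, ?_, ?_⟩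
      · simpa using h1
      · simp [Function.iterate_succ_apply']
    · rintro G i s hi ⟨h1, h2⟩ h3
      simp only [Exp.eval, h2, enc_pair, Val.head] at h3
      exact Nat.find_min (hex' G) hi (enc_list_eq_nil.1 h3)
    · rintro G s ⟨h1, h2⟩
      simp only [Exp.eval, h2, enc_pair, Val.head]
      exact enc_list_eq_nil.2 (Nat.find_spec (hex' G))
    · refine ⟨Polynomial.X + q, ?_⟩
      rintro G i s hi ⟨h1, h2⟩
      simp only [Store.size, Fin.sum_univ_two, h1, h2, Polynomial.eval_add, Polynomial.eval_X]
      have := hq G i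
      omega
  have htriple : Triple (fun G : List (List RawLit) => (enc G).size) (fun G => T G)
      (fun G s => s = Store.input 1 (enc G))
      (Cmd.call 1 c₁ (Exp.var 0) ;; Cmd.while (Exp.hd (Exp.var 1)) (Cmd.call 1 c₂ (Exp.var 1)) ;;
        0 ::= Exp.tl (Exp.var 1))
      (fun G s => s 0 ≠ Val.nil ↔ (initNode G).Sat) := by
    refine Triple.seq (Q := fun G s => I G 0 s) (Triple.call hc₁ ?_)
      (Triple.seq (Q := fun G s => I G (T G) s) (hloop.weaken 1 ?_) (Triple.assign ?_))
    · rintro G s rfl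
      refine ⟨G, by simp [Exp.eval, Store.input_zero], ?_, ?_⟩
      · simp [Store.input_zero]
      · simp
    · intro G s _
      simp
    · rintro G s ⟨h1, h2⟩
      have h3 : searchStep^[j G] ([initNode G], false) = searchStep^[T G] ([initNode G], false) := by
        obtain ⟨k, hk⟩ := Nat.exists_eq_add_of_le (Nat.find_min' (hex' G) (hj2 G))
        rw [hk]
        exact hfix G _ (Nat.find_spec (hex' G)) k
      have h4 := hj3 G
      rw [h3] at h4
      simp only [Exp.eval, h2, enc_pair, Val.tail, Function.update_self, enc_bool, ne_eq,
        ofBool_eq_nil, Bool.not_eq_false, h4, List.mem_singleton, exists_eq_left]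
  obtain ⟨p, hp⟩ := htriple (Polynomial.X + Polynomial.C 2)
  refine ⟨Cmd.call 1 c₁ (Exp.var 0) ;; Cmd.while (Exp.hd (Exp.var 1)) (Cmd.call 1 c₂ (Exp.var 1)) ;;
    0 ::= Exp.tl (Exp.var 1), 2 * p, fun G => ?_⟩
  obtain ⟨s, t, w, h1, h2, h3, h4⟩ := hp G _ rfl (by
    have := Store.size_input_le 1 (enc G); simp; omega)
  refine ⟨s, t, w, h1, h2, h3.trans ?_, h4.trans ?_⟩
  · have h5 : T G ≤ work (initNode G).1.models (initNode G).2 := by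
      refine (Nat.find_min' (hex' G) (hj2 G)).trans ((hj1 G).trans ?_)
      simp [stackWork]
    have h6 := one_le_work (initNode G).1.models (initNode G).2
    simp only [Polynomial.eval_mul, Polynomial.eval_ofNat]
    nlinarith [Nat.zero_le (p.eval (enc G).size)]
  · simp only [Polynomial.eval_mul, Polynomial.eval_ofNat]
    omega

/-! ## The size of the search tree -/

lemma work_empty (C : List (List RawLit)) : work ∅ C = 1 := by
  rcases C with _ | ⟨_ | ⟨a, l⟩, C⟩ <;> simp [work]

lemma work_cons {M : Set (Val → Bool)} (hM : M.Nonempty) (a : RawLit) (l : List RawLit)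
    (C : List (List RawLit)) : work M ((a :: l) :: C) =
      1 + work (M ∩ {v | holds v a = true ∧ ∀ x ∈ l, holds v x = false}) C +
        work (M ∩ {v | holds v a = false}) (l :: C) := by
  rw [work, if_neg hM.ne_empty]

lemma work_mono {M M' : Set (Val → Bool)} (h : M ⊆ M') (C : List (List RawLit)) :
    work M C ≤ work M' C := by
  induction C generalizing M M' with
  | nil => simp [work]
  | cons c C ihC =>
    induction c generalizing M M' with
    | nil => simp [work]
    | cons a l ihl =>
      rcases M.eq_empty_or_nonempty with rfl | hM
      · rw [work_empty]
        exact one_le_work _ _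
      · rw [work_cons hM, work_cons (hM.mono h)]
        have h1 := ihC (Set.inter_subset_inter_left
          {v | holds v a = true ∧ ∀ x ∈ l, holds v x = false} h)
        have h2 := ihl (Set.inter_subset_inter_left {v | holds v a = false} h)
        omega

/-- A node that is consistent for `M` is consistent for `M₁` or for `M₂`. If one of these is empty,
the claim is monotonicity; if `M` is empty, it is trivial; otherwise all three trees branch at the
root and induction applies to both children. -/
lemma work_le_add {M M₁ M₂ : Set (Val → Bool)} (h : M ⊆ M₁ ∪ M₂) (C : List (List RawLit)) :
    work M C ≤ work M₁ C + work M₂ C := by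
  induction C generalizing M M₁ M₂ with
  | nil => simp [work]
  | cons c C ihC =>
    induction c generalizing M M₁ M₂ with
    | nil => simp [work]
    | cons a l ihl =>
      rcases M₁.eq_empty_or_nonempty with rfl | h₁
      · exact (work_mono (by simpa using h) _).trans (Nat.le_add_left _ _)
      rcases M₂.eq_empty_or_nonempty with rfl | h₂
      · exact (work_mono (by simpa using h) _).trans (Nat.le_add_right _ _)
      rcases M.eq_empty_or_nonempty with rfl | hM
      · rw [work_empty]
        exact (one_le_work _ _).trans (Nat.le_add_right _ _)
      rw [work_cons hM, work_cons h₁, work_cons h₂]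
      have key : ∀ s : Set (Val → Bool), M ∩ s ⊆ (M₁ ∩ s) ∪ (M₂ ∩ s) := by
        intro s
        rw [← Set.union_inter_distrib_right]
        exact Set.inter_subset_inter_left s h
      have h1 := ihC (key {v | holds v a = true ∧ ∀ x ∈ l, holds v x = false})
      have h2 := ihl (key {v | holds v a = false})
      omega

/-- A clause that is satisfied anyway does not decrease the work. -/
lemma work_le_work_cons {M : Set (Val → Bool)} {c : List RawLit} (h : ∀ v ∈ M, Exact c v)
    (C : List (List RawLit)) : work M C ≤ work M (c :: C) := by
  induction c generalizing M with
  | nil =>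
    obtain rfl : M = ∅ := Set.eq_empty_of_forall_notMem fun v hv => by simpa [Exact] using h v hv
    rw [work_empty, work_empty]
  | cons a l ih =>
    rcases M.eq_empty_or_nonempty with rfl | hM
    · rw [work_empty, work_empty]
    rw [work_cons hM]
    have h1 := ih (M := M ∩ {v | holds v a = false}) (by
      rintro v ⟨hv, hv'⟩
      rw [Set.mem_ofPred_eq] at hv'
      have := exact_cons.1 (h v hv)
      rw [hv'] at this
      simpa using this)
    have h2 : work M C ≤ _ := work_le_add (M₁ := M ∩ {v | holds v a = true ∧ ∀ x ∈ l, holds v x = false})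
      (M₂ := M ∩ {v | holds v a = false}) (by
        intro v hv
        rcases exact_cons.1 (h v hv) with h | h
        · exact Or.inl ⟨hv, h⟩
        · exact Or.inr ⟨hv, h.1⟩) C
    omega

/-- The assignments in `M` agree on the variables in `D`. -/
def Decided (M : Set (Val → Bool)) (D : Finset Val) : Prop :=
  ∀ x ∈ D, ∀ v ∈ M, ∀ v' ∈ M, v x = v' x

namespace Decided

variable {M M' : Set (Val → Bool)} {D D' : Finset Val}

lemma mono (h : Decided M D) (hM : M' ⊆ M) (hD : D' ⊆ D) : Decided M' D' :=
  fun x hx v hv v' hv' => h x (hD hx) v (hM hv) v' (hM hv')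

lemma union (h : Decided M D) (h' : Decided M D') : Decided M (D ∪ D') :=
  fun x hx => (Finset.mem_union.1 hx).elim (h x) (h' x)

lemma of_holds {b : RawLit → Bool} {c : List RawLit} (h : ∀ v ∈ M, ∀ l ∈ c, holds v l = b l) :
    Decided M (c.map Prod.snd).toFinset := by
  intro x hx v hv v' hv'
  obtain ⟨l, hl, rfl⟩ := List.mem_map.1 (List.mem_toFinset.1 hx)
  have h1 := (h v hv l hl).trans (h v' hv' l hl).symm
  simp only [holds] at h1
  revert h1
  cases v l.2 <;> cases v' l.2 <;> cases l.1 <;> simp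

end Decided

/-- `Q` bounds the work that remains once all variables of `c` are decided. A literal over a decided
variable has the same value in all of `M`, so one of its two branches has no models. A literal over
a new variable costs one copy of `Q` and is decided from then on. The extra copy of `Q` pays for a
decided literal that is true, after which the clause is finished. The term `2 * c.length + 1` counts
the nodes along the clause and the branches without models. -/
lemma work_cons_le {M : Set (Val → Bool)} {D : Finset Val} (hD : Decided M D) (c : List RawLit)
    {C : List (List RawLit)} {Q : ℕ}
    (hQ : ∀ M' ⊆ M, Decided M' (D ∪ (c.map Prod.snd).toFinset) → work M' C ≤ Q) :
    work M (c :: C) ≤ 2 * c.length + 1 + (((c.map Prod.snd).toFinset \ D).card + 1) * Q := by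
  induction c generalizing M D with
  | nil =>
    simp only [work, List.length_nil]
    omega
  | cons a l ih =>
    rcases M.eq_empty_or_nonempty with rfl | hM
    · rw [work_empty]
      omega
    rw [work_cons hM, List.length_cons]
    set A := M ∩ {v | holds v a = true ∧ ∀ x ∈ l, holds v x = false} with hA
    set B := M ∩ {v | holds v a = false} with hB
    have hAM : A ⊆ M := Set.inter_subset_left
    have hBM : B ⊆ M := Set.inter_subset_left
    have hB' : Decided B {a.2} := by
      have : Decided B ([a].map Prod.snd).toFinset := by
        refine Decided.of_holds (b := fun _ => false) ?_
        rintro v ⟨-, hv⟩ x hx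
        rw [List.mem_singleton.1 hx]
        exact hv
      simpa using this
    have h1 : work A C ≤ Q := by
      refine hQ A hAM ((hD.mono hAM subset_rfl).union ?_)
      have h2 : Decided A ([a].map Prod.snd).toFinset := by
        refine Decided.of_holds (b := fun _ => true) ?_
        rintro v ⟨-, hv⟩ x hx
        rw [List.mem_singleton.1 hx]
        exact hv.1
      have h3 : Decided A (l.map Prod.snd).toFinset := by
        refine Decided.of_holds (b := fun _ => false) ?_
        rintro v ⟨-, hv⟩ x hx
        exact hv.2 x hx
      refine (h2.union h3).mono subset_rfl ?_
      intro x hx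
      simpa using hx
    by_cases ha : a.2 ∈ D
    · have hsub : ((l.map Prod.snd).toFinset \ D).card ≤ (((a :: l).map Prod.snd).toFinset \ D).card :=
        Finset.card_le_card (Finset.sdiff_subset_sdiff (by simp) subset_rfl)
      have h4 := Nat.mul_le_mul_right Q (Nat.add_le_add_right hsub 1)
      rcases B.eq_empty_or_nonempty with h2 | ⟨v, hvM, hv⟩
      · rw [h2, work_empty]
        have : Q ≤ (((l.map Prod.snd).toFinset \ D).card + 1) * Q :=
          Nat.le_mul_of_pos_left _ (Nat.succ_pos _)
        omega
      · have h2 : A = ∅ := by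
          refine Set.eq_empty_of_forall_notMem fun v' hv' => ?_
          have h3 := hD _ ha v hvM v' hv'.1
          have h4 := hv'.2.1
          rw [Set.mem_ofPred_eq] at hv
          simp only [holds] at hv h4
          rw [h3, h4] at hv
          exact absurd hv (by simp)
        rw [h2, work_empty]
        have h3 := ih (hD.mono hBM subset_rfl) (fun M' hM' hd => hQ M' (hM'.trans hBM) (hd.mono subset_rfl (by
          intro x hx
          simp only [List.map_cons, List.toFinset_cons, Finset.mem_union, Finset.mem_insert] at hx ⊢
          rcases hx with h | rfl | h
          · exact Or.inl h
          · exact Or.inl ha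
          · exact Or.inr h)))
        omega
    · have hd := (hD.mono hBM subset_rfl).union hB'
      have h3 := ih hd (fun M' hM' hd => hQ M' (hM'.trans hBM) (hd.mono subset_rfl (by
        intro x hx
        simp only [List.map_cons, List.toFinset_cons, Finset.mem_union, Finset.mem_insert,
          Finset.mem_singleton] at hx ⊢
        tauto)))
      have h4 : (((a :: l).map Prod.snd).toFinset \ D).card =
          ((l.map Prod.snd).toFinset \ (D ∪ {a.2})).card + 1 := by
        rw [← Finset.card_insert_of_notMem (a := a.2) (by simp)]
        congr 1
        ext x
        simp only [List.map_cons, List.toFinset_cons, Finset.mem_sdiff, Finset.mem_insert,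
          Finset.mem_union, Finset.mem_singleton]
        by_cases hx : x = a.2
        · simp [hx, ha]
        · simp [hx]
      rw [h4]
      rw [add_mul _ 1 Q]
      omega

/-! ### Search trees for the clauses of a formula relative to a set `X` -/

namespace Formula

lemma toFinset_raw (c : Clause) :
    ((Clause.raw c).map Prod.snd).toFinset = (clauseVars c).image Val.ofNat := by
  ext x
  simp [Clause.raw, Literal.raw, clauseVars]

lemma one_le_weight {φ : ℕ → ℕ} (h1 : ∀ r, 1 ≤ φ r) (X D : Finset ℕ) (F : Formula) :
    1 ≤ weight φ X D F := by
  induction F generalizing D with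
  | nil => exact le_rfl
  | cons c F ih =>
    rw [weight]
    refine Nat.mul_pos ?_ (ih _)
    split_ifs
    · exact Nat.one_pos
    · exact h1 _

/-- Touched clauses are filtered out, and their variables outside `X` are decided by the equations.
An untouched clause contains no variable of `X`, so its variables outside `D \ X` are those outside
`D`, as counted by `weight`. An untouched clause may have been filtered out as well, if it happens
to have a mate; then all models satisfy it, and by `work_le_work_cons` putting it back does not
decrease the work. -/
lemma work_filter_le (X : Finset ℕ) (keep : Clause → Bool) (F : Formula) (D : Finset ℕ)
    (M : Set (Val → Bool)) (hD : Decided M ((D \ X).image Val.ofNat))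
    (ht : ∀ c ∈ F, Touched X c → keep c = false ∧ Decided M ((clauseVars c \ X).image Val.ofNat))
    (hu : ∀ c ∈ F, keep c = false → ∀ v ∈ M, Exact (Clause.raw c) v) :
    work M ((F.filter keep).map Clause.raw) ≤
      ((F.map fun c => 2 * c.length + 1).sum + 1) * weight (fun r => r + 1) X D F := by
  induction F generalizing D M with
  | nil => simp [work, weight]
  | cons c F ih =>
    simp only [List.forall_mem_cons] at ht hu
    have hunion : (D ∪ clauseVars c) \ X = (D \ X) ∪ (clauseVars c \ X) :=
      Finset.union_sdiff_distrib _ _ _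
    rw [List.map_cons, List.sum_cons, weight]
    by_cases hc : Touched X c
    · obtain ⟨h1, h2⟩ := ht.1 hc
      rw [if_pos hc, List.filter_cons_of_neg (by simp [h1]), one_mul]
      refine (ih (D ∪ clauseVars c) M ?_ ht.2 hu.2).trans (Nat.mul_le_mul_right _ (by omega))
      rw [hunion, Finset.image_union]
      exact hD.union h2
    · rw [if_neg hc]
      have hdisj : ∀ x ∈ clauseVars c, x ∉ X := by
        intro x hx hxX
        obtain ⟨l, hl, rfl⟩ := mem_clauseVars.1 hx
        exact hc ⟨l, hl, hxX⟩
      have h1 : work M (((c :: F).filter keep).map Clause.raw) ≤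
          work M (Clause.raw c :: (F.filter keep).map Clause.raw) := by
        cases hk : keep c
        · rw [List.filter_cons_of_neg (by simp [hk])]
          exact work_le_work_cons (hu.1 hk) _
        · rw [List.filter_cons_of_pos hk, List.map_cons]
      have h2 := work_cons_le hD (Clause.raw c) (C := (F.filter keep).map Clause.raw)
        (Q := ((F.map fun c => 2 * c.length + 1).sum + 1) *
          weight (fun r => r + 1) X (D ∪ clauseVars c) F) (by
          intro M' hM' hd
          refine ih _ _ (hd.mono subset_rfl ?_) (fun d hd hX =>
            ⟨(ht.2 d hd hX).1, (ht.2 d hd hX).2.mono hM' subset_rfl⟩)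
            (fun d hd hk v hv => hu.2 d hd hk v (hM' hv))
          rw [hunion, Finset.image_union, toFinset_raw]
          exact Finset.union_subset_union_right (Finset.image_subset_image Finset.sdiff_subset))
      have h3 : (((Clause.raw c).map Prod.snd).toFinset \ (D \ X).image Val.ofNat).card =
          (clauseVars c \ D).card := by
        rw [toFinset_raw, ← Finset.image_sdiff _ _ Val.ofNat_injective,
          Finset.card_image_of_injective _ Val.ofNat_injective]
        congr 1
        ext x
        simp only [Finset.mem_sdiff]
        have := hdisj x
        tauto
      rw [h3] at h2
      refine (h1.trans h2).trans ?_
      have h4 := one_le_weight (φ := fun r => r + 1) (fun r => Nat.succ_pos r) X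
        (D ∪ clauseVars c) F
      have h5 : (Clause.raw c).length = c.length := by simp [Clause.raw]
      rw [h5]
      generalize weight (fun r => r + 1) X (D ∪ clauseVars c) F = W at h4 ⊢
      have h6 := Nat.le_mul_of_pos_right (2 * c.length + 1)
        (Nat.mul_pos (Nat.succ_pos (clauseVars c \ D).card) h4)
      calc _ ≤ (2 * c.length + 1) * (((clauseVars c \ D).card + 1) * W) +
            ((clauseVars c \ D).card + 1) * (((F.map fun c => 2 * c.length + 1).sum + 1) * W) :=
              Nat.add_le_add_right h6 _
        _ = _ := by ring

end Formula

/-! ### Correctness of the solver on formulas, and its work on the formulas built by `P` -/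

namespace Formula

lemma exact_raw (v : Val → Bool) (c : Clause) :
    Exact (Clause.raw c) v ↔ c.countP (Literal.holds fun n => v (Val.ofNat n)) = 1 := by
  rw [Exact, Clause.raw, List.countP_map]
  rfl

lemma xSatisfiable_iff (F : Formula) : F.XSatisfiable ↔ ∃ v, ∀ c ∈ F.raw, Exact c v := by
  simp only [XSatisfiable, IsXModel, raw, List.forall_mem_map, exact_raw]
  constructor
  · rintro ⟨v, hv⟩
    refine ⟨fun x => v (Function.invFun Val.ofNat x), ?_⟩
    simpa only [Function.leftInverse_invFun Val.ofNat_injective _] using hv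
  · rintro ⟨v, hv⟩
    exact ⟨_, hv⟩

lemma nodup_raw {c : Clause} (hc : (c.map Literal.var).Nodup) : (Clause.raw c).Nodup := by
  refine List.Nodup.of_map Prod.snd ?_
  rw [Clause.raw, List.map_map]
  have := hc.map Val.ofNat_injective
  rwa [List.map_map] at this

lemma WellFormed.nodup_raw {F : Formula} (hF : F.WellFormed) : ∀ c ∈ F.raw, c.Nodup := by
  simp only [raw, List.forall_mem_map]
  exact fun c hc => Formula.nodup_raw (hF c hc)

/-- A binary numeral is a list with entries `nil` and `cons nil nil`; the first entry in the name of
`top` is neither. -/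
lemma ofNat_ne_top (n : ℕ) : Val.ofNat n ≠ top.2 := by
  rw [Val.ofNat]
  rcases n.bits with _ | ⟨_ | _, l⟩ <;> simp [Val.ofList, Val.ofBool, top]

lemma sat_initNode_raw {F : Formula} (hF : F.WellFormed) :
    (initNode F.raw).Sat ↔ F.XSatisfiable := by
  rw [xSatisfiable_iff, sat_initNode hF.nodup_raw]
  simp only [raw, Clause.raw, List.forall_mem_map]
  exact fun c _ l _ => ofNat_ne_top l.var

lemma flipClause_flipClause (X : Finset ℕ) (c : Clause) : flipClause X (flipClause X c) = c := by
  rw [flipClause, flipClause, List.map_reverse, List.reverse_reverse, List.map_map]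
  conv_rhs => rw [← List.map_id c]
  refine List.map_congr_left fun l _ => ?_
  simp only [Function.comp]
  split_ifs <;> simp_all

/-- As the variables of `c` are distinct, the only literal of the flipped clause over the variable
of `l` is the image of `l` itself. -/
lemma neg_mem_flipClause {c : Clause} (hc : (c.map Literal.var).Nodup) (X : Finset ℕ) {l : Literal}
    (hl : l ∈ c) : neg l.raw ∈ Clause.raw (flipClause X c) ↔ l.var ∈ X := by
  simp only [Clause.raw, flipClause, List.map_reverse, List.mem_reverse, List.map_map, List.mem_map,
    Function.comp]
  constructor
  · rintro ⟨l', hl', h⟩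
    have h1 : l'.var = l.var := by
      refine Val.ofNat_injective (Eq.trans ?_ (congrArg Prod.snd h))
      split_ifs <;> rfl
    obtain rfl := List.inj_on_of_nodup_map hc hl' hl h1
    by_contra hX
    rw [if_neg hX] at h
    exact neg_ne _ h.symm
  · intro hX
    exact ⟨l, hl, by rw [if_pos hX]; rfl⟩

lemma pairEqs_flipClause_ne_nil {c : Clause} (hc : (c.map Literal.var).Nodup) {X : Finset ℕ}
    (hX : c.countP (fun l => l.var ∈ X) = 2) :
    pairEqs (Clause.raw c) (Clause.raw (flipClause X c)) ≠ [] := by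
  have key := fun l (hl : l ∈ c) => neg_mem_flipClause hc X hl
  have h : ((Clause.raw c).filter fun l => neg l ∈ Clause.raw (flipClause X c)).length = 2 := by
    rw [← List.countP_eq_length_filter, ← hX]
    generalize Clause.raw (flipClause X c) = d at key ⊢
    rw [Clause.raw, List.countP_map]
    refine List.countP_congr fun l hl => ?_
    simp only [Function.comp, decide_eq_true_eq]
    exact key l hl
  rw [pairEqs]
  split
  · rename_i h'
    simp [h'] at h
  · rename_i x l h'
    rw [h'] at h
    obtain _ | ⟨y, l⟩ := l
    · simp at h
    · simp

/-- The two literals that are equated up to negation occur negated in the copy, so they are derived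
from `X`. All other literals of `c`, in particular those over variables outside `X`, are made false.
-/
lemma decided_pairEqs {c : Clause} (hc : (c.map Literal.var).Nodup) {X : Finset ℕ}
    (hX : c.countP (fun l => l.var ∈ X) = 2) :
    Decided (pairEqs (Clause.raw c) (Clause.raw (flipClause X c))).models
      ((clauseVars c \ X).image Val.ofNat) := by
  obtain h | ⟨x, y, r, h1, hx, hy, h2⟩ :=
    pairEqs_cases (Clause.raw c) (Clause.raw (flipClause X c)) (nodup_raw hc)
  · exact absurd h (pairEqs_flipClause_ne_nil hc hX)
  rw [h2]
  refine Decided.mono (Decided.of_holds (b := fun _ => false) (c := r) ?_) subset_rfl ?_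
  · rintro v ⟨hv, h⟩ l hl
    rw [h (l, neg top) (List.mem_cons_of_mem _ (List.mem_map_of_mem hl)), holds_neg, hv]
    rfl
  · intro z' hz'
    obtain ⟨z, hz, rfl⟩ := Finset.mem_image.1 hz'
    obtain ⟨hzc, hzX⟩ := Finset.mem_sdiff.1 hz
    obtain ⟨l, hl, rfl⟩ := mem_clauseVars.1 hzc
    have h3 := h1.mem_iff.1 (List.mem_map_of_mem (f := Literal.raw) hl)
    have h4 := mt (neg_mem_flipClause hc X hl).1 hzX
    rw [List.mem_cons, List.mem_cons] at h3
    rcases h3 with rfl | rfl | h3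
    · exact absurd hx h4
    · exact absurd hy h4
    · exact List.mem_toFinset.2 (List.mem_map_of_mem (f := Prod.snd) h3)

/-- The work on the formula that the algorithm `P` passes to the solver. -/
lemma work_flips_append_le {F : Formula} (hF : F.WellFormed) {X : Finset ℕ} (hX : F.Good X) :
    work (initNode (raw (flips F X ++ F))).1.models (initNode (raw (flips F X ++ F))).2 ≤
      ((F.map fun c => 2 * c.length + 1).sum + 1) * weight (fun r => r + 1) X ∅ F := by
  set G := flips F X ++ F with hG
  have hGF : WellFormed G := hF.flips_append X
  have hflip : ∀ c ∈ F, Touched X c → flipClause X c ∈ G := by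
    intro c hc hcX
    refine List.mem_append_left _ ?_
    rw [flips, List.mem_reverse]
    exact List.mem_map_of_mem (List.mem_filter.2 ⟨hc, by simpa using hcX⟩)
  have hmemF : ∀ c ∈ F, c ∈ G := fun c hc => List.mem_append_right _ hc
  have htwo : ∀ c ∈ F, Touched X c → c.countP (fun l => l.var ∈ X) = 2 := fun c hc hcX =>
    (hX c hc).resolve_left ((touched_iff X c).1 hcX)
  have hmate : ∀ c ∈ F, Touched X c → mateEqs G.raw (Clause.raw c) ≠ [] := by
    intro c hc hcX h
    rw [mateEqs, List.flatMap_eq_nil_iff] at h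
    exact pairEqs_flipClause_ne_nil (hF c hc) (htwo c hc hcX)
      (h _ (List.mem_map_of_mem (hflip c hc hcX)))
  -- Flipping is an involution, so each copy has the original clause as its mate and is removed too.
  -- Hence only clauses of `F` are left for branching.
  have hmate' : ∀ c ∈ F, Touched X c → mateEqs G.raw (Clause.raw (flipClause X c)) ≠ [] := by
    intro c hc hcX h
    rw [mateEqs, List.flatMap_eq_nil_iff] at h
    have h1 : ((flipClause X c).map Literal.var).Nodup := hGF _ (hflip c hc hcX)
    have h2 : (flipClause X c).countP (fun l => l.var ∈ X) = 2 := by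
      rw [← htwo c hc hcX]
      have := congrArg (List.countP fun x => decide (x ∈ X)) (vars_flipClause X c)
      rwa [List.countP_reverse, List.countP_map, List.countP_map] at this
    have h3 := pairEqs_flipClause_ne_nil h1 h2
    rw [flipClause_flipClause] at h3
    exact h3 (h _ (List.mem_map_of_mem (hmemF c hc)))
  have hkeep : (initNode G.raw).2 =
      (F.filter fun c => decide (mateEqs G.raw (Clause.raw c) = [])).map Clause.raw := by
    have h2 : G.raw = (flips F X).map Clause.raw ++ F.map Clause.raw := List.map_append
    generalize hm : mateEqs G.raw = m at hmate'
    have h1 : ((flips F X).map Clause.raw).filter (fun c => decide (m c = [])) = [] := by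
      rw [List.filter_eq_nil_iff]
      simp only [flips, List.map_reverse, List.mem_reverse, List.forall_mem_map, List.mem_filter]
      rintro c ⟨hc, hcX⟩
      simpa using hmate' c hc (by simpa using hcX)
    rw [initNode, hm]
    simp only
    rw [h2, List.filter_append, h1, List.nil_append, List.filter_map]
    rfl
  rw [hkeep]
  refine work_filter_le X _ F ∅ _ (fun x hx => by simp at hx) ?_ ?_
  · intro c hc hcX
    refine ⟨by simpa using hmate c hc hcX, (decided_pairEqs (hF c hc) (htwo c hc hcX)).mono ?_
      subset_rfl⟩
    intro v hv
    exact ((models_initNode _ _).1 hv).2 _ (List.mem_map_of_mem (hmemF c hc)) _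
      (List.mem_map_of_mem (hflip c hc hcX))
  · intro c hc hk v hv
    exact exact_of_models_initNode hGF.nodup_raw hv (List.mem_map_of_mem (hmemF c hc))
      (by simpa using hk)

lemma sum_length_le (F : Formula) : (F.map fun c => 2 * c.length + 1).sum ≤ 2 * F.length := by
  have h1 : ∀ F : Formula, (F.map fun c => 2 * c.length + 1).sum ≤ 2 * (enc F).size := by
    intro F
    induction F with
    | nil => simp
    | cons c F ih =>
      have := length_lt_size_enc c
      rw [List.map_cons, List.sum_cons, enc_cons]
      simp only [Val.size]
      omega
  exact h1 F

end Formula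

/-- There is a solver with which the algorithm `P` runs in time `O(2 ^ n)`. -/
theorem exists_decidesXSAT_and_runs : ∃ (m : ℕ) (S : Cmd (m + 1)),
    DecidesXSAT S ∧ RunsInPolySpaceAndTime 2 (algorithmP S) := by
  obtain ⟨S, p, hS⟩ := exists_solver
  -- The time factor is the size of the search tree. No bound for it on a single formula is needed,
  -- only a bound for the sum over all good `X`.
  refine ⟨1, S, fun F hF => ?_, runs_algorithmP (p := p)
    (M := fun G => work (initNode G.raw).1.models (initNode G.raw).2) (fun G _ => ?_)
    ⟨2 * Polynomial.X + 1, fun F hF => ?_⟩⟩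
  · obtain ⟨s, t, w, h1, h2, -⟩ := hS F.raw
    rw [enc_formula_raw] at h1
    exact ⟨s, t, w, h1, h2.trans (Formula.sat_initNode_raw hF)⟩
  · obtain ⟨s, t, w, h1, -, h3⟩ := hS G.raw
    rw [enc_formula_raw] at h1 h3
    exact ⟨s, t, w, h1, h3⟩
  · have h1 := Formula.sum_good_weight_le (φ := fun r => r + 1) (β := 2)
      (fun r => Nat.succ_pos r) (fun r => by exact_mod_cast succ_add_choose_two_le r) (by norm_num)
      F hF
    have h2 : ∑ X ∈ F.vars.powerset,
        (if F.Good X then Formula.weight (fun r => r + 1) X ∅ F else 0) ≤ 2 ^ F.vars.card := by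
      have h3 : ((∑ X ∈ F.vars.powerset,
          (if F.Good X then Formula.weight (fun r => r + 1) X ∅ F else 0) : ℕ) : ℝ) ≤
          ((2 ^ F.vars.card : ℕ) : ℝ) := by
        push_cast
        exact h1
      exact_mod_cast h3
    simp only [Polynomial.eval_add, Polynomial.eval_mul, Polynomial.eval_X, Polynomial.eval_ofNat,
      Polynomial.eval_one]
    refine le_trans ?_ (Nat.mul_le_mul_left _ h2)
    rw [Finset.mul_sum]
    refine Finset.sum_le_sum fun X _ => ?_
    rw [solverCost]
    split_ifs with hX
    · refine (Formula.work_flips_append_le hF hX).trans (Nat.mul_le_mul_right _ ?_)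
      have := F.sum_length_le
      omega
    · exact Nat.zero_le _

theorem mainTheorem2 :
    (∃ (m : ℕ) (S : Cmd (m + 1)), DecidesXSAT S ∧ RunsInPolySpaceAndTime 2 (algorithmP S)) ∧
    (∀ (m : ℕ) (S : Cmd (m + 1)), DecidesXSAT S → RunsInPolySpaceAndTime 1.1749 S →
      RunsInPolySpaceAndTime 2 (algorithmP S)) :=
  ⟨exists_decidesXSAT_and_runs, fun _ S _ h => runs_algorithmP_of_fast S h⟩
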